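/- **Setting.** Covariates $X\in\mathbb R^d$ have a known density $q$ with respect to a $\sigma$-finite reference measure; given $X=x$, the side information $W\in\mathbb R^m$ and the outcome $Y\in\mathbb R$ have joint conditional law $\kappa(x)$. Write $\mathbb E$ for expectation under this population law, assume $\mathbb E|Y|<\infty$, and let $\theta=\mathbb E[Y]$, $\mu(x)=\mathbb E[Y\mid X=x]$. For a predictor $f$ put $F=f(X,W)$, $$\tau(x,v)=\mathbb E[Y\mid X=x,F=v],\quad \alpha(x)=\operatorname{Var}(\mathbb E[Y\mid X,F]\mid X=x),\quad \beta(x)=\mathbb E[\operatorname{Var}(Y\mid X,F)\mid X=x],$$ and, for a density $p$ and an experiment probability $\pi$, $$V(p,\pi)=\mathbb E_{X\sim p}\Big[\tfrac{q^2(X)}{p^2(X)}\Big(\tfrac{1}{\pi(X)}\beta(X)+\alpha(X)\Big)\Big].$$ **Adaptive experiment.** Fix $\gamma\in[0,1]$ and $0<\sigma_{\min}\le\sigma_{\max}$. Let $\mathcal F_{t-1}$ be the information available before step $t\ge1$. The predictor $f_t$ and the estimators $\hat\mu^{(1)}_t,\hat\mu^{(2)}_t,\hat\beta_t$ (functions of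 $x$) and $\hat\tau^{(1)}_t,\hat\tau^{(2)}_t$ (functions of $(x,v)$) are $\mathcal F_{t-1}$-measurable and otherwise arbitrary. Let $\hat\alpha_t$ be $\hat\mu^{(2)}_t-(\hat\mu^{(1)}_t)^2$ truncated to $[\sigma_{\min},\sigma_{\max}]$; let $\hat p_1=q$, $\hat\pi_1=1$ and, for $t\ge2$, $$\hat p_t=\frac{q\sqrt{\hat\alpha_t}}{\mathbb E_{X\sim q}\sqrt{\hat\alpha_t(X)}},\qquad \hat\pi_t=\min\Big\{\frac{\gamma\sqrt{\hat\beta_t/\hat\alpha_t}}{\mathbb E_{X\sim\hat p_t}\sqrt{\hat\beta_t(X)/\hat\alpha_t(X)}},\,1\Big\}.$$ At step $t$, given $\mathcal F_{t-1}$: $X_t\sim\hat p_t$; then $(W_t,Y_t)\sim\kappa(X_t)$ and $F_t=f_t(X_t,W_t)$; then $\Delta_t\in\{0,1\}$ equals $1$ with probability $\hat\pi_t(X_t)$, independently of $(W_t,Y_t)$ given $\mathcal F_{t-1},X_t$; the outcome $Y_t$ is observed if and only if $\Delta_t=1$. The adaptive one-step estimator is $$\hat\theta_T^{Adap}=\frac1T\sum_{t=1}^T\Big[\mathbb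 E_{X\sim q}[\hat\mu^{(1)}_t(X)]+\tfrac{\Delta_t q(X_t)}{\hat\pi_t(X_t)\hat p_t(X_t)}\big(Y_t-\hat\mu^{(1)}_t(X_t)\big)+\tfrac{(\Delta_t-\hat\pi_t(X_t))q(X_t)}{\hat\pi_t(X_t)\hat p_t(X_t)}\big(\hat\mu^{(1)}_t(X_t)-\hat\tau^{(1)}_t(X_t,F_t)\big)\Big].$$ **Theorem.** Let $f^*$ be a measurable predictor and let $\tau,\alpha,\beta,V$ be those of $F=f^*(X,W)$. Assume: (a) Almost surely, as $t\to\infty$, for almost every $(x,w)$ under the population law: $f_t(x,w)\to f^*(x,w)$, $\hat\mu^{(1)}_t(x)\to\mu(x)$, $\hat\mu^{(2)}_t(x)\to\mathbb E[\tau(X,F)^2\mid X=x]$, $\hat\tau^{(1)}_t(x,f_t(x,w))\to\tau(x,f^*(x,w))$, $\hat\tau^{(2)}_t(x,f_t(x,w))\to\mathbb E[Y^2\mid X=x,F=f^*(x,w)]$ and $\hat\beta_t(x)\to\beta(x)$. Moreover, almost surely, the convergence of $\hat\mu^{(1)}_t$ and $\hat\tau^{(1)}_t$ also holds in $L^2$,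 and that of $\hat\beta_t$ also in $L^1$, of the population law. (b) Under the population law, $Y-\mathbb E[Y\mid X]$ and $X-\mathbb E[X]$ are sub-Gaussian. (c) $\sigma_{\min}\le\alpha(x)\le\sigma_{\max}$ for $q$-almost every $x$, and there is a constant $\pi_{\min}>0$ such that, almost surely, $\hat\pi_t(x)\ge\pi_{\min}$ for all $t$ and $q$-almost every $x$. Let $$p^*=\frac{q\sqrt{\alpha}}{\mathbb E_{X\sim q}\sqrt{\alpha(X)}},\qquad \pi^*=\min\Big\{\frac{\gamma\sqrt{\beta/\alpha}}{\mathbb E_{X\sim p^*}\sqrt{\beta(X)/\alpha(X)}},\,1\Big\}$$ (with the convention $0/0=0$ if $\beta=0$ almost everywhere). Then $$\sqrt T\,(\hat\theta_T^{Adap}-\theta)\xrightarrow{d}\mathcal N\big(0,V(p^*,\pi^*)\big)\qquad(T\to\infty),$$ and $\hat\theta_T^{Adap}$ is efficient: $V(p^*,\pi^*)$ is the semiparametric efficiency bound for $\theta$ from an observation $Z=(X,F,\Delta,\Delta Y)$ under the design $(p^*,\pi^*)$ with $F=f^*(X,W)$. That is, $V(p^*,\pi^*)$ is the supremum of the Cramér–Rao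 bounds $(\partial_\varepsilon\theta_\varepsilon|_{\varepsilon=0})^2/I(g)$ over the submodels in which the conditional law of $(F,Y)$ given $X$ has density $1+\varepsilon g$ relative to the true one, where $g(X,F,Y)$ is bounded with $\mathbb E[g\mid X]=0$, and $I(g)=\mathbb E[(\Delta g+(1-\Delta)\mathbb E[g\mid X,F])^2]$ is the Fisher information of $Z$ about $\varepsilon$ at $\varepsilon=0$, assumed positive. -/

import Mathlib

open MeasureTheory ProbabilityTheory Filter Topology
open scoped NNReal ENNReal

noncomputable section

namespace PGAE

/-- The population. Covariates `X` live in `ℝ^d` and have density `q` with respect to a reference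
measure `ν` (Lebesgue measure, or counting measure for discrete covariates);
`κ x` is the conditional law of `(W, Y)` given `X = x`, where `W ∈ ℝ^m` is the side information
and `Y ∈ ℝ` the outcome. -/
structure Population (d m : ℕ) where
  ν : Measure (EuclideanSpace ℝ (Fin d))
  sigmaFinite_ν : SigmaFinite ν
  q : EuclideanSpace ℝ (Fin d) → ℝ
  measurable_q : Measurable q
  q_nonneg : ∀ x, 0 ≤ q x
  lintegral_q : ∫⁻ x, ENNReal.ofReal (q x) ∂ν = 1
  κ : Kernel (EuclideanSpace ℝ (Fin d)) (EuclideanSpace ℝ (Fin m) × ℝ)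
  isMarkovKernel_κ : IsMarkovKernel κ

namespace Population

variable {d m : ℕ} (pop : Population d m)

instance : SigmaFinite pop.ν := pop.sigmaFinite_ν

instance : IsMarkovKernel pop.κ := pop.isMarkovKernel_κ

/-- The law on covariates with density `p`. -/
def covLaw (p : EuclideanSpace ℝ (Fin d) → ℝ) : Measure (EuclideanSpace ℝ (Fin d)) :=
  pop.ν.withDensity fun x => ENNReal.ofReal (p x)

instance (p : EuclideanSpace ℝ (Fin d) → ℝ) : SFinite (pop.covLaw p) := by
  unfold covLaw; infer_instance

instance : IsProbabilityMeasure (pop.covLaw pop.q) :=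
  ⟨by simp [covLaw, pop.lintegral_q]⟩

/-- The population law of `(X, W, Y)`, i.e. `X ∼ q` and `(W, Y) ∣ X ∼ κ X`. -/
def law : Measure (EuclideanSpace ℝ (Fin d) × EuclideanSpace ℝ (Fin m) × ℝ) :=
  pop.covLaw pop.q ⊗ₘ pop.κ

instance : IsProbabilityMeasure pop.law := by
  unfold law; infer_instance

/-- The population mean `θ = E[Y]`. -/
def θ : ℝ := ∫ z, z.2.2 ∂pop.law

/-- `μ(x) = E[Y ∣ X = x]`. -/
def μ (x : EuclideanSpace ℝ (Fin d)) : ℝ := ∫ z, z.2 ∂pop.κ x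

variable (f : EuclideanSpace ℝ (Fin d) → EuclideanSpace ℝ (Fin m) → ℝ)

/-- The conditional law of `Y` given `(X, F) = (x, v)`, where `F = f (X, W)`. -/
def condY : Kernel (EuclideanSpace ℝ (Fin d) × ℝ) ℝ :=
  condDistrib (fun z : EuclideanSpace ℝ (Fin d) × EuclideanSpace ℝ (Fin m) × ℝ => z.2.2)
    (fun z => (z.1, f z.1 z.2.1)) pop.law

/-- `τ(x, v) = E[Y ∣ X = x, F = v]`. -/
def τ (x : EuclideanSpace ℝ (Fin d)) (v : ℝ) : ℝ := ∫ y, y ∂pop.condY f (x, v)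

/-- `E[Y² ∣ X = x, F = v]`. -/
def τsq (x : EuclideanSpace ℝ (Fin d)) (v : ℝ) : ℝ := ∫ y, y ^ 2 ∂pop.condY f (x, v)

/-- `E[(E[Y ∣ X, F])² ∣ X = x]`. -/
def μsq (x : EuclideanSpace ℝ (Fin d)) : ℝ := ∫ z, (pop.τ f x (f x z.1)) ^ 2 ∂pop.κ x

/-- `α(x) = Var(E[Y ∣ X, F] ∣ X = x)`. -/
def α (x : EuclideanSpace ℝ (Fin d)) : ℝ :=
  variance (fun z : EuclideanSpace ℝ (Fin m) × ℝ => pop.τ f x (f x z.1)) (pop.κ x)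

/-- `β(x) = E[Var(Y ∣ X, F) ∣ X = x]`. -/
def β (x : EuclideanSpace ℝ (Fin d)) : ℝ :=
  ∫ z, variance (fun y : ℝ => y) (pop.condY f (x, f x z.1)) ∂pop.κ x

/-- `V(p, π) = E_{X ∼ p}[q(X)² / p(X)² * (β(X) / π(X) + α(X))]`. -/
def V (p π : EuclideanSpace ℝ (Fin d) → ℝ) : ℝ :=
  ∫ x, (pop.q x) ^ 2 / (p x) ^ 2 * (1 / π x * pop.β f x + pop.α f x) ∂pop.covLaw p

/-- The design density computed from a variance function `a`: `q √a / E_q[√a]`. -/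
def density (a : EuclideanSpace ℝ (Fin d) → ℝ) (x : EuclideanSpace ℝ (Fin d)) : ℝ :=
  pop.q x * √(a x) / ∫ x', √(a x') ∂pop.covLaw pop.q

/-- The experiment probability computed from variance functions `a` and `b`:
`γ √(b / a) / E_{X ∼ p}[√(b / a)]` capped at one, where `p = density a`. -/
def expProb (γ : ℝ) (a b : EuclideanSpace ℝ (Fin d) → ℝ) (x : EuclideanSpace ℝ (Fin d)) : ℝ :=
  min (γ * √(b x / a x) / ∫ x', √(b x' / a x') ∂pop.covLaw (pop.density a)) 1

/-- The target sampling density `p⋆ ∝ q √α`. -/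
def pStar (x : EuclideanSpace ℝ (Fin d)) : ℝ := pop.density (pop.α f) x

/-- The target experiment probability `π⋆ ∝ γ √(β / α)`, normalised by `E_{p⋆}[π⋆] = γ`
(and capped at one, should the normalised function exceed one). -/
def πStar (γ : ℝ) (x : EuclideanSpace ℝ (Fin d)) : ℝ :=
  pop.expProb γ (pop.α f) (pop.β f) x

/-! ### The semiparametric efficiency bound

The observation is `Z = (X, F, Δ, Δ Y)` with `X ∼ p`, `Δ ∣ X ∼ Bernoulli (π X)` independent of
`(F, Y)` given `X`; `p` and `π` are known and the law of `(F, Y)` given `X` is unknown.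
A direction is a bounded function `g (x, v, y)` with `E[g (X, F, Y) ∣ X] = 0`; it spans the
submodel under which the conditional law of `(F, Y)` given `X` has density `1 + ε g` with respect
to the true one. -/

/-- `g` is an admissible direction. -/
structure IsDirection (g : EuclideanSpace ℝ (Fin d) → ℝ → ℝ → ℝ) : Prop where
  measurable : Measurable fun z : EuclideanSpace ℝ (Fin d) × ℝ × ℝ => g z.1 z.2.1 z.2.2
  bounded : ∃ C : ℝ, ∀ x v y, |g x v y| ≤ C
  mean_zero : ∀ᵐ x ∂pop.covLaw pop.q, ∫ z, g x (f x z.1) z.2 ∂pop.κ x = 0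

/-- The mean outcome `θ_ε = E_{X ∼ q}[E_ε[Y ∣ X]]` under the submodel in direction `g`. -/
def θPath (g : EuclideanSpace ℝ (Fin d) → ℝ → ℝ → ℝ) (ε : ℝ) : ℝ :=
  ∫ z, z.2.2 * (1 + ε * g z.1 (f z.1 z.2.1) z.2.2) ∂pop.law

/-- The score at `ε = 0` of the observation when it is not labelled, `E[g ∣ X = x, F = v]`.
(For a labelled observation the score is `g` itself.) -/
def scoreUnlabelled (g : EuclideanSpace ℝ (Fin d) → ℝ → ℝ → ℝ) (x : EuclideanSpace ℝ (Fin d))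
    (v : ℝ) : ℝ :=
  ∫ y, g x v y ∂pop.condY f (x, v)

/-- The Fisher information about `ε` at `ε = 0` carried by one observation `Z`, namely
`E[(Δ g + (1 - Δ) E[g ∣ X, F])²]` under the design `(p, π)`. -/
def information (p π : EuclideanSpace ℝ (Fin d) → ℝ)
    (g : EuclideanSpace ℝ (Fin d) → ℝ → ℝ → ℝ) : ℝ :=
  ∫ z, (π z.1 * (g z.1 (f z.1 z.2.1) z.2.2) ^ 2
      + (1 - π z.1) * (pop.scoreUnlabelled f g z.1 (f z.1 z.2.1)) ^ 2)
    ∂(pop.covLaw p ⊗ₘ pop.κ)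

/-- `v` is the semiparametric efficiency bound for `θ` under the design `(p, π)`: the supremum,
over the submodels above, of the Cramér–Rao bounds `(dθ_ε / dε)² / information` at `ε = 0`. -/
def IsEfficiencyBound (p π : EuclideanSpace ℝ (Fin d) → ℝ) (v : ℝ) : Prop :=
  IsLUB {c : ℝ | ∃ g, pop.IsDirection f g ∧ 0 < pop.information f p π g ∧
    c = (deriv (pop.θPath f g) 0) ^ 2 / pop.information f p π g} v

end Population

/-- The random variables and the random functions of an adaptive experiment. Time starts at `0`.
`X t, W t, Y t, Δ t` are the covariate, side information, outcome and experiment indicator of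
step `t`; `f t` is the predictor used at step `t`; `μ₁ t, μ₂ t, τ₁ t, τ₂ t, β t` are the estimators,
available before step `t`, of `E[Y ∣ X]`, `E[(E[Y ∣ X, F])² ∣ X]`, `E[Y ∣ X, F]`, `E[Y² ∣ X, F]` and
`E[Var(Y ∣ X, F) ∣ X]`. -/
structure Experiment (Ω : Type*) (d m : ℕ) where
  X : ℕ → Ω → EuclideanSpace ℝ (Fin d)
  W : ℕ → Ω → EuclideanSpace ℝ (Fin m)
  Y : ℕ → Ω → ℝ
  Δ : ℕ → Ω → ℝ
  f : ℕ → Ω → EuclideanSpace ℝ (Fin d) → EuclideanSpace ℝ (Fin m) → ℝ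
  μ₁ : ℕ → Ω → EuclideanSpace ℝ (Fin d) → ℝ
  μ₂ : ℕ → Ω → EuclideanSpace ℝ (Fin d) → ℝ
  τ₁ : ℕ → Ω → EuclideanSpace ℝ (Fin d) → ℝ → ℝ
  τ₂ : ℕ → Ω → EuclideanSpace ℝ (Fin d) → ℝ → ℝ
  β : ℕ → Ω → EuclideanSpace ℝ (Fin d) → ℝ

namespace Experiment

variable {Ω : Type*} {d m : ℕ} (e : Experiment Ω d m) (pop : Population d m) (γ σmin σmax : ℝ)

/-- The prediction `F_t = f_t (X_t, W_t)`. -/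
def F (t : ℕ) (ω : Ω) : ℝ := e.f t ω (e.X t ω) (e.W t ω)

/-- The estimator `μ₂ - μ₁²` of `α`, truncated to `[σmin, σmax]`. -/
def α (t : ℕ) (ω : Ω) (x : EuclideanSpace ℝ (Fin d)) : ℝ :=
  max σmin (min (e.μ₂ t ω x - (e.μ₁ t ω x) ^ 2) σmax)

/-- The sampling density of step `t`: it is `q` at the first step, and the plug-in density
`q √α_t / E_q[√α_t]` afterwards. -/
def p (t : ℕ) (ω : Ω) (x : EuclideanSpace ℝ (Fin d)) : ℝ :=
  if t = 0 then pop.q x else pop.density (e.α σmin σmax t ω) x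

/-- The experiment probability of step `t`: it is `1` at the first step, and the plug-in
`min {γ √(β_t / α_t) / E_{p_t}[√(β_t / α_t)], 1}` afterwards. -/
def π (t : ℕ) (ω : Ω) (x : EuclideanSpace ℝ (Fin d)) : ℝ :=
  if t = 0 then 1 else pop.expProb γ (e.α σmin σmax t ω) (e.β t ω) x

/-- The estimated influence function at the observation of step `t`. -/
def influence (t : ℕ) (ω : Ω) : ℝ :=
  let x := e.X t ω
  let pt := e.p pop σmin σmax t ω x
  let πt := e.π pop γ σmin σmax t ω x
  e.Δ t ω * pop.q x / (πt * pt) * (e.Y t ω - e.μ₁ t ω x)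
    + (e.Δ t ω - πt) * pop.q x / (πt * pt) * (e.μ₁ t ω x - e.τ₁ t ω x (e.F t ω))

/-- The adaptive one-step estimator from the first `T` observations. -/
def estimator (T : ℕ) (ω : Ω) : ℝ :=
  1 / (T : ℝ) * ∑ t ∈ Finset.range T,
    ((∫ x, e.μ₁ t ω x ∂pop.covLaw pop.q) + e.influence pop γ σmin σmax t ω)

/-- The experiment follows the adaptive protocol. `ℱ t` is the information available before step
`t` (the data of the earlier steps and, possibly, auxiliary randomisation); the predictor and the
estimators of step `t` are computed from it. -/
structure FollowsProtocol [MeasurableSpace Ω] (P : Measure Ω)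
    (ℱ : Filtration ℕ (inferInstance : MeasurableSpace Ω)) : Prop where
  adapted_X : ∀ t, Measurable[ℱ (t + 1)] (e.X t)
  adapted_W : ∀ t, Measurable[ℱ (t + 1)] (e.W t)
  adapted_Y : ∀ t, Measurable[ℱ (t + 1)] (e.Y t)
  adapted_Δ : ∀ t, Measurable[ℱ (t + 1)] (e.Δ t)
  Δ_mem : ∀ t ω, e.Δ t ω = 0 ∨ e.Δ t ω = 1
  predictable_f : ∀ t, Measurable[(ℱ t).prod inferInstance]
    fun z : Ω × EuclideanSpace ℝ (Fin d) × EuclideanSpace ℝ (Fin m) => e.f t z.1 z.2.1 z.2.2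
  predictable_μ₁ : ∀ t, Measurable[(ℱ t).prod inferInstance]
    fun z : Ω × EuclideanSpace ℝ (Fin d) => e.μ₁ t z.1 z.2
  predictable_μ₂ : ∀ t, Measurable[(ℱ t).prod inferInstance]
    fun z : Ω × EuclideanSpace ℝ (Fin d) => e.μ₂ t z.1 z.2
  predictable_τ₁ : ∀ t, Measurable[(ℱ t).prod inferInstance]
    fun z : Ω × EuclideanSpace ℝ (Fin d) × ℝ => e.τ₁ t z.1 z.2.1 z.2.2
  predictable_τ₂ : ∀ t, Measurable[(ℱ t).prod inferInstance]
    fun z : Ω × EuclideanSpace ℝ (Fin d) × ℝ => e.τ₂ t z.1 z.2.1 z.2.2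
  predictable_β : ∀ t, Measurable[(ℱ t).prod inferInstance]
    fun z : Ω × EuclideanSpace ℝ (Fin d) => e.β t z.1 z.2
  /-- Given the past, `X_t` has density `p_t`. -/
  sample_X : ∀ t, ∀ A : Set (EuclideanSpace ℝ (Fin d)), MeasurableSet A →
    P⟦e.X t ⁻¹' A | ℱ t⟧ =ᵐ[P] fun ω => (pop.covLaw (e.p pop σmin σmax t ω)).real A
  /-- Given the past and `X_t`, the pair `(W_t, Y_t)` is drawn from the population kernel. -/
  sample_WY : ∀ t, ∀ B : Set (EuclideanSpace ℝ (Fin m) × ℝ), MeasurableSet B →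
    P⟦(fun ω => (e.W t ω, e.Y t ω)) ⁻¹' B | ℱ t ⊔ MeasurableSpace.comap (e.X t) inferInstance⟧
      =ᵐ[P] fun ω => (pop.κ (e.X t ω)).real B
  /-- Given the past and `(X_t, W_t, Y_t)`, the outcome is observed with probability
  `π_t (X_t)`. -/
  sample_Δ : ∀ t,
    P⟦{ω | e.Δ t ω = 1} | ℱ t ⊔ MeasurableSpace.comap
        (fun ω => (e.X t ω, e.W t ω, e.Y t ω)) inferInstance⟧
      =ᵐ[P] fun ω => e.π pop γ σmin σmax t ω (e.X t ω)

end Experiment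

end PGAE

end

/-! ### A central limit theorem for martingale differences -/

namespace MartingaleCLT

/-! Let ρ_t = p̂_t / q, let τ̂_t be the plug-in prediction τ̂⁽¹⁾_t(X, f_t(X, W)) and write μ̂_t for
μ̂⁽¹⁾_t. The t-th summand of the estimator minus θ equals A_t + Δ_t B_t, with A_t = (τ̂_t −
μ̂_t)/ρ_t + (E_q μ̂_t − θ) and B_t = (Y − τ̂_t)/(ρ_t π̂_t) (`stepA`, `stepB`). Given the past, the
sampled point has density ρ_t with respect to the population law and Δ_t has mean π̂_t. The
conditional mean is therefore E[ρ(A + πB)] = E[Y − μ̂_t] + E_q μ̂_t − θ = 0, however bad the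
estimators are (`condExp_increment`). The estimation error is thus an average of martingale
differences.

Their conditional variances are E[ρ(A² + π(2AB + B²))], and the L² convergence of the estimators
sends them to V(p*, π*) (`tendsto_condVar`). To secure second moments and bounded conditional
variances, the differences are truncated to the event `good`, which is decided before step t. Almost
surely it occurs for all large t, so only finitely many summands change and the factor 1/√T removes
them. The Lindeberg condition holds because an increment is dominated by a fixed square-integrable
envelope plus an estimation error that vanishes in mean square (`tendsto_lindeberg`). The central
limit theorem itself comes from characteristic functions: multiplying by the exponential of the
predictable variance turns exp(iuS) into an almost-martingale with expectation tending to 1.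

For efficiency, split a direction g into s = E[g | X, F] and g − s. The derivative of the mean is D
= E[(Y − τ)(g − s) + (τ − μ)s] (`deriv_θPath`) and the information is I = E[ρπ(g − s)² + ρs²]
(`information_eq`). Cauchy–Schwarz gives D²/I ≤ E[(Y − τ)²/(ρπ) + (τ − μ)²/ρ] = V, with equality for
g − s = (Y − τ)/(ρπ) and s = (τ − μ)/ρ. This optimal direction may be unbounded; truncating and
recentring it gives admissible directions whose bounds approach V (`isEfficiencyBound_V`).

If β = 0 almost everywhere, then π* = 0 and the π̂_t need not converge. In that case Y = τ(X, F)
almost surely, so every limit term containing 1/π has a vanishing factor; this dichotomy is carried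
through both halves. -/

/-- The minimum is the point: the cubic bound is small at the scale y ~ T^(-1/2), while the
quadratic one keeps the remainder integrable for variables with only two moments. -/
lemma norm_cexp_sub_taylor_two_le (y : ℝ) :
    ‖Complex.exp (Complex.I * y) - (1 + Complex.I * y - y ^ 2 / 2)‖
      ≤ 4 * min (y ^ 2) (|y| ^ 3) := by
  rcases le_or_gt |y| 1 with h | h
  · have h1 := Complex.norm_exp_sub_sum_le_norm_mul_exp (Complex.I * y) 3
    have hn : ‖Complex.I * (y : ℂ)‖ = |y| := by simp
    have h2 : (∑ m ∈ Finset.range 3, (Complex.I * (y : ℂ)) ^ m / (m.factorial : ℂ))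
        = 1 + Complex.I * y - y ^ 2 / 2 := by
      simp only [Finset.sum_range_succ, Finset.sum_range_zero, Nat.factorial, mul_pow,
        Complex.I_sq]
      push_cast; ring
    rw [h2, hn] at h1
    have h3 : Real.exp |y| ≤ 4 := by
      have := Real.exp_one_lt_d9
      have h4 : Real.exp |y| ≤ Real.exp 1 := Real.exp_le_exp.2 h
      linarith
    have h5 : min (y ^ 2) (|y| ^ 3) = |y| ^ 3 := by
      apply min_eq_right
      rw [← sq_abs y]
      exact pow_le_pow_of_le_one (abs_nonneg y) h (by norm_num)
    rw [h5]
    calc _ ≤ |y| ^ 3 * Real.exp |y| := h1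
      _ ≤ |y| ^ 3 * 4 := by gcongr
      _ = _ := by ring
  · have h5 : min (y ^ 2) (|y| ^ 3) = |y| ^ 2 := by
      rw [← sq_abs y]
      apply min_eq_left
      exact pow_le_pow_right₀ h.le (by norm_num)
    rw [h5]
    have e1 : ‖Complex.exp (Complex.I * y)‖ = 1 := Complex.norm_exp_I_mul_ofReal y
    have e2 : ‖(1 + Complex.I * y - y ^ 2 / 2 : ℂ)‖ ≤ 1 + |y| + |y| ^ 2 / 2 := by
      refine (norm_sub_le _ _).trans ?_
      refine add_le_add ((norm_add_le _ _).trans ?_) ?_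
      · simp
      · simp
    refine (norm_sub_le _ _).trans ?_
    nlinarith

/-- In one telescoping step the compensating factor e^a meets the second-order mean 1 − a of the
oscillating factor. Their product is 1 up to order a², which is T⁻² after scaling. -/
lemma abs_exp_mul_one_sub_sub_one_le {a : ℝ} (ha : 0 ≤ a) :
    |Real.exp a * (1 - a) - 1| ≤ Real.exp a * a ^ 2 := by
  have h1 : 1 - a ≤ Real.exp (-a) := by have := Real.add_one_le_exp (-a); linarith
  have h2 : Real.exp (-a) ≤ 1 - a + a ^ 2 := by
    have h3 := Real.add_one_le_exp a
    -- This rests on e^a ≥ 1 + a and (1 + a)(1 − a + a²) = 1 + a³ ≥ 1.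
    rw [Real.exp_neg, inv_le_comm₀ (Real.exp_pos a) (by nlinarith)]
    refine le_trans ?_ h3
    rw [inv_le_iff_one_le_mul₀ (by nlinarith)]
    nlinarith [pow_nonneg ha 3]
  have h4 : Real.exp a * Real.exp (-a) = 1 := by rw [← Real.exp_add]; simp
  have hp := Real.exp_pos a
  rw [abs_le]
  constructor <;> nlinarith

lemma integrable_min_sq_cube {Ω : Type*} {mΩ : MeasurableSpace Ω} {P : Measure Ω}
    {f : Ω → ℝ} (hf : MemLp f 2 P) {s : ℝ} (hs : 0 ≤ s) :
    Integrable (fun ω => min ((f ω) ^ 2) (|f ω| ^ 3 / s)) P := by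
  refine hf.integrable_sq.mono ?_ (ae_of_all _ fun ω => ?_)
  · have := hf.1.aemeasurable
    exact AEMeasurable.aestronglyMeasurable (by fun_prop)
  · have h0 : 0 ≤ min ((f ω) ^ 2) (|f ω| ^ 3 / s) := le_min (by positivity) (by positivity)
    rw [Real.norm_of_nonneg h0, Real.norm_of_nonneg (sq_nonneg _)]
    exact min_le_left _ _

variable {Ω : Type*} {mΩ : MeasurableSpace Ω} {P : Measure Ω} [IsProbabilityMeasure P]

/-- A bounded `m`-measurable complex weight sees only the conditional expectation given `m`. -/
lemma integral_mul_ofReal_of_condExp {m : MeasurableSpace Ω} (hm : m ≤ mΩ) {W : Ω → ℂ} {C : ℝ}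
    (hW : StronglyMeasurable[m] W) (hWb : ∀ ω, ‖W ω‖ ≤ C) {f g : Ω → ℝ} (hf : Integrable f P)
    (h : P[f|m] =ᵐ[P] g) : ∫ ω, W ω * (f ω : ℂ) ∂P = ∫ ω, W ω * (g ω : ℂ) ∂P := by
  have hs : ∀ᵐ ω ∂P, ‖W ω‖ ≤ C := ae_of_all _ hWb
  have key := condExp_stronglyMeasurable_bilin_of_bound
    ((ContinuousLinearMap.lsmul ℝ ℝ).flip : ℂ →L[ℝ] ℝ →L[ℝ] ℂ) hm hW hf C hs
  rw [← integral_condExp hm (f := fun ω => W ω * (f ω : ℂ))]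
  refine integral_congr_ae ?_
  have e1 : (fun ω => W ω * (f ω : ℂ))
      = fun ω => ((ContinuousLinearMap.lsmul ℝ ℝ).flip : ℂ →L[ℝ] ℝ →L[ℝ] ℂ) (W ω) (f ω) := by
    ext ω; simp [mul_comm]
  rw [e1]
  filter_upwards [key, h] with ω h1 h2
  rw [h1, h2]
  simp [mul_comm]

variable {ℱ : Filtration ℕ mΩ} {D v : ℕ → Ω → ℝ} {C V : ℝ}

/-- The partial sums of the first `k` terms, as a measurable function of the past. -/
lemma measurable_sum_range (hD : ∀ k, Measurable[ℱ (k + 1)] (D k)) (k : ℕ) :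
    Measurable[ℱ k] fun ω => ∑ j ∈ Finset.range k, D j ω := by
  refine Finset.measurable_fun_sum _ fun j hj => ?_
  exact (hD j).mono (ℱ.mono (Finset.mem_range.1 hj)) le_rfl

/-- The exponential of the normalised sum, compensated by its predictable variance. -/
noncomputable def compensated (D v : ℕ → Ω → ℝ) (u : ℝ) (T k : ℕ) (ω : Ω) : ℂ :=
  Complex.exp (Complex.I * ((u / √T * ∑ j ∈ Finset.range k, D j ω : ℝ) : ℂ)
    + ((u ^ 2 / (2 * T) * ∑ j ∈ Finset.range k, v j ω : ℝ) : ℂ))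

lemma norm_compensated (u : ℝ) (T k : ℕ) (ω : Ω) :
    ‖compensated D v u T k ω‖ = Real.exp (u ^ 2 / (2 * T) * ∑ j ∈ Finset.range k, v j ω) := by
  rw [compensated, Complex.norm_exp]
  congr 1
  rw [Complex.add_re, Complex.re_mul_ofReal, Complex.ofReal_re]; simp

lemma sum_le_of_mem_Icc (hvb : ∀ k ω, v k ω ∈ Set.Icc 0 C) (u : ℝ) {T k : ℕ} (hk : k ≤ T) (ω : Ω) :
    u ^ 2 / (2 * T) * ∑ j ∈ Finset.range k, v j ω ≤ u ^ 2 * C / 2 := by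
  have hC : 0 ≤ C := (hvb 0 ω).1.trans (hvb 0 ω).2
  have h1 : ∑ j ∈ Finset.range k, v j ω ≤ k * C := by
    calc _ ≤ ∑ j ∈ Finset.range k, C := Finset.sum_le_sum fun j _ => (hvb j ω).2
      _ = _ := by simp
  rcases Nat.eq_zero_or_pos T with rfl | hT
  · simp; positivity
  have hT' : (0 : ℝ) < T := by exact_mod_cast hT
  have hk' : (k : ℝ) ≤ T := by exact_mod_cast hk
  calc _ ≤ u ^ 2 / (2 * T) * (T * C) := by gcongr; exact h1.trans (by gcongr)
    _ = _ := by field_simp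

lemma measurable_compensated (hD : ∀ k, Measurable[ℱ (k + 1)] (D k))
    (hv : ∀ k, Measurable[ℱ k] (v k)) (u : ℝ) (T k : ℕ) :
    Measurable[ℱ k] (compensated D v u T k) := by
  have h1 := measurable_sum_range hD k
  have h2 := measurable_sum_range (fun j => (hv j).mono (ℱ.mono j.le_succ) le_rfl) k
  unfold compensated
  exact Complex.measurable_exp.comp
    (((Complex.measurable_ofReal.comp (h1.const_mul _)).const_mul _).add
      (Complex.measurable_ofReal.comp (h2.const_mul _)))

lemma compensated_succ (u : ℝ) (T k : ℕ) (ω : Ω) :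
    compensated D v u T (k + 1) ω = compensated D v u T k ω
      * Complex.exp ((u ^ 2 / (2 * T) * v k ω : ℝ) : ℂ)
      * Complex.exp (Complex.I * ((u / √T * D k ω : ℝ) : ℂ)) := by
  simp only [compensated]
  rw [← Complex.exp_add, ← Complex.exp_add, Finset.sum_range_succ, Finset.sum_range_succ]
  congr 1
  push_cast
  ring

/-- Extracts the scaling from the Taylor remainder: a prefactor of order 1/T is left in front of the
Lindeberg integrand. -/
lemma min_sq_cube_smul_le (u d : ℝ) {T : ℝ} (hT : 0 < T) :
    min ((u / √T * d) ^ 2) (|u / √T * d| ^ 3)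
      ≤ (u ^ 2 + |u| ^ 3) / T * min (d ^ 2) (|d| ^ 3 / √T) := by
  have hs : 0 < √T := Real.sqrt_pos.2 hT
  have hsq : √T ^ 2 = T := Real.sq_sqrt hT.le
  have e1 : (u / √T * d) ^ 2 = u ^ 2 / T * d ^ 2 := by
    rw [mul_pow, div_pow, hsq]
  have e2 : |u / √T * d| ^ 3 = |u| ^ 3 / T * (|d| ^ 3 / √T) := by
    rw [abs_mul, abs_div, abs_of_pos hs, mul_pow, div_pow]
    rw [show √T ^ 3 = T * √T by rw [pow_succ, hsq]]
    field_simp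
  have k1 : u ^ 2 / T ≤ (u ^ 2 + |u| ^ 3) / T := by gcongr; linarith [pow_nonneg (abs_nonneg u) 3]
  have k2 : |u| ^ 3 / T ≤ (u ^ 2 + |u| ^ 3) / T := by gcongr; linarith [sq_nonneg u]
  rw [e1, e2, mul_min_of_nonneg _ _ (by positivity)]
  exact min_le_min (by gcongr) (by gcongr)

/-- One step of the telescoping argument: the compensated exponential is almost a martingale. -/
lemma norm_integral_compensated_succ_sub_le (hD : ∀ k, Measurable[ℱ (k + 1)] (D k))
    (hD2 : ∀ k, MemLp (D k) 2 P) (h0 : ∀ k, P[D k|ℱ k] =ᵐ[P] 0)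
    (hvm : ∀ k, Measurable[ℱ k] (v k))
    (hv : ∀ k, P[fun ω => (D k ω) ^ 2|ℱ k] =ᵐ[P] v k) (hvb : ∀ k ω, v k ω ∈ Set.Icc 0 C)
    (u : ℝ) {T k : ℕ} (hk : k < T) :
    ‖∫ ω, compensated D v u T (k + 1) ω ∂P - ∫ ω, compensated D v u T k ω ∂P‖
      ≤ Real.exp (u ^ 2 * C / 2) * ((u ^ 2 * C / (2 * T)) ^ 2
        + 4 * ((u ^ 2 + |u| ^ 3) / T) * ∫ ω, min ((D k ω) ^ 2) (|D k ω| ^ 3 / √T) ∂P) := by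
  have hT : (0 : ℝ) < T := by exact_mod_cast (Nat.zero_le k).trans_lt hk
  set a : Ω → ℝ := fun ω => u ^ 2 / (2 * T) * v k ω with ha
  set y : Ω → ℝ := fun ω => u / √T * D k ω with hy
  set Z : Ω → ℂ := compensated D v u T k with hZ
  set W : Ω → ℂ := fun ω => Z ω * Complex.exp (a ω : ℂ) with hW
  have hm : ℱ k ≤ mΩ := ℱ.le k
  have ha0 : ∀ ω, 0 ≤ a ω := fun ω => mul_nonneg (by positivity) (hvb k ω).1
  have haC : ∀ ω, a ω ≤ u ^ 2 * C / (2 * T) := fun ω => by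
    have := (hvb k ω).2
    calc a ω ≤ u ^ 2 / (2 * T) * C := by simp only [ha]; gcongr
      _ = _ := by ring
  have ham : Measurable[ℱ k] a := (hvm k).const_mul _
  have hZm : Measurable[ℱ k] Z := measurable_compensated hD hvm u T k
  have hWm : Measurable[ℱ k] W :=
    hZm.mul (Complex.measurable_exp.comp (Complex.measurable_ofReal.comp ham))
  have hZb : ∀ ω, ‖Z ω‖ ≤ Real.exp (u ^ 2 * C / 2) := fun ω => by
    rw [hZ, norm_compensated]
    exact Real.exp_le_exp.2 (sum_le_of_mem_Icc hvb u hk.le ω)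
  have hWn : ∀ ω, ‖W ω‖ = ‖Z ω‖ * Real.exp (a ω) := fun ω => by
    rw [hW, norm_mul, Complex.norm_exp_ofReal]
  -- The modulus of `W` is that of the compensated exponential at index k + 1, so the same bound
  -- holds without an extra factor.
  have hWb : ∀ ω, ‖W ω‖ ≤ Real.exp (u ^ 2 * C / 2) := fun ω => by
    rw [hWn, hZ, norm_compensated, ← Real.exp_add]
    refine Real.exp_le_exp.2 (le_trans (le_of_eq ?_)
      (sum_le_of_mem_Icc hvb u (Nat.succ_le_of_lt hk) ω))
    rw [Finset.sum_range_succ, mul_add]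
  have hDm : Measurable (D k) := (hD k).mono (ℱ.le _) le_rfl
  have hWm' : Measurable W := hWm.mono hm le_rfl
  have hZm' : Measurable Z := hZm.mono hm le_rfl
  have ham' : Measurable a := ham.mono hm le_rfl
  have hym : Measurable y := hDm.const_mul _
  have hDi : Integrable (D k) P := (hD2 k).integrable (by norm_num)
  have hyi : Integrable y P := hDi.const_mul _
  have hy2 : Integrable (fun ω => (y ω) ^ 2) P := by
    simp only [hy, mul_pow]; exact (hD2 k).integrable_sq.const_mul _
  have bdd : ∀ {f : Ω → ℂ}, Integrable f P → Integrable (fun ω => W ω * f ω) P := fun hf =>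
    hf.bdd_mul hWm'.aestronglyMeasurable (ae_of_all _ hWb)
  have hWi : Integrable W P := Integrable.of_bound hWm'.aestronglyMeasurable _ (ae_of_all _ hWb)
  have hZi : Integrable Z P := Integrable.of_bound hZm'.aestronglyMeasurable _ (ae_of_all _ hZb)
  have I1 : ∫ ω, W ω * (y ω : ℂ) ∂P = 0 := by
    have := integral_mul_ofReal_of_condExp hm hWm.stronglyMeasurable hWb hDi (h0 k)
    have e : (fun ω => W ω * (y ω : ℂ)) = fun ω => ((u / √T : ℝ) : ℂ) * (W ω * (D k ω : ℂ)) := by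
      ext ω; simp only [hy]; push_cast; ring
    rw [e, integral_const_mul, this]; simp
  -- `W` is known before step k, so y² may be replaced by its conditional expectation (u²/T) v = 2a.
  have I2 : ∫ ω, W ω * ((y ω ^ 2 : ℝ) : ℂ) ∂P = 2 * ∫ ω, W ω * (a ω : ℂ) ∂P := by
    have := integral_mul_ofReal_of_condExp hm hWm.stronglyMeasurable hWb (hD2 k).integrable_sq (hv k)
    have e : (fun ω => W ω * ((y ω ^ 2 : ℝ) : ℂ))
        = fun ω => ((u ^ 2 / T : ℝ) : ℂ) * (W ω * ((D k ω ^ 2 : ℝ) : ℂ)) := by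
      ext ω; simp only [hy, mul_pow, div_pow, Real.sq_sqrt hT.le]; push_cast; ring
    have e2 : (fun ω => W ω * (a ω : ℂ))
        = fun ω => ((u ^ 2 / (2 * T) : ℝ) : ℂ) * (W ω * (v k ω : ℂ)) := by
      ext ω; simp only [ha]; push_cast; ring
    rw [e, e2, integral_const_mul, integral_const_mul, this]
    push_cast
    have : (T : ℂ) ≠ 0 := by exact_mod_cast hT.ne'
    field_simp
  set ρ : Ω → ℂ := fun ω =>
    Complex.exp (Complex.I * y ω) - (1 + Complex.I * y ω - (y ω) ^ 2 / 2) with hρ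
  have hρb : ∀ ω, ‖ρ ω‖ ≤ 4 * ((u ^ 2 + |u| ^ 3) / T * min ((D k ω) ^ 2) (|D k ω| ^ 3 / √T)) :=
    fun ω => (norm_cexp_sub_taylor_two_le (y ω)).trans (by
      gcongr; exact min_sq_cube_smul_le u (D k ω) hT)
  have hψ : Integrable (fun ω => min ((D k ω) ^ 2) (|D k ω| ^ 3 / √T)) P :=
    integrable_min_sq_cube (hD2 k) (Real.sqrt_nonneg _)
  have hρi : Integrable ρ P := by
    refine ((hψ.const_mul _).const_mul 4).mono' ?_ (ae_of_all _ hρb)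
    exact Measurable.aestronglyMeasurable (by fun_prop)
  have hai : Integrable (fun ω => (a ω : ℂ)) P := by
    refine Integrable.of_bound (C := u ^ 2 * C / (2 * T))
      (Measurable.aestronglyMeasurable (by fun_prop)) (ae_of_all _ fun ω => ?_)
    rw [Complex.norm_real, Real.norm_of_nonneg (ha0 ω)]; exact haC ω
  have J1 := bdd (f := fun ω => (y ω : ℂ)) hyi.ofReal
  have J2 := bdd (f := fun ω => ((y ω ^ 2 : ℝ) : ℂ)) hy2.ofReal
  have J3 := bdd hρi
  have J4 := bdd hai
  -- Expand e^(iy) = 1 + iy − y²/2 + ρ. The linear term vanishes by `I1`, the quadratic one becomes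
  -- −a by `I2`, and W(1 − a) − Z = Z(e^a(1 − a) − 1).
  have split : ∫ ω, compensated D v u T (k + 1) ω ∂P - ∫ ω, Z ω ∂P
      = ∫ ω, Z ω * ((Real.exp (a ω) * (1 - a ω) - 1 : ℝ) : ℂ) ∂P + ∫ ω, W ω * ρ ω ∂P := by
    have e1 : (fun ω => compensated D v u T (k + 1) ω) = fun ω =>
        ((W ω + Complex.I * (W ω * (y ω : ℂ))) - (1 / 2 : ℂ) * (W ω * ((y ω ^ 2 : ℝ) : ℂ)))
          + W ω * ρ ω := by
      ext ω
      rw [compensated_succ]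
      simp only [hρ, hW, ha, hy, ← hZ]
      push_cast
      ring
    have e2 : (fun ω => Z ω * ((Real.exp (a ω) * (1 - a ω) - 1 : ℝ) : ℂ))
        = fun ω => (W ω - W ω * (a ω : ℂ)) - Z ω := by
      ext ω; simp only [hW]; push_cast; ring
    have K1 : Integrable (fun ω => W ω + Complex.I * (W ω * (y ω : ℂ))) P :=
      hWi.add (J1.const_mul _)
    have K2 : Integrable (fun ω => (1 / 2 : ℂ) * (W ω * ((y ω ^ 2 : ℝ) : ℂ))) P := J2.const_mul _
    have K3 : Integrable (fun ω => W ω + Complex.I * (W ω * (y ω : ℂ))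
        - (1 / 2 : ℂ) * (W ω * ((y ω ^ 2 : ℝ) : ℂ))) P := K1.sub K2
    have K4 : Integrable (fun ω => W ω - W ω * (a ω : ℂ)) P := hWi.sub J4
    rw [e1, e2, integral_add K3 J3, integral_sub K1 K2, integral_add hWi (J1.const_mul _),
      integral_const_mul, integral_const_mul, I1, I2, integral_sub K4 hZi, integral_sub hWi J4]
    ring
  rw [split]
  refine (norm_add_le _ _).trans ?_
  rw [mul_add]
  refine add_le_add ?_ ?_
  · have : ∀ᵐ ω ∂P, ‖Z ω * ((Real.exp (a ω) * (1 - a ω) - 1 : ℝ) : ℂ)‖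
        ≤ Real.exp (u ^ 2 * C / 2) * (u ^ 2 * C / (2 * T)) ^ 2 := ae_of_all _ fun ω => by
      rw [norm_mul, Complex.norm_real, Real.norm_eq_abs]
      calc _ ≤ ‖Z ω‖ * (Real.exp (a ω) * a ω ^ 2) := by
            gcongr; exact abs_exp_mul_one_sub_sub_one_le (ha0 ω)
        _ = ‖W ω‖ * a ω ^ 2 := by rw [hWn]; ring
        _ ≤ _ := by
            gcongr
            · exact hWb ω
            · exact ha0 ω
            · exact haC ω
    simpa using norm_integral_le_of_norm_le_const this
  · calc ‖∫ ω, W ω * ρ ω ∂P‖ ≤ ∫ ω, Real.exp (u ^ 2 * C / 2)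
          * (4 * ((u ^ 2 + |u| ^ 3) / T * min ((D k ω) ^ 2) (|D k ω| ^ 3 / √T))) ∂P := by
          refine norm_integral_le_of_norm_le (((hψ.const_mul _).const_mul 4).const_mul _)
            (ae_of_all _ fun ω => ?_)
          rw [norm_mul]
          gcongr
          · exact hWb ω
          · exact hρb ω
      _ = _ := by
          rw [integral_const_mul, integral_const_mul, integral_const_mul]; ring

/-- Telescoping: the T errors of order T⁻² add up to order T⁻¹, and the Taylor remainders add up to
the Lindeberg average. -/
lemma tendsto_integral_compensated (hD : ∀ k, Measurable[ℱ (k + 1)] (D k))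
    (hD2 : ∀ k, MemLp (D k) 2 P) (h0 : ∀ k, P[D k|ℱ k] =ᵐ[P] 0)
    (hvm : ∀ k, Measurable[ℱ k] (v k))
    (hv : ∀ k, P[fun ω => (D k ω) ^ 2|ℱ k] =ᵐ[P] v k) (hvb : ∀ k ω, v k ω ∈ Set.Icc 0 C)
    (hL : Tendsto (fun T : ℕ => (T : ℝ)⁻¹ * ∑ k ∈ Finset.range T,
      ∫ ω, min ((D k ω) ^ 2) (|D k ω| ^ 3 / √T) ∂P) atTop (𝓝 0)) (u : ℝ) :
    Tendsto (fun T : ℕ => ∫ ω, compensated D v u T T ω ∂P) atTop (𝓝 1) := by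
  rw [tendsto_iff_norm_sub_tendsto_zero]
  have hbound : ∀ T : ℕ, ‖∫ ω, compensated D v u T T ω ∂P - 1‖
      ≤ Real.exp (u ^ 2 * C / 2) * ((u ^ 2 * C / 2) ^ 2 * (T : ℝ)⁻¹
        + 4 * (u ^ 2 + |u| ^ 3) * ((T : ℝ)⁻¹ * ∑ k ∈ Finset.range T,
      ∫ ω, min ((D k ω) ^ 2) (|D k ω| ^ 3 / √T) ∂P)) := fun T => by
    have tel := Finset.sum_range_sub (fun k => ∫ ω, compensated D v u T k ω ∂P) T
    have z0 : ∫ ω, compensated D v u T 0 ω ∂P = 1 := by simp [compensated]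
    simp only [z0] at tel
    rw [← tel]
    refine (norm_sum_le _ _).trans ((Finset.sum_le_sum fun k hk =>
      norm_integral_compensated_succ_sub_le hD hD2 h0 hvm hv hvb u
        (Finset.mem_range.1 hk)).trans (le_of_eq ?_))
    rw [← Finset.mul_sum, Finset.sum_add_distrib, ← Finset.mul_sum]
    congr 1
    simp only [Finset.sum_const, Finset.card_range, nsmul_eq_mul]
    rcases Nat.eq_zero_or_pos T with rfl | hT
    · simp
    have hT' : (0 : ℝ) < T := by exact_mod_cast hT
    field_simp
  refine squeeze_zero (fun _ => norm_nonneg _) hbound ?_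
  have := ((tendsto_inv_atTop_nhds_zero_nat (𝕜 := ℝ)).const_mul ((u ^ 2 * C / 2) ^ 2)).add
    (hL.const_mul (4 * (u ^ 2 + |u| ^ 3)))
  simpa using this.const_mul (Real.exp (u ^ 2 * C / 2))

/-- **Martingale central limit theorem.** The normalised sums of a square-integrable martingale
difference sequence whose conditional variances are bounded and converge almost surely to a
constant `V`, and which satisfies a Lindeberg condition, converge in distribution to
`gaussianReal 0 V`. -/
theorem tendstoInDistribution_inv_sqrt_mul_sum_martingale
    (hD : ∀ k, Measurable[ℱ (k + 1)] (D k))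
    (hD2 : ∀ k, MemLp (D k) 2 P) (h0 : ∀ k, P[D k|ℱ k] =ᵐ[P] 0)
    (hvm : ∀ k, Measurable[ℱ k] (v k))
    (hv : ∀ k, P[fun ω => (D k ω) ^ 2|ℱ k] =ᵐ[P] v k) (hvb : ∀ k ω, v k ω ∈ Set.Icc 0 C)
    (hvlim : ∀ᵐ ω ∂P, Tendsto (fun k => v k ω) atTop (𝓝 V))
    (hL : Tendsto (fun T : ℕ => (T : ℝ)⁻¹ * ∑ k ∈ Finset.range T,
      ∫ ω, min ((D k ω) ^ 2) (|D k ω| ^ 3 / √T) ∂P) atTop (𝓝 0)) :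
    TendstoInDistribution (fun (T : ℕ) ω => (√T)⁻¹ * ∑ k ∈ Finset.range T, D k ω) atTop
      (fun z : ℝ => z) (fun _ => P) (gaussianReal 0 V.toNNReal) := by
  have hDm : ∀ k, Measurable (D k) := fun k => (hD k).mono (ℱ.le _) le_rfl
  have hvm' : ∀ k, Measurable (v k) := fun k => (hvm k).mono (ℱ.le _) le_rfl
  have hSm : ∀ T : ℕ, Measurable fun ω => (√T)⁻¹ * ∑ k ∈ Finset.range T, D k ω := fun T =>
    (Finset.measurable_fun_sum _ fun k _ => hDm k).const_mul _
  have hV : 0 ≤ V := by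
    obtain ⟨ω, hω⟩ := hvlim.exists
    exact ge_of_tendsto' hω fun k => (hvb k ω).1
  refine ⟨fun T => (hSm T).aemeasurable, by fun_prop, ?_⟩
  refine ProbabilityMeasure.tendsto_iff_tendsto_charFun.2 fun u => ?_
  simp only [ProbabilityMeasure.coe_mk, Measure.map_id']
  rw [charFun_gaussianReal]
  have hchar : ∀ T : ℕ, charFun (P.map fun ω => (√T)⁻¹ * ∑ k ∈ Finset.range T, D k ω) u
      = ∫ ω, Complex.exp (Complex.I * ((u / √T * ∑ k ∈ Finset.range T, D k ω : ℝ) : ℂ)) ∂P := by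
    intro T
    rw [charFun_apply_real, integral_map (hSm T).aemeasurable
      (Measurable.aestronglyMeasurable (by fun_prop))]
    refine integral_congr_ae (ae_of_all _ fun ω => ?_)
    simp only
    congr 1
    push_cast
    ring
  simp only [hchar]
  set q : ℕ → Ω → ℝ := fun T ω => u ^ 2 / (2 * T) * ∑ j ∈ Finset.range T, v j ω with hq
  set Y : ℕ → Ω → ℂ := fun T ω =>
    Complex.exp (Complex.I * ((u / √T * ∑ k ∈ Finset.range T, D k ω : ℝ) : ℂ)) with hYdef
  have hY1 : ∀ T ω, ‖Y T ω‖ = 1 := fun T ω => Complex.norm_exp_I_mul_ofReal _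
  have hYm : ∀ T, Measurable (Y T) := fun T => by
    have : Measurable fun ω => ∑ k ∈ Finset.range T, D k ω :=
      Finset.measurable_fun_sum _ fun k _ => hDm k
    fun_prop
  have hqm : ∀ T, Measurable (q T) := fun T =>
    (Finset.measurable_fun_sum _ fun k _ => hvm' k).const_mul _
  have hqlim : ∀ᵐ ω ∂P, Tendsto (fun T => q T ω) atTop (𝓝 (u ^ 2 * V / 2)) := by
    filter_upwards [hvlim] with ω hω
    have := hω.cesaro.const_mul (u ^ 2 / 2)
    refine (this.congr fun T => ?_).trans (le_of_eq (by congr 1; ring))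
    simp only [hq]; field_simp
  have hqb : ∀ T ω, q T ω ≤ u ^ 2 * C / 2 := fun T ω => sum_le_of_mem_Icc hvb u le_rfl ω
  have hcomp : ∀ T ω, compensated D v u T T ω = Y T ω * (Real.exp (q T ω) : ℂ) := fun T ω => by
    simp only [compensated, hYdef, hq]
    rw [Complex.exp_add, Complex.ofReal_exp]
  have main := tendsto_integral_compensated hD hD2 h0 hvm hv hvb hL u
  -- The compensator is still random and sits inside the expectation. It is bounded and tends almost
  -- surely to a constant, so dominated convergence allows replacing it by that constant.
  have diff : Tendsto (fun T => ∫ ω, Y T ω * ((Real.exp (u ^ 2 * V / 2) - Real.exp (q T ω) : ℝ) : ℂ)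
      ∂P) atTop (𝓝 0) := by
    have := tendsto_integral_of_dominated_convergence (μ := P)
      (F := fun T ω => Y T ω * ((Real.exp (u ^ 2 * V / 2) - Real.exp (q T ω) : ℝ) : ℂ))
      (f := fun _ => 0) (fun _ => Real.exp (u ^ 2 * V / 2) + Real.exp (u ^ 2 * C / 2))
      (fun T => Measurable.aestronglyMeasurable (by have := hYm T; have := hqm T; fun_prop))
      (integrable_const _) (fun T => ae_of_all _ fun ω => ?_) ?_
    · simpa using this
    · rw [norm_mul, hY1, one_mul, Complex.norm_real]
      refine (norm_sub_le _ _).trans ?_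
      rw [Real.norm_of_nonneg (Real.exp_pos _).le, Real.norm_of_nonneg (Real.exp_pos _).le]
      gcongr
      exact hqb T ω
    · filter_upwards [hqlim] with ω hω
      rw [tendsto_zero_iff_norm_tendsto_zero]
      simp only [norm_mul, hY1, one_mul, Complex.norm_real]
      rw [← tendsto_zero_iff_norm_tendsto_zero]
      have hexp : Tendsto (fun T => Real.exp (q T ω)) atTop (𝓝 (Real.exp (u ^ 2 * V / 2))) :=
        (Real.continuous_exp.tendsto _).comp hω
      have hsub := hexp.const_sub (Real.exp (u ^ 2 * V / 2))
      rwa [sub_self] at hsub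
  have hYi : ∀ T, Integrable (Y T) P := fun T =>
    Integrable.of_bound (hYm T).aestronglyMeasurable 1 (ae_of_all _ fun ω => (hY1 T ω).le)
  have hYqi : ∀ T, Integrable (fun ω => Y T ω * (Real.exp (q T ω) : ℂ)) P := fun T =>
    Integrable.of_bound (C := Real.exp (u ^ 2 * C / 2))
      (Measurable.aestronglyMeasurable (by have := hYm T; have := hqm T; fun_prop))
      (ae_of_all _ fun ω => by
        rw [norm_mul, hY1, one_mul, Complex.norm_real, Real.norm_of_nonneg (Real.exp_pos _).le]
        exact Real.exp_le_exp.2 (hqb T ω))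
  have key : ∀ T, ∫ ω, Y T ω ∂P = ((Real.exp (-(u ^ 2 * V / 2)) : ℝ) : ℂ)
      * (∫ ω, compensated D v u T T ω ∂P
        + ∫ ω, Y T ω * ((Real.exp (u ^ 2 * V / 2) - Real.exp (q T ω) : ℝ) : ℂ) ∂P) := fun T => by
    simp only [hcomp]
    have e : (fun ω => Y T ω * ((Real.exp (u ^ 2 * V / 2) - Real.exp (q T ω) : ℝ) : ℂ))
        = fun ω => Y T ω * ((Real.exp (u ^ 2 * V / 2) : ℝ) : ℂ)
          - Y T ω * ((Real.exp (q T ω) : ℝ) : ℂ) := by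
      ext ω; push_cast; ring
    rw [e, integral_sub ((hYi T).mul_const _) (hYqi T), integral_mul_const]
    have : ((Real.exp (-(u ^ 2 * V / 2)) : ℝ) : ℂ) * ((Real.exp (u ^ 2 * V / 2) : ℝ) : ℂ) = 1 := by
      rw [← Complex.ofReal_mul, ← Real.exp_add]; simp
    linear_combination -(∫ ω, Y T ω ∂P) * this
  have fin := (main.add diff).const_mul ((Real.exp (-(u ^ 2 * V / 2)) : ℝ) : ℂ)
  simp only [← key] at fin
  refine fin.trans (le_of_eq ?_)
  congr 1
  rw [Real.coe_toNNReal V hV]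
  push_cast
  rw [add_zero, mul_one]
  congr 1
  ring

end MartingaleCLT

/-! ### Sampling from a conditional density -/

set_option linter.unusedSectionVars false

namespace SequentialSampling

variable {Ω : Type*} {mΩ : MeasurableSpace Ω} {P : Measure Ω} [IsProbabilityMeasure P]

/-- The defining property of a conditional probability, in lower-integral form so that Tonelli
applies to the densities directly. -/
lemma measure_inter_eq_setLIntegral {m : MeasurableSpace Ω} (hm : m ≤ mΩ) {A s : Set Ω}
    (hA : MeasurableSet[mΩ] A) (hs : MeasurableSet[m] s) {M : Ω → ℝ≥0∞} (hM : ∀ ω, M ω ≠ ∞)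
    (h : P⟦A|m⟧ =ᵐ[P] fun ω => (M ω).toReal) : P (s ∩ A) = ∫⁻ ω in s, M ω ∂P := by
  have hi : Integrable (A.indicator fun _ => (1 : ℝ)) P :=
    (integrable_const _).indicator hA
  have h1 := setIntegral_condExp hm hi hs
  have hint : Integrable (fun ω => (M ω).toReal) P := integrable_condExp.congr h
  rw [setIntegral_congr_ae (hm s hs) (h.mono fun ω hω _ => hω), setIntegral_indicator hA] at h1
  simp only [integral_const, smul_eq_mul, mul_one, measureReal_restrict_apply_univ] at h1
  have h2 : ∫⁻ ω in s, M ω ∂P = ENNReal.ofReal (∫ ω in s, (M ω).toReal ∂P) := by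
    rw [ofReal_integral_eq_lintegral_ofReal hint.integrableOn
      (ae_of_all _ fun _ => ENNReal.toReal_nonneg)]
    exact lintegral_congr fun ω => (ENNReal.ofReal_toReal (hM ω)).symm
  rw [h2, h1, ofReal_measureReal]

variable {Ω' E 𝓦 : Type*} {mΩ' : MeasurableSpace Ω'} {mE : MeasurableSpace E}
  {m𝓦 : MeasurableSpace 𝓦} {ι : Ω → Ω'} {X : Ω → E} {S : Ω → 𝓦} {Q : Measure E}
  [IsProbabilityMeasure Q] {κ : Kernel E 𝓦} [IsMarkovKernel κ] {ρ : Ω' → E → ℝ}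

/-- If `X` has conditional density `ρ` with respect to `Q` given the past `ι`, and `S` has
conditional law `κ X` given the past and `X`, then the joint law of `(ι, (X, S))` has density `ρ`
with respect to the product of the law of the past and `Q ⊗ₘ κ`. -/
theorem map_prodMk_eq_withDensity (hι : Measurable ι) (hX : Measurable X) (hS : Measurable S)
    (hρ : Measurable (Function.uncurry ρ)) (hρ1 : ∀ ω, ∫⁻ x, ENNReal.ofReal (ρ ω x) ∂Q = 1)
    (hXcond : ∀ A, MeasurableSet A → P⟦X ⁻¹' A | mΩ'.comap ι⟧ =ᵐ[P]
      fun ω => (Q.withDensity fun x => ENNReal.ofReal (ρ (ι ω) x)).real A)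
    (hScond : ∀ B, MeasurableSet B → P⟦S ⁻¹' B | mΩ'.comap ι ⊔ mE.comap X⟧ =ᵐ[P]
      fun ω => (κ (X ω)).real B) :
    P.map (fun ω => (ι ω, X ω, S ω))
      = ((P.map ι).prod (Q ⊗ₘ κ)).withDensity fun z => ENNReal.ofReal (ρ z.1 z.2.1) := by
  have hρ' : Measurable fun z : Ω' × E => ENNReal.ofReal (ρ z.1 z.2) :=
    ENNReal.measurable_ofReal.comp hρ
  have : IsProbabilityMeasure (P.map ι) := Measure.isProbabilityMeasure_map hι.aemeasurable
  have : IsProbabilityMeasure (P.map fun ω => (ι ω, X ω)) :=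
    Measure.isProbabilityMeasure_map (hι.prodMk hX).aemeasurable
  have : IsProbabilityMeasure (P.map fun ω => (ι ω, X ω, S ω)) :=
    Measure.isProbabilityMeasure_map (hι.prodMk (hX.prodMk hS)).aemeasurable
  -- Measures on products are compared on rectangles: the conditional law of `X` settles the pair,
  -- and conditioning on the past together with `X` then adds `S`.
  have step1 : P.map (fun ω => (ι ω, X ω))
      = ((P.map ι).prod Q).withDensity fun z => ENNReal.ofReal (ρ z.1 z.2) := by
    refine Measure.ext_prod fun {s t} hs ht => ?_
    rw [Measure.map_apply (hι.prodMk hX) (hs.prod ht), withDensity_apply _ (hs.prod ht),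
      ← Measure.prod_restrict, lintegral_prod _ hρ'.aemeasurable,
      setLIntegral_map hs (Measurable.lintegral_prod_right' (ν := Q.restrict t) hρ') hι]
    have e : (fun ω => (ι ω, X ω)) ⁻¹' s ×ˢ t = ι ⁻¹' s ∩ X ⁻¹' t := rfl
    rw [e, measure_inter_eq_setLIntegral hι.comap_le (hX ht) ⟨s, hs, rfl⟩
      (M := fun ω => (Q.withDensity fun x => ENNReal.ofReal (ρ (ι ω) x)) t) _ (hXcond t ht)]
    · refine lintegral_congr fun ω => ?_
      rw [withDensity_apply _ ht]
    · intro ω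
      have := hρ1 (ι ω)
      refine ((measure_mono (Set.subset_univ t)).trans_lt ?_).ne
      rw [withDensity_apply _ MeasurableSet.univ, Measure.restrict_univ, this]
      exact ENNReal.one_lt_top
  refine Measure.ext_prod₃ fun {s t r} hs ht hr => ?_
  have hρ3 : Measurable fun z : Ω' × E × 𝓦 => ENNReal.ofReal (ρ z.1 z.2.1) :=
    hρ'.comp (measurable_fst.prodMk measurable_snd.fst)
  have hκr : Measurable fun z : Ω' × E => κ z.2 r :=
    (Kernel.measurable_coe κ hr).comp measurable_snd
  rw [Measure.map_apply (hι.prodMk (hX.prodMk hS)) (hs.prod (ht.prod hr)),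
    withDensity_apply _ (hs.prod (ht.prod hr)), ← Measure.prod_restrict,
    lintegral_prod _ hρ3.aemeasurable]
  have e : (fun ω => (ι ω, X ω, S ω)) ⁻¹' s ×ˢ t ×ˢ r
      = (fun ω => (ι ω, X ω)) ⁻¹' (s ×ˢ t) ∩ S ⁻¹' r := by
    ext; simp [and_assoc]
  have hmeas : MeasurableSet[mΩ'.comap ι ⊔ mE.comap X]
      ((fun ω => (ι ω, X ω)) ⁻¹' (s ×ˢ t)) := by
    have e' : (fun ω => (ι ω, X ω)) ⁻¹' (s ×ˢ t) = ι ⁻¹' s ∩ X ⁻¹' t := rfl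
    rw [e']
    exact MeasurableSet.inter (le_sup_left (a := mΩ'.comap ι) _ ⟨s, hs, rfl⟩)
      (le_sup_right (b := mE.comap X) _ ⟨t, ht, rfl⟩)
  rw [e, measure_inter_eq_setLIntegral (sup_le hι.comap_le hX.comap_le) (hS hr) hmeas
    (M := fun ω => κ (X ω) r) (fun ω => measure_ne_top _ _) (hScond r hr)]
  have e2 := setLIntegral_map (μ := P) (hs.prod ht) hκr (hι.prodMk hX)
  rw [← e2, step1, setLIntegral_withDensity_eq_setLIntegral_mul _ hρ' hκr
    (hs.prod ht), ← Measure.prod_restrict, lintegral_prod _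
      (hρ'.mul hκr).aemeasurable]
  refine lintegral_congr fun ω => ?_
  have hρω : Measurable fun z : E × 𝓦 => ENNReal.ofReal (ρ ω z.1) :=
    hρ'.comp (measurable_const.prodMk measurable_fst)
  rw [Measure.setLIntegral_compProd hρω ht hr]
  refine lintegral_congr fun x => ?_
  simp

variable {C : ℝ}

/-- Domination: if the conditional density is bounded, expectations at the sampled point are
bounded by expectations under an independent draw from `Q ⊗ₘ κ`. -/
lemma lintegral_sample_le
    (hmap : P.map (fun ω => (ι ω, X ω, S ω))
      = ((P.map ι).prod (Q ⊗ₘ κ)).withDensity fun z => ENNReal.ofReal (ρ z.1 z.2.1))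
    (hι : Measurable ι) (hX : Measurable X) (hS : Measurable S)
    (hρ : Measurable (Function.uncurry ρ)) (hρC : ∀ ω x, ρ ω x ≤ C)
    {H : Ω' × E × 𝓦 → ℝ≥0∞} (hH : Measurable H) :
    ∫⁻ ω, H (ι ω, X ω, S ω) ∂P
      ≤ ENNReal.ofReal C * ∫⁻ ω, ∫⁻ z, H (ι ω, z) ∂(Q ⊗ₘ κ) ∂P := by
  have hρ3 : Measurable fun z : Ω' × E × 𝓦 => ENNReal.ofReal (ρ z.1 z.2.1) :=
    (ENNReal.measurable_ofReal.comp hρ).comp (measurable_fst.prodMk measurable_snd.fst)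
  rw [← lintegral_map hH (hι.prodMk (hX.prodMk hS)), hmap,
    lintegral_withDensity_eq_lintegral_mul _ hρ3 hH]
  calc _ ≤ ∫⁻ z, ENNReal.ofReal C * H z ∂((P.map ι).prod (Q ⊗ₘ κ)) :=
        lintegral_mono fun z => by
          simp only [Pi.mul_apply]; gcongr; exact hρC _ _
    _ = _ := by
        rw [lintegral_const_mul _ hH, lintegral_prod _ hH.aemeasurable,
          lintegral_map hH.lintegral_prod_right' hι]

/-- A property that holds for almost every point of an independent draw holds almost surely at the
sampled point. -/
lemma ae_sample
    (hmap : P.map (fun ω => (ι ω, X ω, S ω))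
      = ((P.map ι).prod (Q ⊗ₘ κ)).withDensity fun z => ENNReal.ofReal (ρ z.1 z.2.1))
    (hι : Measurable ι) (hX : Measurable X) (hS : Measurable S)
    {p : Ω' × E × 𝓦 → Prop} (hp : MeasurableSet {z | p z})
    (h : ∀ᵐ ω ∂P, ∀ᵐ z ∂(Q ⊗ₘ κ), p (ι ω, z)) : ∀ᵐ ω ∂P, p (ι ω, X ω, S ω) := by
  have h1 : ∀ᵐ z ∂((P.map ι).prod (Q ⊗ₘ κ)), p z := by
    rw [Measure.ae_prod_iff_ae_ae hp, ae_map_iff hι.aemeasurable]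
    · exact h
    · have := measurable_measure_prodMk_left (ν := Q ⊗ₘ κ) hp.compl
      have h2 := this (measurableSet_singleton 0)
      convert! h2 using 1
  have h2 : ∀ᵐ z ∂(P.map fun ω => (ι ω, X ω, S ω)), p z := by
    rw [hmap]; exact (withDensity_absolutelyContinuous _ _).ae_le h1
  exact (ae_map_iff (hι.prodMk (hX.prodMk hS)).aemeasurable hp).1 h2

/-- Conditional expectations given the past are integrals against the conditional density. -/
theorem condExp_sample
    (hmap : P.map (fun ω => (ι ω, X ω, S ω))
      = ((P.map ι).prod (Q ⊗ₘ κ)).withDensity fun z => ENNReal.ofReal (ρ z.1 z.2.1))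
    (hι : Measurable ι) (hX : Measurable X) (hS : Measurable S)
    (hρ : Measurable (Function.uncurry ρ)) (hρ0 : ∀ ω x, 0 ≤ ρ ω x)
    {G : Ω' × E × 𝓦 → ℝ} (hG : Measurable G) (hint : Integrable (fun ω => G (ι ω, X ω, S ω)) P) :
    P[fun ω => G (ι ω, X ω, S ω)|mΩ'.comap ι] =ᵐ[P]
      fun ω => ∫ z, ρ (ι ω) z.1 * G (ι ω, z) ∂(Q ⊗ₘ κ) := by
  have hρr : Measurable fun z : Ω' × E × 𝓦 => ρ z.1 z.2.1 :=
    hρ.comp (measurable_fst.prodMk measurable_snd.fst)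
  have hρ3 : Measurable fun z : Ω' × E × 𝓦 => ENNReal.ofReal (ρ z.1 z.2.1) :=
    ENNReal.measurable_ofReal.comp hρr
  have : IsProbabilityMeasure (P.map ι) := Measure.isProbabilityMeasure_map hι.aemeasurable
  have htoReal : ∀ z : Ω' × E × 𝓦, (ENNReal.ofReal (ρ z.1 z.2.1)).toReal = ρ z.1 z.2.1 :=
    fun z => ENNReal.toReal_ofReal (hρ0 _ _)
  have hint1 : Integrable G (P.map fun ω => (ι ω, X ω, S ω)) :=
    (integrable_map_measure hG.aestronglyMeasurable (hι.prodMk (hX.prodMk hS)).aemeasurable).2 hint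
  have hint2 : Integrable (fun z => ρ z.1 z.2.1 * G z) ((P.map ι).prod (Q ⊗ₘ κ)) := by
    rw [hmap, integrable_withDensity_iff_integrable_smul' hρ3
      (ae_of_all _ fun _ => ENNReal.ofReal_lt_top)] at hint1
    simpa only [htoReal, smul_eq_mul] using hint1
  have hgm : StronglyMeasurable fun ω' => ∫ z, ρ ω' z.1 * G (ω', z) ∂(Q ⊗ₘ κ) :=
    (hρr.mul hG).stronglyMeasurable.integral_prod_right'
  have hgi : Integrable (fun ω' => ∫ z, ρ ω' z.1 * G (ω', z) ∂(Q ⊗ₘ κ)) (P.map ι) :=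
    hint2.integral_prod_left
  have hgi' : Integrable (fun ω => ∫ z, ρ (ι ω) z.1 * G (ι ω, z) ∂(Q ⊗ₘ κ)) P :=
    hgi.comp_measurable hι
  refine (ae_eq_condExp_of_forall_setIntegral_eq hι.comap_le hint
    (fun s _ _ => hgi'.integrableOn) ?_ ?_).symm
  · rintro s ⟨A, hA, rfl⟩ -
    have e1 : ∫ ω in ι ⁻¹' A, G (ι ω, X ω, S ω) ∂P
        = ∫ z in A ×ˢ Set.univ, G z ∂(P.map fun ω => (ι ω, X ω, S ω)) := by
      rw [setIntegral_map (hA.prod MeasurableSet.univ) hG.aestronglyMeasurable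
        (hι.prodMk (hX.prodMk hS)).aemeasurable]
      congr 2
      ext; simp
    rw [e1, hmap, restrict_withDensity (hA.prod MeasurableSet.univ),
      integral_withDensity_eq_integral_toReal_smul hρ3
        (ae_of_all _ fun _ => ENNReal.ofReal_lt_top), ← Measure.prod_restrict,
      Measure.restrict_univ]
    simp only [htoReal, smul_eq_mul]
    have hint3 : Integrable (fun z => ρ z.1 z.2.1 * G z)
        (((P.map ι).restrict A).prod (Q ⊗ₘ κ)) := by
      have h3 := hint2.integrableOn (s := A ×ˢ Set.univ)
      rwa [IntegrableOn, ← Measure.prod_restrict, Measure.restrict_univ] at h3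
    rw [integral_prod _ hint3, setIntegral_map hA hgm.aestronglyMeasurable hι.aemeasurable]
  · exact (hgm.comp_measurable (Measurable.of_comap_le le_rfl)).aestronglyMeasurable

/-- Under the conditional expectation given `m₁`, a factor may be replaced by its conditional
expectation given a finer σ-algebra that knows the other factor. -/
lemma condExp_mul_of_condExp_eq {m₁ m₂ : MeasurableSpace Ω} (h12 : m₁ ≤ m₂) (hm : m₂ ≤ mΩ)
    {D p h : Ω → ℝ} (hh : StronglyMeasurable[m₂] h) (hDh : Integrable (fun ω => D ω * h ω) P)
    (hDi : Integrable D P) (hD : P[D|m₂] =ᵐ[P] p) :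
    P[fun ω => D ω * h ω|m₁] =ᵐ[P] P[fun ω => p ω * h ω|m₁] := by
  have h1 : P[fun ω => D ω * h ω|m₂] =ᵐ[P] fun ω => p ω * h ω :=
    (condExp_mul_of_stronglyMeasurable_right hh hDh hDi).trans
      (hD.mono fun ω hω => by simp [hω])
  exact (condExp_condExp_of_le h12 hm).symm.trans (condExp_congr_ae h1)

end SequentialSampling

/-! ### Convergence in `L²` -/

namespace LTwo

variable {Z : Type*} {mZ : MeasurableSpace Z} {μ : Measure Z}

/-- Dominated convergence in `L²`. -/
lemma tendsto_eLpNorm_two_of_dominated {F : ℕ → Z → ℝ} {g : Z → ℝ} (hg : MemLp g 2 μ)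
    (hFm : ∀ t, AEStronglyMeasurable (F t) μ) (hb : ∀ᶠ t in atTop, ∀ᵐ z ∂μ, |F t z| ≤ |g z|)
    (hlim : ∀ᵐ z ∂μ, Tendsto (fun t => F t z) atTop (𝓝 0)) :
    Tendsto (fun t => eLpNorm (F t) 2 μ) atTop (𝓝 0) := by
  have hform : ∀ f : Z → ℝ, eLpNorm f 2 μ = (∫⁻ z, ‖f z‖ₑ ^ (2 : ℝ) ∂μ) ^ (1 / (2 : ℝ)) :=
    fun f => by
      rw [eLpNorm_eq_lintegral_rpow_enorm_toReal (by norm_num) (by norm_num)]; norm_num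
  simp only [hform]
  have hgfin : ∫⁻ z, ‖g z‖ₑ ^ (2 : ℝ) ∂μ ≠ ∞ := by
    have := (lintegral_rpow_enorm_lt_top_of_eLpNorm_lt_top (p := 2) (by norm_num) (by norm_num)
      hg.2).ne
    simpa using this
  have key : Tendsto (fun t => ∫⁻ z, ‖F t z‖ₑ ^ (2 : ℝ) ∂μ) atTop (𝓝 (∫⁻ _, 0 ∂μ)) := by
    refine tendsto_lintegral_filter_of_dominated_convergence' (fun z => ‖g z‖ₑ ^ (2 : ℝ)) ?_ ?_
      hgfin ?_
    · exact Eventually.of_forall fun t => (hFm t).enorm.pow_const _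
    · filter_upwards [hb] with t ht
      filter_upwards [ht] with z hz
      gcongr
      rw [enorm_le_iff_norm_le]
      simpa using hz
    · filter_upwards [hlim] with z hz
      have h1 : Tendsto (fun t => ‖F t z‖ₑ) atTop (𝓝 0) := by
        simpa using hz.enorm
      have := (ENNReal.continuous_rpow_const (y := (2 : ℝ))).tendsto 0 |>.comp h1
      simpa [Function.comp_def] using this
  have := ((ENNReal.continuous_rpow_const (y := 1 / (2 : ℝ))).tendsto _).comp key
  simpa [Function.comp_def] using this

/-- Multiplication by bounded functions: if `h t → h` in `L²` and the bounded multipliers `w t`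
satisfy `w t * h → w * h` almost everywhere, then `w t * h t → w * h` in `L²`. -/
lemma tendsto_eLpNorm_mul_sub {w h : Z → ℝ} {ws hs : ℕ → Z → ℝ} {C : ℝ}
    (hh : MemLp h 2 μ) (hw : AEStronglyMeasurable w μ)
    (hwm : ∀ t, AEStronglyMeasurable (ws t) μ) (hsm : ∀ t, AEStronglyMeasurable (hs t) μ)
    (hwb : ∀ᶠ t in atTop, ∀ᵐ z ∂μ, |ws t z| ≤ C)
    (hlim : ∀ᵐ z ∂μ, Tendsto (fun t => ws t z * h z) atTop (𝓝 (w z * h z)))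
    (hconv : Tendsto (fun t => eLpNorm (fun z => hs t z - h z) 2 μ) atTop (𝓝 0)) :
    Tendsto (fun t => eLpNorm (fun z => ws t z * hs t z - w z * h z) 2 μ) atTop (𝓝 0) := by
  -- The limit weight need not be bounded where h vanishes, so the bound is inherited by the product
  -- `w * h` rather than by `w`.
  have hwh : ∀ᵐ z ∂μ, |w z * h z| ≤ C * |h z| := by
    obtain ⟨N, hN⟩ := eventually_atTop.1 hwb
    have hall : ∀ᵐ z ∂μ, ∀ t, N ≤ t → |ws t z| ≤ C :=
      ae_all_iff.2 fun t => by
        by_cases ht : N ≤ t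
        · filter_upwards [hN t ht] with z hz _ using hz
        · exact ae_of_all _ fun z h => absurd h ht
    filter_upwards [hlim, hall] with z hz hb
    refine le_of_tendsto hz.abs (eventually_atTop.2 ⟨N, fun t ht => ?_⟩)
    rw [abs_mul]; gcongr; exact hb t ht
  have t2 : Tendsto (fun t => eLpNorm (fun z => ws t z * h z - w z * h z) 2 μ) atTop (𝓝 0) := by
    refine tendsto_eLpNorm_two_of_dominated (g := fun z => (2 * C) * h z) (hh.const_mul _)
      (fun t => ((hwm t).mul hh.1).sub (hw.mul hh.1)) ?_ ?_
    · filter_upwards [hwb] with t ht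
      filter_upwards [ht, hwh] with z h1 h2
      calc _ ≤ |ws t z * h z| + |w z * h z| := abs_sub _ _
        _ ≤ C * |h z| + C * |h z| := by rw [abs_mul]; gcongr
        _ = 2 * C * |h z| := by ring
        _ ≤ |2 * C * h z| := by rw [abs_mul]; gcongr; exact le_abs_self _
    · filter_upwards [hlim] with z hz
      simpa using hz.sub_const (w z * h z)
  have t1 : Tendsto (fun t => ENNReal.ofReal C * eLpNorm (fun z => hs t z - h z) 2 μ) atTop
      (𝓝 0) := by
    simpa using ENNReal.Tendsto.const_mul hconv (Or.inr ENNReal.ofReal_ne_top)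
  have tsum := t1.add t2
  rw [add_zero] at tsum
  refine tendsto_of_tendsto_of_tendsto_of_le_of_le' tendsto_const_nhds tsum
    (Eventually.of_forall fun _ => zero_le) ?_
  filter_upwards [hwb] with t ht
  have e : (fun z => ws t z * hs t z - w z * h z)
      = (fun z => ws t z * (hs t z - h z)) + fun z => ws t z * h z - w z * h z := by
    ext z; simp only [Pi.add_apply]; ring
  rw [e]
  refine (eLpNorm_add_le ((hwm t).mul ((hsm t).sub hh.1)) (((hwm t).mul hh.1).sub (hw.mul hh.1))
    (by norm_num)).trans ?_
  refine add_le_add ?_ le_rfl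
  refine eLpNorm_le_mul_eLpNorm_of_ae_le_mul (c := C) ?_ 2
  filter_upwards [ht] with z hz
  simp only [Pi.mul_apply, Pi.sub_apply, norm_mul]
  gcongr; exact hz

lemma memLp_of_eLpNorm_sub_lt_top {f g : Z → ℝ} (hf : AEStronglyMeasurable f μ) (hg : MemLp g 2 μ)
    (h : eLpNorm (fun z => f z - g z) 2 μ < ∞) : MemLp f 2 μ := by
  have h1 : MemLp (fun z => f z - g z) 2 μ := ⟨hf.sub hg.1, h⟩
  have h2 := h1.add hg
  refine h2.ae_eq (ae_of_all _ fun z => ?_)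
  simp

lemma eventually_memLp_of_tendsto {f : ℕ → Z → ℝ} {g : Z → ℝ}
    (hf : ∀ t, AEStronglyMeasurable (f t) μ) (hg : MemLp g 2 μ)
    (h : Tendsto (fun t => eLpNorm (fun z => f t z - g z) 2 μ) atTop (𝓝 0)) :
    ∀ᶠ t in atTop, MemLp (f t) 2 μ := by
  filter_upwards [h.eventually_lt_const ENNReal.zero_lt_top] with t ht
  exact memLp_of_eLpNorm_sub_lt_top (hf t) hg ht

/-- The integral of a product is continuous in `L²`. -/
lemma tendsto_integral_mul {f g : Z → ℝ} {fs gs : ℕ → Z → ℝ}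
    (hf : MemLp f 2 μ) (hg : MemLp g 2 μ)
    (hfm : ∀ t, AEStronglyMeasurable (fs t) μ) (hgm : ∀ t, AEStronglyMeasurable (gs t) μ)
    (hfs : Tendsto (fun t => eLpNorm (fun z => fs t z - f z) 2 μ) atTop (𝓝 0))
    (hgs : Tendsto (fun t => eLpNorm (fun z => gs t z - g z) 2 μ) atTop (𝓝 0)) :
    Tendsto (fun t => ∫ z, fs t z * gs t z ∂μ) atTop (𝓝 (∫ z, f z * g z ∂μ)) := by
  have hol : ∀ {a b : Z → ℝ}, AEStronglyMeasurable a μ → AEStronglyMeasurable b μ →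
      eLpNorm (fun z => a z * b z) 1 μ ≤ eLpNorm a 2 μ * eLpNorm b 2 μ := fun ha hb => by
    have := eLpNorm_smul_le_mul_eLpNorm (p := 2) (q := 2) (r := 1) hb ha
    exact this
  refine tendsto_integral_of_L1' _ (hf.1.mul hg.1) ?_ ?_
  · filter_upwards [eventually_memLp_of_tendsto hfm hf hfs,
      eventually_memLp_of_tendsto hgm hg hgs] with t h1 h2
    exact h1.integrable_mul h2
  · have m1 : ∀ t, AEStronglyMeasurable (fun z => fs t z - f z) μ := fun t => (hfm t).sub hf.1
    have m2 : ∀ t, AEStronglyMeasurable (fun z => gs t z - g z) μ := fun t => (hgm t).sub hg.1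
    -- Expanding around the limits leaves products with at least one small factor, so no uniform
    -- bound on `fs` or `gs` is needed.
    have lim : Tendsto (fun t => eLpNorm (fun z => fs t z - f z) 2 μ
          * eLpNorm (fun z => gs t z - g z) 2 μ
        + eLpNorm (fun z => fs t z - f z) 2 μ * eLpNorm g 2 μ
        + eLpNorm f 2 μ * eLpNorm (fun z => gs t z - g z) 2 μ) atTop (𝓝 0) := by
      have a1 := ENNReal.Tendsto.mul hfs (Or.inr ENNReal.zero_ne_top) hgs
        (Or.inr ENNReal.zero_ne_top)
      have a2 := ENNReal.Tendsto.mul_const hfs (Or.inr hg.2.ne)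
      have a3 := ENNReal.Tendsto.const_mul hgs (Or.inr hf.2.ne)
      simpa using (a1.add a2).add a3
    refine tendsto_of_tendsto_of_tendsto_of_le_of_le tendsto_const_nhds lim
      (fun _ => zero_le) fun t => ?_
    have e : (fun z => fs t z * gs t z) - (fun z => f z * g z)
        = ((fun z => (fs t z - f z) * (gs t z - g z)) + fun z => (fs t z - f z) * g z)
          + fun z => f z * (gs t z - g z) := by
      ext z; simp only [Pi.add_apply, Pi.sub_apply]; ring
    change eLpNorm ((fun z => fs t z * gs t z) - fun z => f z * g z) 1 μ ≤ _
    rw [e]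
    refine (eLpNorm_add_le (((m1 t).mul (m2 t)).add ((m1 t).mul hg.1)) (hf.1.mul (m2 t))
      le_rfl).trans (add_le_add ((eLpNorm_add_le ((m1 t).mul (m2 t)) ((m1 t).mul hg.1)
      le_rfl).trans (add_le_add ?_ ?_)) ?_)
    · exact hol (m1 t) (m2 t)
    · exact hol (m1 t) hg.1
    · exact hol hf.1 (m2 t)

lemma tendsto_eLpNorm_add_sub {f g : Z → ℝ} {fs gs : ℕ → Z → ℝ}
    (hf : AEStronglyMeasurable f μ) (hg : AEStronglyMeasurable g μ)
    (hfm : ∀ t, AEStronglyMeasurable (fs t) μ) (hgm : ∀ t, AEStronglyMeasurable (gs t) μ)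
    (hfs : Tendsto (fun t => eLpNorm (fun z => fs t z - f z) 2 μ) atTop (𝓝 0))
    (hgs : Tendsto (fun t => eLpNorm (fun z => gs t z - g z) 2 μ) atTop (𝓝 0)) :
    Tendsto (fun t => eLpNorm (fun z => fs t z + gs t z - (f z + g z)) 2 μ) atTop (𝓝 0) := by
  have lim := hfs.add hgs
  rw [add_zero] at lim
  refine tendsto_of_tendsto_of_tendsto_of_le_of_le tendsto_const_nhds lim
    (fun _ => zero_le) fun t => ?_
  have e : (fun z => fs t z + gs t z - (f z + g z))
      = (fun z => fs t z - f z) + fun z => gs t z - g z := by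
    ext z; simp only [Pi.add_apply]; ring
  simp only [e]
  exact eLpNorm_add_le ((hfm t).sub hf) ((hgm t).sub hg) (by norm_num)

end LTwo

/-! ### Conditional moments under the population law -/

namespace PGAE

/-- The covariate space. -/
abbrev Cov (d : ℕ) := EuclideanSpace ℝ (Fin d)

/-- The space of side information and outcomes. -/
abbrev Side (m : ℕ) := EuclideanSpace ℝ (Fin m) × ℝ

namespace Population

variable {d m : ℕ} (pop : Population d m)

lemma measurable_μ : Measurable pop.μ :=
  (StronglyMeasurable.integral_kernel (κ := pop.κ) measurable_snd.stronglyMeasurable).measurable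

lemma measurePreserving_fst : MeasurePreserving Prod.fst pop.law (pop.covLaw pop.q) :=
  ⟨measurable_fst, Measure.fst_compProd _ _⟩

lemma ae_law_of_ae {p : Cov d → Prop} (h : ∀ᵐ x ∂pop.covLaw pop.q, p x) :
    ∀ᵐ z ∂pop.law, p z.1 :=
  pop.measurePreserving_fst.quasiMeasurePreserving.ae h

lemma ae_q_pos : ∀ᵐ x ∂pop.covLaw pop.q, 0 < pop.q x := by
  rw [covLaw, ae_withDensity_iff pop.measurable_q.ennreal_ofReal]
  exact ae_of_all _ fun x hx => by simpa using hx

lemma integral_fst {g : Cov d → ℝ} (hg : AEStronglyMeasurable g (pop.covLaw pop.q)) :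
    ∫ z, g z.1 ∂pop.law = ∫ x, g x ∂pop.covLaw pop.q := by
  have h := pop.measurePreserving_fst
  rw [← h.map_eq] at hg ⊢
  exact (integral_map h.measurable.aemeasurable hg).symm

variable {pop} {f : Cov d → EuclideanSpace ℝ (Fin m) → ℝ}

instance : IsMarkovKernel (pop.condY f) := by unfold condY; infer_instance

variable (f) in
/-- The covariate and the prediction, as a function of the data. -/
def covPred (z : Cov d × Side m) : Cov d × ℝ := (z.1, f z.1 z.2.1)

lemma measurable_pred (hf : Measurable fun z : Cov d × EuclideanSpace ℝ (Fin m) => f z.1 z.2) :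
    Measurable fun z : Cov d × Side m => f z.1 z.2.1 :=
  hf.comp (measurable_fst.prodMk measurable_snd.fst)

lemma measurable_covPred
    (hf : Measurable fun z : Cov d × EuclideanSpace ℝ (Fin m) => f z.1 z.2) :
    Measurable (covPred f) := measurable_fst.prodMk (measurable_pred hf)

lemma measurable_integral_condY {g : Cov d × ℝ → ℝ → ℝ} (hg : Measurable (Function.uncurry g)) :
    Measurable fun v => ∫ y, g v y ∂pop.condY f v :=
  (StronglyMeasurable.integral_kernel_prod_right hg.stronglyMeasurable).measurable

lemma measurable_τ : Measurable fun v : Cov d × ℝ => pop.τ f v.1 v.2 :=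
  measurable_integral_condY (g := fun _ y => y) measurable_snd

lemma measurable_τ_comp
    (hf : Measurable fun z : Cov d × EuclideanSpace ℝ (Fin m) => f z.1 z.2) :
    Measurable fun z : Cov d × Side m => pop.τ f z.1 (f z.1 z.2.1) :=
  measurable_τ.comp (measurable_covPred hf)

lemma variance_condY (v : Cov d × ℝ) :
    variance (fun y : ℝ => y) (pop.condY f v) = ∫ y, (y - pop.τ f v.1 v.2) ^ 2 ∂pop.condY f v :=
  variance_eq_integral measurable_id.aemeasurable

lemma measurable_variance_condY :
    Measurable fun v => variance (fun y : ℝ => y) (pop.condY f v) := by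
  simp only [variance_condY]
  exact measurable_integral_condY (g := fun v y => (y - pop.τ f v.1 v.2) ^ 2)
    ((measurable_snd.sub (measurable_τ.comp measurable_fst)).pow_const 2)

lemma variance_κ (hf : Measurable fun z : Cov d × EuclideanSpace ℝ (Fin m) => f z.1 z.2)
    (x : Cov d) : pop.α f x = ∫ s, (pop.τ f x (f x s.1)
      - ∫ s', pop.τ f x (f x s'.1) ∂pop.κ x) ^ 2 ∂pop.κ x :=
  variance_eq_integral (((measurable_τ_comp hf).comp measurable_prodMk_left).aemeasurable)

lemma measurable_integral_κ {g : Cov d × Side m → ℝ} (hg : Measurable g) :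
    Measurable fun x => ∫ s, g (x, s) ∂pop.κ x :=
  (StronglyMeasurable.integral_kernel_prod_right' hg.stronglyMeasurable).measurable

lemma measurable_α (hf : Measurable fun z : Cov d × EuclideanSpace ℝ (Fin m) => f z.1 z.2) :
    Measurable (pop.α f) := by
  have e : pop.α f = _ := funext (variance_κ hf)
  rw [e]
  exact measurable_integral_κ (g := fun z => (pop.τ f z.1 (f z.1 z.2.1)
      - ∫ s', pop.τ f z.1 (f z.1 s'.1) ∂pop.κ z.1) ^ 2)
    (((measurable_τ_comp hf).sub
      ((measurable_integral_κ (measurable_τ_comp hf)).comp measurable_fst)).pow_const 2)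

lemma measurable_β (hf : Measurable fun z : Cov d × EuclideanSpace ℝ (Fin m) => f z.1 z.2) :
    Measurable (pop.β f) :=
  measurable_integral_κ (g := fun z => variance (fun y : ℝ => y) (pop.condY f (covPred f z)))
    (measurable_variance_condY.comp (measurable_covPred hf))

lemma β_nonneg (x : Cov d) : 0 ≤ pop.β f x := integral_nonneg fun _ => variance_nonneg _ _

/-! The σ-algebra generated by the covariate and the prediction. -/

variable (f) in
/-- The σ-algebra generated by `(X, F)`. -/
@[reducible] def sigmaXF : MeasurableSpace (Cov d × Side m) :=
  MeasurableSpace.comap (covPred f) inferInstance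

lemma sigmaXF_le (hf : Measurable fun z : Cov d × EuclideanSpace ℝ (Fin m) => f z.1 z.2) :
    sigmaXF f ≤ (inferInstance : MeasurableSpace (Cov d × Side m)) :=
  (measurable_covPred hf).comap_le

lemma measurable_sigmaXF {g : Cov d × ℝ → ℝ} (hg : Measurable g) :
    Measurable[sigmaXF f] fun z => g (covPred f z) :=
  hg.comp (Measurable.of_comap_le le_rfl)

lemma condExp_eq_integral_condY
    (hf : Measurable fun z : Cov d × EuclideanSpace ℝ (Fin m) => f z.1 z.2)
    {g : Cov d × ℝ → ℝ → ℝ} (hg : Measurable (Function.uncurry g))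
    (hint : Integrable (fun z => g (covPred f z) z.2.2) pop.law) :
    pop.law[fun z => g (covPred f z) z.2.2|sigmaXF f] =ᵐ[pop.law]
      fun z => ∫ y, g (covPred f z) y ∂pop.condY f (covPred f z) :=
  condExp_prod_ae_eq_integral_condDistrib (measurable_covPred hf)
    (measurable_snd.snd).aemeasurable hg.stronglyMeasurable hint

lemma condExp_Y (hf : Measurable fun z : Cov d × EuclideanSpace ℝ (Fin m) => f z.1 z.2)
    (hY : Integrable (fun z : Cov d × Side m => z.2.2) pop.law) :
    pop.law[fun z => z.2.2|sigmaXF f] =ᵐ[pop.law] fun z => pop.τ f z.1 (f z.1 z.2.1) :=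
  condExp_eq_integral_condY hf (g := fun _ y => y) measurable_snd hY

lemma integrable_τ (hf : Measurable fun z : Cov d × EuclideanSpace ℝ (Fin m) => f z.1 z.2)
    (hY : Integrable (fun z : Cov d × Side m => z.2.2) pop.law) :
    Integrable (fun z : Cov d × Side m => pop.τ f z.1 (f z.1 z.2.1)) pop.law :=
  integrable_condExp.congr (condExp_Y hf hY)

lemma integrable_μ (hY : Integrable (fun z : Cov d × Side m => z.2.2) pop.law) :
    Integrable pop.μ (pop.covLaw pop.q) := by
  have h := (Measure.integrable_compProd_iff (μ := pop.covLaw pop.q) (κ := pop.κ) hY.1).1 hY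
  exact h.2.mono' pop.measurable_μ.aestronglyMeasurable
    (ae_of_all _ fun x => norm_integral_le_integral_norm _)

lemma integrable_integral_κ {g : Cov d × Side m → ℝ} (hg : Measurable g)
    (hi : Integrable g pop.law) : Integrable (fun x => ∫ s, g (x, s) ∂pop.κ x)
      (pop.covLaw pop.q) := by
  have h := (Measure.integrable_compProd_iff (μ := pop.covLaw pop.q) (κ := pop.κ) hi.1).1 hi
  exact h.2.mono' (measurable_integral_κ hg).aestronglyMeasurable
    (ae_of_all _ fun x => norm_integral_le_integral_norm _)

lemma ae_integrable_κ {g : Cov d × Side m → ℝ} (hi : Integrable g pop.law) :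
    ∀ᵐ x ∂pop.covLaw pop.q, Integrable (fun s => g (x, s)) (pop.κ x) :=
  ((Measure.integrable_compProd_iff (μ := pop.covLaw pop.q) (κ := pop.κ) hi.1).1 hi).1

lemma integral_law {g : Cov d × Side m → ℝ} (hi : Integrable g pop.law) :
    ∫ z, g z ∂pop.law = ∫ x, ∫ s, g (x, s) ∂pop.κ x ∂pop.covLaw pop.q :=
  Measure.integral_compProd hi

/-- Two functions with the same conditional expectation given `(X, F)` have the same conditional
expectation given `X`. -/
lemma ae_integral_κ_eq_of_condExp_eq
    (hf : Measurable fun z : Cov d × EuclideanSpace ℝ (Fin m) => f z.1 z.2)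
    {g h : Cov d × Side m → ℝ} (hgm : Measurable g) (hhm : Measurable h)
    (hg : Integrable g pop.law) (hh : Integrable h pop.law)
    (hgh : pop.law[g|sigmaXF f] =ᵐ[pop.law] pop.law[h|sigmaXF f]) :
    ∀ᵐ x ∂pop.covLaw pop.q, ∫ s, g (x, s) ∂pop.κ x = ∫ s, h (x, s) ∂pop.κ x := by
  refine Integrable.ae_eq_of_forall_setIntegral_eq _ _ (integrable_integral_κ hgm hg)
    (integrable_integral_κ hhm hh) fun s hs _ => ?_
  -- Cylinders over covariate sets belong to `sigmaXF f`, so integrals over them depend only on the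
  -- conditional expectation given (X, F).
  have key : ∀ {k : Cov d × Side m → ℝ}, Integrable k pop.law →
      ∫ x in s, ∫ t, k (x, t) ∂pop.κ x ∂pop.covLaw pop.q
        = ∫ z in s ×ˢ Set.univ, (pop.law[k|sigmaXF f]) z ∂pop.law := fun {k} hk => by
    have hms : MeasurableSet[sigmaXF f] (s ×ˢ (Set.univ : Set (Side m))) :=
      ⟨s ×ˢ Set.univ, hs.prod MeasurableSet.univ, by ext; simp [covPred]⟩
    rw [setIntegral_condExp (sigmaXF_le hf) hk hms]
    have := Measure.setIntegral_compProd (μ := pop.covLaw pop.q) (κ := pop.κ) hs MeasurableSet.univ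
      hk.integrableOn
    simpa [law] using this.symm
  rw [key hg, key hh]
  exact setIntegral_congr_ae (hs.prod MeasurableSet.univ) (hgh.mono fun z hz _ => hz)

/-- Tower property: conditioning on (X, F) and afterwards on X is conditioning on X. -/
lemma ae_integral_τ (hf : Measurable fun z : Cov d × EuclideanSpace ℝ (Fin m) => f z.1 z.2)
    (hY : Integrable (fun z : Cov d × Side m => z.2.2) pop.law) :
    ∀ᵐ x ∂pop.covLaw pop.q, ∫ s, pop.τ f x (f x s.1) ∂pop.κ x = pop.μ x := by
  refine ae_integral_κ_eq_of_condExp_eq hf (g := fun z => pop.τ f z.1 (f z.1 z.2.1))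
    (h := fun z => z.2.2) (measurable_τ_comp hf) measurable_snd.snd (integrable_τ hf hY) hY ?_
  refine (EventuallyEq.of_eq ?_).trans (condExp_Y hf hY).symm
  exact condExp_of_stronglyMeasurable (sigmaXF_le hf)
    (measurable_sigmaXF measurable_τ).stronglyMeasurable (integrable_τ hf hY)

/-! The orthogonal decomposition `Y - μ = (τ - μ) + (Y - τ)`. -/

variable (hf : Measurable fun z : Cov d × EuclideanSpace ℝ (Fin m) => f z.1 z.2)
  (hY : Integrable (fun z : Cov d × Side m => z.2.2) pop.law)
  (hY2 : MemLp (fun z : Cov d × Side m => z.2.2 - pop.μ z.1) 2 pop.law)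

include hf hY in
lemma condExp_Y_sub_μ : pop.law[fun z : Cov d × Side m => z.2.2 - pop.μ z.1|sigmaXF f] =ᵐ[pop.law]
    fun z => pop.τ f z.1 (f z.1 z.2.1) - pop.μ z.1 := by
  have hμ : Integrable (fun z : Cov d × Side m => pop.μ z.1) pop.law :=
    pop.measurePreserving_fst.integrable_comp_of_integrable (integrable_μ hY)
  have h1 := condExp_sub hY hμ (sigmaXF f)
  have h2 : pop.law[fun z : Cov d × Side m => pop.μ z.1|sigmaXF f] = fun z => pop.μ z.1 :=
    condExp_of_stronglyMeasurable (sigmaXF_le hf) (measurable_sigmaXF (f := f)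
      (g := fun v => pop.μ v.1) (pop.measurable_μ.comp measurable_fst)).stronglyMeasurable hμ
  refine h1.trans ?_
  filter_upwards [condExp_Y hf hY] with z hz
  simp only [Pi.sub_apply, h2, hz]

include hf hY hY2 in
-- Only Y − μ(X) is assumed square integrable, not Y, so the L² theory is run on centred variables.
-- This one is the conditional expectation of Y − μ(X) given (X, F).
lemma memLp_τ_sub_μ :
    MemLp (fun z : Cov d × Side m => pop.τ f z.1 (f z.1 z.2.1) - pop.μ z.1) 2 pop.law :=
  (hY2.condExp (m := sigmaXF f) (by norm_num)).ae_eq (condExp_Y_sub_μ hf hY)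

include hf hY hY2 in
lemma memLp_Y_sub_τ :
    MemLp (fun z : Cov d × Side m => z.2.2 - pop.τ f z.1 (f z.1 z.2.1)) 2 pop.law := by
  refine (hY2.sub (memLp_τ_sub_μ hf hY hY2)).ae_eq (ae_of_all _ fun z => ?_)
  simp

include hf hY in
lemma condExp_Y_sub_τ :
    pop.law[fun z : Cov d × Side m => z.2.2 - pop.τ f z.1 (f z.1 z.2.1)|sigmaXF f]
      =ᵐ[pop.law] 0 := by
  have h1 := condExp_sub hY (integrable_τ hf hY) (sigmaXF f)
  have h2 : pop.law[fun z : Cov d × Side m => pop.τ f z.1 (f z.1 z.2.1)|sigmaXF f]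
      = fun z => pop.τ f z.1 (f z.1 z.2.1) :=
    condExp_of_stronglyMeasurable (sigmaXF_le hf)
      (measurable_sigmaXF measurable_τ).stronglyMeasurable (integrable_τ hf hY)
  refine h1.trans ?_
  filter_upwards [condExp_Y hf hY] with z hz
  simp [h2, hz]

include hf hY in
/-- The residual `Y - τ` is orthogonal to the functions of `(X, F)`. -/
lemma integral_mul_Y_sub_τ {g : Cov d × ℝ → ℝ} (hg : Measurable g)
    (hi : Integrable (fun z : Cov d × Side m =>
      g (covPred f z) * (z.2.2 - pop.τ f z.1 (f z.1 z.2.1))) pop.law) :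
    ∫ z, g (covPred f z) * (z.2.2 - pop.τ f z.1 (f z.1 z.2.1)) ∂pop.law = 0 := by
  rw [← integral_condExp (sigmaXF_le hf)]
  have h := condExp_mul_of_stronglyMeasurable_left
    (measurable_sigmaXF (f := f) hg).stronglyMeasurable hi (hY.sub (integrable_τ hf hY))
  have h2 : (pop.law[fun z : Cov d × Side m => g (covPred f z)
      * (z.2.2 - pop.τ f z.1 (f z.1 z.2.1))|sigmaXF f]) =ᵐ[pop.law] 0 := by
    refine h.trans ?_
    filter_upwards [condExp_Y_sub_τ hf hY] with z hz
    rw [Pi.mul_apply]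
    exact (congrArg (g (covPred f z) * ·) hz).trans (mul_zero _)
  rw [integral_congr_ae h2]; simp

include hf hY in
lemma ae_α_eq : ∀ᵐ x ∂pop.covLaw pop.q,
    pop.α f x = ∫ s, (pop.τ f x (f x s.1) - pop.μ x) ^ 2 ∂pop.κ x := by
  filter_upwards [ae_integral_τ hf hY] with x hx
  rw [variance_κ hf, hx]

include hf hY hY2 in
-- The conditional variance given (X, F) is the conditional expectation of the squared residual;
-- averaging both given X yields the same function.
lemma ae_β_eq : ∀ᵐ x ∂pop.covLaw pop.q,
    pop.β f x = ∫ s, (s.2 - pop.τ f x (f x s.1)) ^ 2 ∂pop.κ x := by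
  have hE := (memLp_Y_sub_τ hf hY hY2).integrable_sq
  have hEm : Measurable fun z : Cov d × Side m => (z.2.2 - pop.τ f z.1 (f z.1 z.2.1)) ^ 2 :=
    (measurable_snd.snd.sub (measurable_τ_comp hf)).pow_const 2
  have hvm : Measurable fun z : Cov d × Side m =>
      variance (fun y : ℝ => y) (pop.condY f (covPred f z)) :=
    measurable_variance_condY.comp (measurable_covPred hf)
  have h1 : pop.law[fun z : Cov d × Side m => (z.2.2 - pop.τ f z.1 (f z.1 z.2.1)) ^ 2|sigmaXF f]
      =ᵐ[pop.law] fun z => variance (fun y : ℝ => y) (pop.condY f (covPred f z)) := by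
    refine (condExp_eq_integral_condY hf (g := fun v y => (y - pop.τ f v.1 v.2) ^ 2)
      ((measurable_snd.sub (measurable_τ.comp measurable_fst)).pow_const 2) hE).trans ?_
    exact ae_of_all _ fun z => (variance_condY _).symm
  have hvi : Integrable (fun z : Cov d × Side m =>
      variance (fun y : ℝ => y) (pop.condY f (covPred f z))) pop.law := integrable_condExp.congr h1
  refine ae_integral_κ_eq_of_condExp_eq hf
    (g := fun z => variance (fun y : ℝ => y) (pop.condY f (covPred f z)))
    (h := fun z => (z.2.2 - pop.τ f z.1 (f z.1 z.2.1)) ^ 2) hvm hEm hvi hE ?_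
  refine (EventuallyEq.of_eq ?_).trans h1.symm
  exact condExp_of_stronglyMeasurable (sigmaXF_le hf)
    (measurable_sigmaXF measurable_variance_condY).stronglyMeasurable hvi

include hf hY hY2 in
-- This identifies the limit of the plug-in μ₂ − μ₁² before truncation. The square is expanded
-- around μ(x), because integrability is known for the centred variable.
lemma ae_μsq_sub_sq : ∀ᵐ x ∂pop.covLaw pop.q, pop.μsq f x - pop.μ x ^ 2 = pop.α f x := by
  filter_upwards [ae_integral_τ hf hY, ae_α_eq hf hY, ae_integrable_κ (integrable_τ hf hY),
    ae_integrable_κ (memLp_τ_sub_μ hf hY hY2).integrable_sq] with x h1 h2 h3 h4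
  rw [h2, μsq]
  have e : (fun s : Side m => pop.τ f x (f x s.1) ^ 2) = fun s =>
      (pop.τ f x (f x s.1) - pop.μ x) ^ 2 + (2 * pop.μ x * pop.τ f x (f x s.1) - pop.μ x ^ 2) := by
    ext s; ring
  have h5 : Integrable (fun s : Side m => 2 * pop.μ x * pop.τ f x (f x s.1) - pop.μ x ^ 2)
      (pop.κ x) := (h3.const_mul _).sub (integrable_const _)
  rw [e, integral_add h4 h5,
    integral_sub (h3.const_mul _) (integrable_const _), integral_const_mul, h1]
  simp
  ring

include hf hY hY2 in
lemma integrable_β : Integrable (pop.β f) (pop.covLaw pop.q) :=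
  (integrable_integral_κ ((measurable_snd.snd.sub (measurable_τ_comp hf)).pow_const 2)
    (memLp_Y_sub_τ hf hY hY2).integrable_sq).congr
    ((ae_β_eq hf hY hY2).mono fun _ h => h.symm)

include hf hY hY2 in
lemma integrable_α : Integrable (pop.α f) (pop.covLaw pop.q) :=
  (integrable_integral_κ (((measurable_τ_comp hf).sub
      (pop.measurable_μ.comp measurable_fst)).pow_const 2)
    (memLp_τ_sub_μ hf hY hY2).integrable_sq).congr
    ((ae_α_eq hf hY).mono fun _ h => h.symm)

/-- A bounded weight can be moved inside the conditional second moment given `X`. -/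
lemma integral_mul_sq_of_bounded {a c : Cov d → ℝ} {r : Cov d × Side m → ℝ} {C : ℝ}
    (ha : Measurable a) (haC : ∀ᵐ x ∂pop.covLaw pop.q, |a x| ≤ C)
    (hr : MemLp r 2 pop.law)
    (hc : ∀ᵐ x ∂pop.covLaw pop.q, c x = ∫ s, r (x, s) ^ 2 ∂pop.κ x) :
    Integrable (fun z => a z.1 * r z ^ 2) pop.law ∧
    ∫ z, a z.1 * r z ^ 2 ∂pop.law = ∫ x, a x * c x ∂pop.covLaw pop.q := by
  have hi : Integrable (fun z => a z.1 * r z ^ 2) pop.law :=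
    hr.integrable_sq.bdd_mul (ha.comp measurable_fst).aestronglyMeasurable
      (pop.ae_law_of_ae haC)
  refine ⟨hi, ?_⟩
  rw [integral_law hi]
  refine integral_congr_ae ?_
  filter_upwards [hc] with x hx
  rw [integral_const_mul, hx]

include hf hY hY2 in
/-- If the conditional variance `β` vanishes, the outcome is a function of `(X, F)`. -/
lemma ae_Y_eq_τ_of_β_eq_zero (h : ∀ᵐ x ∂pop.covLaw pop.q, pop.β f x = 0) :
    ∀ᵐ z ∂pop.law, z.2.2 = pop.τ f z.1 (f z.1 z.2.1) := by
  have hE := memLp_Y_sub_τ hf hY hY2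
  have h1 := (integral_mul_sq_of_bounded (a := fun _ => 1) (C := 1) measurable_const (by simp) hE
    (ae_β_eq hf hY hY2)).2
  simp only [one_mul] at h1
  rw [integral_congr_ae h, integral_zero, integral_eq_zero_iff_of_nonneg
    (fun z => sq_nonneg _) hE.integrable_sq] at h1
  filter_upwards [h1] with z hz
  have : z.2.2 - pop.τ f z.1 (f z.1 z.2.1) = 0 := by simpa using hz
  linarith

end Population

end PGAE

/-! ### Design densities -/

namespace PGAE

namespace Population

variable {d m : ℕ} {pop : Population d m}

variable (pop) in
/-- The normalising constant `E_q[√a]` of a design density. -/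
noncomputable def normConst (a : Cov d → ℝ) : ℝ := ∫ x, √(a x) ∂pop.covLaw pop.q

variable (pop) in
/-- The density of the design `density a` with respect to the population law of the covariates. -/
noncomputable def relDensity (a : Cov d → ℝ) (x : Cov d) : ℝ := √(a x) / pop.normConst a

lemma normConst_nonneg (a : Cov d → ℝ) : 0 ≤ pop.normConst a :=
  integral_nonneg fun _ => Real.sqrt_nonneg _

lemma relDensity_nonneg (a : Cov d → ℝ) (x : Cov d) : 0 ≤ pop.relDensity a x :=
  div_nonneg (Real.sqrt_nonneg _) (normConst_nonneg a)

lemma density_eq (a : Cov d → ℝ) (x : Cov d) :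
    pop.density a x = pop.q x * pop.relDensity a x := by
  rw [density, relDensity, normConst, mul_div_assoc]

section Bounds

variable {a : Cov d → ℝ} {σmin σmax : ℝ}

lemma measurable_relDensity (ha : Measurable a) : Measurable (pop.relDensity a) :=
  ha.sqrt.div_const _

lemma integrable_sqrt_of_mem_Icc (ha : Measurable a)
    (hab : ∀ᵐ x ∂pop.covLaw pop.q, a x ∈ Set.Icc σmin σmax) :
    Integrable (fun x => √(a x)) (pop.covLaw pop.q) := by
  refine Integrable.of_bound ha.sqrt.aestronglyMeasurable √σmax ?_
  filter_upwards [hab] with x hx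
  rw [Real.norm_of_nonneg (Real.sqrt_nonneg _)]
  exact Real.sqrt_le_sqrt hx.2

lemma normConst_mem_Icc (ha : Measurable a)
    (hab : ∀ᵐ x ∂pop.covLaw pop.q, a x ∈ Set.Icc σmin σmax) :
    pop.normConst a ∈ Set.Icc √σmin √σmax := by
  have hi := integrable_sqrt_of_mem_Icc ha hab
  constructor
  · have := integral_mono_ae (integrable_const √σmin) hi
      (hab.mono fun x hx => Real.sqrt_le_sqrt hx.1)
    simpa [normConst] using this
  · have := integral_mono_ae hi (integrable_const √σmax)
      (hab.mono fun x hx => Real.sqrt_le_sqrt hx.2)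
    simpa [normConst] using this

variable (hσ : 0 < σmin) (ha : Measurable a)
  (hab : ∀ᵐ x ∂pop.covLaw pop.q, a x ∈ Set.Icc σmin σmax)

include hσ ha hab in
lemma normConst_pos : 0 < pop.normConst a :=
  (Real.sqrt_pos.2 hσ).trans_le (normConst_mem_Icc ha hab).1

include hσ ha hab in
lemma relDensity_mem_Icc :
    ∀ᵐ x ∂pop.covLaw pop.q, pop.relDensity a x ∈ Set.Icc (√σmin / √σmax) (√σmax / √σmin) := by
  have hc := normConst_mem_Icc ha hab
  have h0 := normConst_pos hσ ha hab
  have h1 := Real.sqrt_pos.2 hσ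
  filter_upwards [hab] with x hx
  exact ⟨div_le_div₀ (Real.sqrt_nonneg _) (Real.sqrt_le_sqrt hx.1) h0 hc.2,
    div_le_div₀ (Real.sqrt_nonneg _) (Real.sqrt_le_sqrt hx.2) h1 hc.1⟩

include hσ ha hab in
lemma relDensity_pos : ∀ᵐ x ∂pop.covLaw pop.q, 0 < pop.relDensity a x := by
  filter_upwards [hab] with x hx
  exact div_pos (Real.sqrt_pos.2 (hσ.trans_le hx.1)) (normConst_pos hσ ha hab)

include hσ ha hab in
lemma inv_relDensity_le :
    ∀ᵐ x ∂pop.covLaw pop.q, |(pop.relDensity a x)⁻¹| ≤ √σmax / √σmin := by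
  have h1 := Real.sqrt_pos.2 hσ
  filter_upwards [relDensity_mem_Icc hσ ha hab, hab] with x hx hx2
  have h2 : 0 < √σmax := Real.sqrt_pos.2 (hσ.trans_le (hx2.1.trans hx2.2))
  rw [abs_of_nonneg (inv_nonneg.2 (relDensity_nonneg _ _)), ← inv_div]
  exact inv_anti₀ (div_pos h1 h2) hx.1

lemma covLaw_density (ha : Measurable a) : pop.covLaw (pop.density a)
    = (pop.covLaw pop.q).withDensity fun x => ENNReal.ofReal (pop.relDensity a x) := by
  have e : (fun x => ENNReal.ofReal (pop.density a x))
      = (fun x => ENNReal.ofReal (pop.q x)) * fun x => ENNReal.ofReal (pop.relDensity a x) := by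
    ext x
    rw [density_eq, Pi.mul_apply, ENNReal.ofReal_mul (pop.q_nonneg x)]
  rw [covLaw, covLaw, e, withDensity_mul _ pop.measurable_q.ennreal_ofReal
    (measurable_relDensity ha).ennreal_ofReal]

include hσ ha hab in
lemma lintegral_relDensity :
    ∫⁻ x, ENNReal.ofReal (pop.relDensity a x) ∂pop.covLaw pop.q = 1 := by
  have hi : Integrable (pop.relDensity a) (pop.covLaw pop.q) :=
    (integrable_sqrt_of_mem_Icc ha hab).div_const _
  rw [← ofReal_integral_eq_lintegral_ofReal hi (ae_of_all _ (relDensity_nonneg a))]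
  have : ∫ x, pop.relDensity a x ∂pop.covLaw pop.q = 1 := by
    simp only [relDensity, integral_div]
    exact div_self (normConst_pos hσ ha hab).ne'
  rw [this, ENNReal.ofReal_one]

lemma integral_covLaw_density (ha : Measurable a) (g : Cov d → ℝ) :
    ∫ x, g x ∂pop.covLaw (pop.density a)
      = ∫ x, pop.relDensity a x * g x ∂pop.covLaw pop.q := by
  rw [covLaw_density ha, integral_withDensity_eq_integral_toReal_smul
    (measurable_relDensity ha).ennreal_ofReal (ae_of_all _ fun _ => ENNReal.ofReal_lt_top)]
  simp [ENNReal.toReal_ofReal (relDensity_nonneg a _)]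

lemma compProd_covLaw_density (ha : Measurable a) : pop.covLaw (pop.density a) ⊗ₘ pop.κ
    = pop.law.withDensity fun z => ENNReal.ofReal (pop.relDensity a z.1) := by
  have hm := (measurable_relDensity (pop := pop) ha).ennreal_ofReal
  ext s hs
  rw [Measure.compProd_apply hs, covLaw_density ha, withDensity_apply _ hs,
    lintegral_withDensity_eq_lintegral_mul _ hm (Kernel.measurable_kernel_prodMk_left hs), law,
    ← lintegral_indicator hs, Measure.lintegral_compProd]
  · refine lintegral_congr fun x => ?_
    have : ∀ t, s.indicator (fun z : Cov d × Side m => ENNReal.ofReal (pop.relDensity a z.1)) (x, t)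
        = (Prod.mk x ⁻¹' s).indicator (fun _ => ENNReal.ofReal (pop.relDensity a x)) t :=
      fun t => rfl
    simp only [this]
    rw [lintegral_indicator (measurable_prodMk_left hs)]
    simp
  · exact (hm.comp measurable_fst).indicator hs

lemma integral_compProd_covLaw_density (ha : Measurable a) (g : Cov d × Side m → ℝ) :
    ∫ z, g z ∂(pop.covLaw (pop.density a) ⊗ₘ pop.κ)
      = ∫ z, pop.relDensity a z.1 * g z ∂pop.law := by
  have hm : Measurable fun z : Cov d × Side m => ENNReal.ofReal (pop.relDensity a z.1) :=
    (measurable_relDensity ha).ennreal_ofReal.comp measurable_fst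
  rw [compProd_covLaw_density ha, integral_withDensity_eq_integral_toReal_smul hm
    (ae_of_all _ fun _ => ENNReal.ofReal_lt_top)]
  simp [ENNReal.toReal_ofReal (relDensity_nonneg a _)]

include hσ ha hab in
/-- The experiment probability in terms of integrals under the population law. -/
lemma expProb_eq (γ : ℝ) (b : Cov d → ℝ) (x : Cov d) : pop.expProb γ a b x
    = min (γ * √(b x / a x) / ((∫ x', √(b x') ∂pop.covLaw pop.q) / pop.normConst a)) 1 := by
  -- The factor √a of the design density cancels the denominator, so the normaliser is E_q√b /
  -- E_q√a: an integral against a fixed measure.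
  have h : ∫ x', √(b x' / a x') ∂pop.covLaw (pop.density a)
      = (∫ x', √(b x') ∂pop.covLaw pop.q) / pop.normConst a := by
    rw [integral_covLaw_density ha, ← integral_div]
    refine integral_congr_ae ?_
    filter_upwards [hab] with x hx
    have h0 : 0 < a x := hσ.trans_le hx.1
    have h1 : √(a x) ≠ 0 := (Real.sqrt_pos.2 h0).ne'
    rw [relDensity, Real.sqrt_div' _ h0.le]
    field_simp
  rw [expProb, h]

lemma expProb_mem_Icc {γ : ℝ} (hγ : 0 ≤ γ) (a b : Cov d → ℝ) (x : Cov d) :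
    pop.expProb γ a b x ∈ Set.Icc 0 1 :=
  ⟨le_min (div_nonneg (mul_nonneg hγ (Real.sqrt_nonneg _))
    (integral_nonneg fun _ => Real.sqrt_nonneg _)) zero_le_one, min_le_right _ _⟩

lemma measurable_expProb (γ : ℝ) {b : Cov d → ℝ} (ha : Measurable a) (hb : Measurable b) :
    Measurable (pop.expProb γ a b) :=
  (((hb.div ha).sqrt.const_mul γ).div_const _).min measurable_const

end Bounds

/-! ### The asymptotic variance -/

section Variance

variable {f : Cov d → EuclideanSpace ℝ (Fin m) → ℝ} {a π : Cov d → ℝ} {σmin σmax πmin : ℝ}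
  (hf : Measurable fun z : Cov d × EuclideanSpace ℝ (Fin m) => f z.1 z.2)
  (hY : Integrable (fun z : Cov d × Side m => z.2.2) pop.law)
  (hY2 : MemLp (fun z : Cov d × Side m => z.2.2 - pop.μ z.1) 2 pop.law)
  (hσ : 0 < σmin) (ha : Measurable a)
  (hab : ∀ᵐ x ∂pop.covLaw pop.q, a x ∈ Set.Icc σmin σmax)
  (hπm : Measurable π) (hπmin : 0 < πmin)
  -- The second alternative covers the degenerate design: if β = 0 almost everywhere, the normaliser
  -- of π* is 0, division by zero returns 0, and π* has no positive lower bound.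
  (hdich : (∀ᵐ x ∂pop.covLaw pop.q, πmin ≤ π x) ∨ ∀ᵐ x ∂pop.covLaw pop.q, pop.β f x = 0)

/-- The part of the influence function that is due to the outcome. -/
noncomputable def residualInfluence (pop : Population d m)
    (f : Cov d → EuclideanSpace ℝ (Fin m) → ℝ) (a π : Cov d → ℝ) (z : Cov d × Side m) : ℝ :=
  (pop.relDensity a z.1)⁻¹ * (π z.1)⁻¹ * (z.2.2 - pop.τ f z.1 (f z.1 z.2.1))

/-- The part of the influence function that is due to the prediction. -/
noncomputable def predictionInfluence (pop : Population d m)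
    (f : Cov d → EuclideanSpace ℝ (Fin m) → ℝ) (a : Cov d → ℝ) (z : Cov d × Side m) : ℝ :=
  (pop.relDensity a z.1)⁻¹ * (pop.τ f z.1 (f z.1 z.2.1) - pop.μ z.1)

include hf ha hπm in
lemma measurable_residualInfluence : Measurable (pop.residualInfluence f a π) :=
  ((((measurable_relDensity ha).comp measurable_fst).inv).mul (hπm.comp measurable_fst).inv).mul
    (measurable_snd.snd.sub (measurable_τ_comp hf))

include hf ha in
lemma measurable_predictionInfluence : Measurable (pop.predictionInfluence f a) :=
  (((measurable_relDensity ha).comp measurable_fst).inv).mul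
    ((measurable_τ_comp hf).sub (pop.measurable_μ.comp measurable_fst))

include hf hY hY2 hσ ha hab hπm hπmin hdich in
lemma memLp_residualInfluence : MemLp (pop.residualInfluence f a π) 2 pop.law := by
  have hE := memLp_Y_sub_τ hf hY hY2
  rcases hdich with h | h
  · refine hE.of_le_mul (c := √σmax / √σmin * πmin⁻¹)
      (measurable_residualInfluence hf ha hπm).aestronglyMeasurable ?_
    filter_upwards [pop.ae_law_of_ae h, pop.ae_law_of_ae (inv_relDensity_le hσ ha hab)] with z h1 h2
    rw [residualInfluence, norm_mul, norm_mul]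
    have h3 : ‖(π z.1)⁻¹‖ ≤ πmin⁻¹ := by
      rw [Real.norm_of_nonneg (inv_nonneg.2 (hπmin.le.trans h1))]
      exact inv_anti₀ hπmin h1
    gcongr
    exact h2
  · refine (MemLp.zero (ε := ℝ)).ae_eq ?_
    filter_upwards [ae_Y_eq_τ_of_β_eq_zero hf hY hY2 h] with z hz
    simp [residualInfluence, ← hz]

include hf hY hY2 hσ ha hab in
lemma memLp_predictionInfluence : MemLp (pop.predictionInfluence f a) 2 pop.law := by
  refine (memLp_τ_sub_μ hf hY hY2).of_le_mul (c := √σmax / √σmin)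
    (measurable_predictionInfluence hf ha).aestronglyMeasurable ?_
  filter_upwards [pop.ae_law_of_ae (inv_relDensity_le hσ ha hab)] with z h2
  rw [predictionInfluence, norm_mul]
  gcongr
  exact h2

include hf hY hY2 hσ ha hab hπmin hdich in
-- Lets Y − τ be traded for ρπR, where R is the residual influence and ρ, π are the design weights.
-- This turns V, the derivative and the information into one weighted inner product. In the
-- degenerate case both sides are 0, although π may vanish.
lemma ae_mul_residualInfluence : ∀ᵐ z ∂pop.law,
    pop.relDensity a z.1 * π z.1 * pop.residualInfluence f a π z
      = z.2.2 - pop.τ f z.1 (f z.1 z.2.1) := by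
  rcases hdich with h | h
  · filter_upwards [pop.ae_law_of_ae h, pop.ae_law_of_ae (relDensity_pos hσ ha hab)] with z h1 h2
    have h3 : π z.1 ≠ 0 := (hπmin.trans_le h1).ne'
    rw [residualInfluence]
    field_simp
  · filter_upwards [ae_Y_eq_τ_of_β_eq_zero hf hY hY2 h] with z hz
    simp [residualInfluence, ← hz]

include hσ ha hab in
lemma ae_mul_predictionInfluence : ∀ᵐ z ∂pop.law,
    pop.relDensity a z.1 * pop.predictionInfluence f a z
      = pop.τ f z.1 (f z.1 z.2.1) - pop.μ z.1 := by
  filter_upwards [pop.ae_law_of_ae (relDensity_pos hσ ha hab)] with z h2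
  rw [predictionInfluence]
  field_simp

include hσ ha hab in
-- With p = qρ, the factor (q/p)² against dp becomes 1/ρ against the population law. Cancelling q is
-- legitimate because q > 0 almost everywhere under its own law.
lemma V_eq_integral_inv_relDensity : pop.V f (pop.density a) π
    = ∫ x, (pop.relDensity a x)⁻¹ * ((π x)⁻¹ * pop.β f x + pop.α f x) ∂pop.covLaw pop.q := by
  rw [V, integral_covLaw_density ha]
  refine integral_congr_ae ?_
  filter_upwards [pop.ae_q_pos, relDensity_pos hσ ha hab] with x h1 h2
  rw [density_eq]
  field_simp

include hf hY hY2 hσ ha hab hπm hπmin hdich in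
/-- The asymptotic variance is the second moment of the influence function. -/
lemma V_eq_integral_influence : pop.V f (pop.density a) π
    = ∫ z, ((z.2.2 - pop.τ f z.1 (f z.1 z.2.1)) * pop.residualInfluence f a π z
      + (pop.τ f z.1 (f z.1 z.2.1) - pop.μ z.1) * pop.predictionInfluence f a z) ∂pop.law := by
  have hE := memLp_Y_sub_τ hf hY hY2
  have hB := memLp_τ_sub_μ hf hY hY2
  have hR := memLp_residualInfluence hf hY hY2 hσ ha hab hπm hπmin hdich
  have hQ := memLp_predictionInfluence hf hY hY2 hσ ha hab
  have hρm := measurable_relDensity (pop := pop) ha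
  have hB2 := integral_mul_sq_of_bounded hρm.inv (inv_relDensity_le hσ ha hab) hB (ae_α_eq hf hY)
  have hαi : Integrable (fun x => (pop.relDensity a x)⁻¹ * pop.α f x) (pop.covLaw pop.q) :=
    (integrable_α hf hY hY2).bdd_mul hρm.inv.aestronglyMeasurable (inv_relDensity_le hσ ha hab)
  have i1 : Integrable (fun z : Cov d × Side m => (z.2.2 - pop.τ f z.1 (f z.1 z.2.1))
      * pop.residualInfluence f a π z) pop.law := hE.integrable_mul hR
  have i2 : Integrable (fun z : Cov d × Side m => (pop.τ f z.1 (f z.1 z.2.1) - pop.μ z.1)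
      * pop.predictionInfluence f a z) pop.law := hB.integrable_mul hQ
  rw [V_eq_integral_inv_relDensity hσ ha hab, integral_add i1 i2]
  have e2 : ∫ z : Cov d × Side m, (pop.τ f z.1 (f z.1 z.2.1) - pop.μ z.1)
      * pop.predictionInfluence f a z ∂pop.law
      = ∫ x, (pop.relDensity a x)⁻¹ * pop.α f x ∂pop.covLaw pop.q := by
    refine Eq.trans ?_ hB2.2
    refine integral_congr_ae (ae_of_all _ fun z => ?_)
    simp only [predictionInfluence, Pi.inv_apply]; ring
  have e3 : Integrable (fun x => (pop.relDensity a x)⁻¹ * ((π x)⁻¹ * pop.β f x))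
      (pop.covLaw pop.q) ∧ ∫ z : Cov d × Side m, (z.2.2 - pop.τ f z.1 (f z.1 z.2.1))
      * pop.residualInfluence f a π z ∂pop.law
      = ∫ x, (pop.relDensity a x)⁻¹ * ((π x)⁻¹ * pop.β f x) ∂pop.covLaw pop.q := by
    -- Without a lower bound on π no bounded weight is available, but then both integrands vanish
    -- almost everywhere.
    rcases hdich with h | h
    · have hb : ∀ᵐ x ∂pop.covLaw pop.q,
          |(pop.relDensity a x)⁻¹ * (π x)⁻¹| ≤ √σmax / √σmin * πmin⁻¹ := by
        filter_upwards [h, inv_relDensity_le hσ ha hab] with x h1 h2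
        rw [abs_mul]
        have h3 : |(π x)⁻¹| ≤ πmin⁻¹ := by
          rw [abs_of_nonneg (inv_nonneg.2 (hπmin.le.trans h1))]
          exact inv_anti₀ hπmin h1
        gcongr
      have hE2 := integral_mul_sq_of_bounded (hρm.inv.mul hπm.inv) hb hE (ae_β_eq hf hY hY2)
      constructor
      · refine ((integrable_β hf hY hY2).bdd_mul (hρm.inv.mul hπm.inv).aestronglyMeasurable
          hb).congr (ae_of_all _ fun x => ?_)
        simp only [Pi.mul_apply, Pi.inv_apply]; ring
      · refine Eq.trans (integral_congr_ae (ae_of_all _ fun z => ?_))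
          (hE2.2.trans (integral_congr_ae (ae_of_all _ fun x => ?_)))
        · simp only [residualInfluence, Pi.mul_apply, Pi.inv_apply]; ring
        · simp only [Pi.mul_apply, Pi.inv_apply]; ring
    · constructor
      · refine (integrable_zero _ _ _).congr ?_
        filter_upwards [h] with x hx
        simp [hx]
      · rw [integral_eq_zero_of_ae, integral_eq_zero_of_ae]
        · filter_upwards [h] with x hx
          simp [hx]
        · filter_upwards [ae_Y_eq_τ_of_β_eq_zero hf hY hY2 h] with z hz
          simp [← hz]
  rw [e2, e3.2, ← integral_add e3.1 hαi]
  simp only [mul_add]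

end Variance

end Population

end PGAE

/-! ### The efficiency bound -/

namespace PGAE

namespace Population

variable {d m : ℕ} {pop : Population d m} {f : Cov d → EuclideanSpace ℝ (Fin m) → ℝ}

/-- A variable with vanishing conditional expectation given `(X, F)` is orthogonal to the functions
of `(X, F)`. -/
lemma integral_mul_eq_zero_of_condExp_eq_zero
    (hf : Measurable fun z : Cov d × EuclideanSpace ℝ (Fin m) => f z.1 z.2)
    {r : Cov d × Side m → ℝ} (hr : Integrable r pop.law)
    (h0 : pop.law[r|sigmaXF f] =ᵐ[pop.law] 0) {h : Cov d × ℝ → ℝ} (hh : Measurable h)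
    (hi : Integrable (fun z => h (covPred f z) * r z) pop.law) :
    ∫ z, h (covPred f z) * r z ∂pop.law = 0 := by
  rw [← integral_condExp (sigmaXF_le hf)]
  have hm := condExp_mul_of_stronglyMeasurable_left
    (measurable_sigmaXF (f := f) hh).stronglyMeasurable hi hr
  have h2 : (pop.law[fun z => h (covPred f z) * r z|sigmaXF f]) =ᵐ[pop.law] 0 := by
    refine hm.trans ?_
    filter_upwards [h0] with z hz
    rw [Pi.mul_apply, hz, Pi.zero_apply, mul_zero]
  rw [integral_congr_ae h2]; simp

/-- Averaging over the conditional law given `X` preserves square integrability. -/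
lemma memLp_two_integral_κ {g : Cov d × Side m → ℝ} (hg : Measurable g)
    (hg2 : MemLp g 2 pop.law) : MemLp (fun z => ∫ s, g (z.1, s) ∂pop.κ z.1) 2 pop.law := by
  have hm : Measurable fun z : Cov d × Side m => ∫ s, g (z.1, s) ∂pop.κ z.1 :=
    (measurable_integral_κ hg).comp measurable_fst
  rw [memLp_two_iff_integrable_sq hm.aestronglyMeasurable]
  have h1 : Integrable (fun x => ∫ s, g (x, s) ^ 2 ∂pop.κ x) (pop.covLaw pop.q) :=
    integrable_integral_κ (g := fun z => g z ^ 2) (hg.pow_const 2) hg2.integrable_sq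
  have h2 : Integrable (fun z : Cov d × Side m => ∫ s, g (z.1, s) ^ 2 ∂pop.κ z.1) pop.law :=
    pop.measurePreserving_fst.integrable_comp_of_integrable h1
  refine h2.mono' (hm.pow_const 2).aestronglyMeasurable ?_
  filter_upwards [pop.ae_law_of_ae (ae_integrable_κ (g := fun z => g z ^ 2) hg2.integrable_sq)] with z hz
  have hgz : Measurable fun s => g (z.1, s) := hg.comp measurable_prodMk_left
  have hL : MemLp (fun s => g (z.1, s)) 2 (pop.κ z.1) :=
    (memLp_two_iff_integrable_sq hgz.aestronglyMeasurable).2 hz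
  -- Nonnegativity of the variance is Jensen's inequality for the square.
  have hv := variance_nonneg (fun s => g (z.1, s)) (pop.κ z.1)
  rw [variance_eq_sub hL] at hv
  rw [Real.norm_of_nonneg (sq_nonneg _)]
  simpa using hv

lemma abs_clip_le (x : ℝ) {c : ℝ} (hc : 0 ≤ c) : |max (-c) (min x c)| ≤ |x| := by
  rcases abs_cases x with h | h <;> rcases le_total x c with h1 | h1 <;>
    rcases le_total (-c) x with h2 | h2 <;> rw [abs_le] <;> constructor <;>
    simp [h1] <;> grind

lemma tendsto_clip (x : ℝ) :
    Tendsto (fun n : ℕ => max (-(n : ℝ)) (min x n)) atTop (𝓝 x) := by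
  refine tendsto_const_nhds.congr' ?_
  obtain ⟨N, hN⟩ := exists_nat_ge |x|
  filter_upwards [eventually_ge_atTop N] with n hn
  have h : |x| ≤ n := hN.trans (by exact_mod_cast hn)
  rw [min_eq_left (abs_le.1 h).2, max_eq_right (abs_le.1 h).1]

/-! ### Scores, pathwise derivative and Fisher information along a direction. -/

section Directions

variable {g : Cov d → ℝ → ℝ → ℝ}
  (hf : Measurable fun z : Cov d × EuclideanSpace ℝ (Fin m) => f z.1 z.2)
  (hY : Integrable (fun z : Cov d × Side m => z.2.2) pop.law)
  (hg : pop.IsDirection f g)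

variable (f g) in
/-- A direction, as a function of the data. -/
def scoreLabelled (z : Cov d × Side m) : ℝ := g z.1 (f z.1 z.2.1) z.2.2

variable (pop f g) in
/-- The score of an unlabelled observation, as a function of the data. -/
noncomputable def projScore (z : Cov d × Side m) : ℝ := pop.scoreUnlabelled f g z.1 (f z.1 z.2.1)

lemma IsDirection.measurable_uncurry (hg : pop.IsDirection f g) :
    Measurable (Function.uncurry fun (v : Cov d × ℝ) y => g v.1 v.2 y) :=
  hg.measurable.comp (measurable_fst.fst.prodMk (measurable_fst.snd.prodMk measurable_snd))

include hf hg in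
lemma measurable_scoreLabelled : Measurable (scoreLabelled (m := m) f g) :=
  hg.measurable.comp (measurable_fst.prodMk ((measurable_pred hf).prodMk measurable_snd.snd))

include hg in
lemma measurable_scoreUnlabelled :
    Measurable fun v : Cov d × ℝ => pop.scoreUnlabelled f g v.1 v.2 :=
  measurable_integral_condY hg.measurable_uncurry

include hf hg in
lemma measurable_projScore : Measurable (pop.projScore f g) :=
  (measurable_scoreUnlabelled hg).comp (measurable_covPred hf)

include hg in
lemma exists_bound_scores : ∃ C : ℝ, (∀ z : Cov d × Side m, |scoreLabelled f g z| ≤ C) ∧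
    ∀ z, |pop.projScore f g z| ≤ C := by
  obtain ⟨C, hC⟩ := hg.bounded
  refine ⟨C, fun z => hC _ _ _, fun z => ?_⟩
  have := norm_integral_le_of_norm_le_const (μ := pop.condY f (z.1, f z.1 z.2.1))
    (f := fun y => g z.1 (f z.1 z.2.1) y) (C := C) (ae_of_all _ fun y => hC z.1 (f z.1 z.2.1) y)
  simpa [projScore, scoreUnlabelled] using this

include hf hg in
lemma memLp_scoreLabelled : MemLp (scoreLabelled f g) 2 pop.law := by
  obtain ⟨C, hC, -⟩ := exists_bound_scores hg
  exact MemLp.of_bound (measurable_scoreLabelled hf hg).aestronglyMeasurable C (ae_of_all _ hC)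

include hf hg in
lemma memLp_projScore : MemLp (pop.projScore f g) 2 pop.law := by
  obtain ⟨C, -, hC⟩ := exists_bound_scores hg
  exact MemLp.of_bound (measurable_projScore hf hg).aestronglyMeasurable C (ae_of_all _ hC)

include hf hg in
lemma condExp_scoreLabelled :
    pop.law[scoreLabelled f g|sigmaXF f] =ᵐ[pop.law] pop.projScore f g :=
  condExp_eq_integral_condY hf (g := fun v y => g v.1 v.2 y) hg.measurable_uncurry
    ((memLp_scoreLabelled hf hg).integrable (by norm_num))

include hf hg in
lemma condExp_score_sub : pop.law[fun z => scoreLabelled f g z - pop.projScore f g z|sigmaXF f]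
    =ᵐ[pop.law] 0 := by
  have i1 := (memLp_scoreLabelled hf hg).integrable (q := 2) (by norm_num)
  have i2 := (memLp_projScore hf hg).integrable (q := 2) (by norm_num)
  have h1 := condExp_sub i1 i2 (sigmaXF f)
  have h2 : pop.law[pop.projScore f g|sigmaXF f] = pop.projScore f g :=
    condExp_of_stronglyMeasurable (sigmaXF_le hf)
      (measurable_sigmaXF (measurable_scoreUnlabelled hg)).stronglyMeasurable i2
  refine h1.trans ?_
  filter_upwards [condExp_scoreLabelled hf hg] with z hz
  simp [h2, hz]

include hf hY hg in
/-- The derivative of the mean outcome along a direction. -/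
lemma deriv_θPath (hY2 : MemLp (fun z : Cov d × Side m => z.2.2 - pop.μ z.1) 2 pop.law) :
    deriv (pop.θPath f g) 0 = ∫ z, ((z.2.2 - pop.τ f z.1 (f z.1 z.2.1))
        * (scoreLabelled f g z - pop.projScore f g z)
      + (pop.τ f z.1 (f z.1 z.2.1) - pop.μ z.1) * pop.projScore f g z) ∂pop.law := by
  obtain ⟨C, hC1, hC2⟩ := exists_bound_scores hg
  have hGm := measurable_scoreLabelled hf hg
  have hsm := measurable_projScore hf hg
  have hi1 : Integrable (fun z : Cov d × Side m => z.2.2 * scoreLabelled f g z) pop.law :=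
    hY.mul_bdd hGm.aestronglyMeasurable (ae_of_all _ hC1)
  -- The mean is affine in ε, so its derivative is E[Y g].
  have hpath : pop.θPath f g = fun ε => (∫ z, z.2.2 ∂pop.law)
      + ε * ∫ z, z.2.2 * scoreLabelled f g z ∂pop.law := by
    funext ε
    rw [θPath, ← integral_const_mul, ← integral_add hY (hi1.const_mul ε)]
    refine integral_congr_ae (ae_of_all _ fun z => ?_)
    simp only [scoreLabelled]; ring
  have hderiv : deriv (pop.θPath f g) 0 = ∫ z, z.2.2 * scoreLabelled f g z ∂pop.law := by
    rw [hpath]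
    simp
  have hE := memLp_Y_sub_τ hf hY hY2
  have hB := memLp_τ_sub_μ hf hY hY2
  have hG2 := memLp_scoreLabelled hf hg
  have hs2 := memLp_projScore hf hg
  have hr2 : MemLp (fun z => scoreLabelled f g z - pop.projScore f g z) 2 pop.law := hG2.sub hs2
  have hμ : Integrable (fun z : Cov d × Side m => pop.μ z.1) pop.law :=
    pop.measurePreserving_fst.integrable_comp_of_integrable (integrable_μ hY)
  have j1 : Integrable (fun z : Cov d × Side m => (z.2.2 - pop.τ f z.1 (f z.1 z.2.1))
      * (scoreLabelled f g z - pop.projScore f g z)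
      + (pop.τ f z.1 (f z.1 z.2.1) - pop.μ z.1) * pop.projScore f g z) pop.law :=
    (hE.integrable_mul hr2).add (hB.integrable_mul hs2)
  have j2 : Integrable (fun z : Cov d × Side m => pop.projScore f g z
      * (z.2.2 - pop.τ f z.1 (f z.1 z.2.1))) pop.law := hs2.integrable_mul hE
  have j3 : Integrable (fun z : Cov d × Side m => (pop.τ f z.1 (f z.1 z.2.1) - pop.μ z.1)
      * (scoreLabelled f g z - pop.projScore f g z)) pop.law := hB.integrable_mul hr2
  have j4 : Integrable (fun z : Cov d × Side m => pop.μ z.1 * scoreLabelled f g z) pop.law :=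
    hμ.mul_bdd hGm.aestronglyMeasurable (ae_of_all _ hC1)
  have e2 : ∫ z : Cov d × Side m, pop.projScore f g z
      * (z.2.2 - pop.τ f z.1 (f z.1 z.2.1)) ∂pop.law = 0 :=
    integral_mul_Y_sub_τ hf hY (g := fun v => pop.scoreUnlabelled f g v.1 v.2)
      (measurable_scoreUnlabelled hg) j2
  have e3 : ∫ z : Cov d × Side m, (pop.τ f z.1 (f z.1 z.2.1) - pop.μ z.1)
      * (scoreLabelled f g z - pop.projScore f g z) ∂pop.law = 0 :=
    integral_mul_eq_zero_of_condExp_eq_zero hf (hr2.integrable (by norm_num))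
      (condExp_score_sub hf hg) (h := fun v => pop.τ f v.1 v.2 - pop.μ v.1)
      (measurable_τ.sub (pop.measurable_μ.comp measurable_fst)) j3
  have e4 : ∫ z : Cov d × Side m, pop.μ z.1 * scoreLabelled f g z ∂pop.law = 0 := by
    rw [integral_law j4]
    refine integral_eq_zero_of_ae ?_
    filter_upwards [hg.mean_zero] with x hx
    rw [integral_const_mul]
    change pop.μ x * ∫ s, g x (f x s.1) s.2 ∂pop.κ x = 0
    rw [hx, mul_zero]
  -- With s the projected score, Yg = (Y−τ)(g−s) + (τ−μ)s + s(Y−τ) + (τ−μ)(g−s) + μg. The third and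
  -- fourth terms integrate to 0 by orthogonality given (X, F), the last because E[g | X] = 0.
  have : ∫ z : Cov d × Side m, z.2.2 * scoreLabelled f g z ∂pop.law
      = (∫ z, ((z.2.2 - pop.τ f z.1 (f z.1 z.2.1)) * (scoreLabelled f g z - pop.projScore f g z)
        + (pop.τ f z.1 (f z.1 z.2.1) - pop.μ z.1) * pop.projScore f g z) ∂pop.law)
        + ((∫ z : Cov d × Side m, pop.projScore f g z
            * (z.2.2 - pop.τ f z.1 (f z.1 z.2.1)) ∂pop.law)
          + ((∫ z : Cov d × Side m, (pop.τ f z.1 (f z.1 z.2.1) - pop.μ z.1)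
              * (scoreLabelled f g z - pop.projScore f g z) ∂pop.law)
            + ∫ z : Cov d × Side m, pop.μ z.1 * scoreLabelled f g z ∂pop.law)) := by
    have j34 := j3.add j4
    have j234 := j2.add j34
    simp only [Pi.add_def] at j34 j234
    rw [← integral_add j3 j4, ← integral_add j2 j34, ← integral_add j1 j234]
    refine integral_congr_ae (ae_of_all _ fun z => ?_)
    ring
  rw [hderiv, this, e2, e3, e4]; ring

variable {a π : Cov d → ℝ} {σmin σmax πmin : ℝ} (hσ : 0 < σmin) (ha : Measurable a)
  (hab : ∀ᵐ x ∂pop.covLaw pop.q, a x ∈ Set.Icc σmin σmax)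
  (hπm : Measurable π) (hπ01 : ∀ x, π x ∈ Set.Icc (0 : ℝ) 1)

include hσ ha hab in
lemma ae_abs_relDensity_le :
    ∀ᵐ x ∂pop.covLaw pop.q, |pop.relDensity a x| ≤ √σmax / √σmin := by
  filter_upwards [relDensity_mem_Icc hσ ha hab] with x hx
  rw [abs_of_nonneg (relDensity_nonneg _ _)]; exact hx.2

include hσ ha hab hπ01 in
lemma ae_abs_relDensity_mul_le :
    ∀ᵐ x ∂pop.covLaw pop.q, |pop.relDensity a x * π x| ≤ √σmax / √σmin := by
  filter_upwards [ae_abs_relDensity_le hσ ha hab] with x hx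
  rw [abs_mul, abs_of_nonneg (hπ01 x).1]
  exact (mul_le_of_le_one_right (abs_nonneg _) (hπ01 x).2).trans hx

include hf hg hσ ha hab hπm hπ01 in
/-- The information along a direction, in terms of the orthogonal parts of the score. -/
lemma information_eq : pop.information f (pop.density a) π g
    = ∫ z, (pop.relDensity a z.1 * π z.1 * (scoreLabelled f g z - pop.projScore f g z)
        * (scoreLabelled f g z - pop.projScore f g z)
      + pop.relDensity a z.1 * pop.projScore f g z * pop.projScore f g z) ∂pop.law := by
  have hρm := measurable_relDensity (pop := pop) ha
  have hG2 := memLp_scoreLabelled hf hg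
  have hs2 := memLp_projScore hf hg
  obtain ⟨C, hC1, hC2⟩ := exists_bound_scores hg
  have hr2 : MemLp (fun z => scoreLabelled f g z - pop.projScore f g z) 2 pop.law := hG2.sub hs2
  have hρ := pop.ae_law_of_ae (ae_abs_relDensity_le hσ ha hab)
  have hρπ := pop.ae_law_of_ae (ae_abs_relDensity_mul_le hσ ha hab hπ01)
  have k1 : Integrable (fun z : Cov d × Side m => pop.relDensity a z.1 * π z.1
      * ((scoreLabelled f g z - pop.projScore f g z) ^ 2)) pop.law :=
    hr2.integrable_sq.bdd_mul ((hρm.mul hπm).comp measurable_fst).aestronglyMeasurable hρπ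
  have k2 : Integrable (fun z : Cov d × Side m => pop.relDensity a z.1
      * (pop.projScore f g z) ^ 2) pop.law :=
    hs2.integrable_sq.bdd_mul (hρm.comp measurable_fst).aestronglyMeasurable hρ
  have k3 : Integrable (fun z : Cov d × Side m => (2 * (pop.relDensity a z.1 * π z.1)
      * pop.projScore f g z) * (scoreLabelled f g z - pop.projScore f g z)) pop.law := by
    have := ((hs2.integrable_mul hr2).bdd_mul
      ((hρm.mul hπm).comp measurable_fst).aestronglyMeasurable hρπ).const_mul 2
    refine this.congr (ae_of_all _ fun z => ?_)
    simp only [Pi.mul_apply, Function.comp]; ring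
  -- Pointwise πg² + (1−π)s² = π(g−s)² + s² + 2πs(g−s), and the cross term is a function of (X, F)
  -- times a variable with conditional mean 0.
  have e3 : ∫ z : Cov d × Side m, (2 * (pop.relDensity a z.1 * π z.1)
      * pop.projScore f g z) * (scoreLabelled f g z - pop.projScore f g z) ∂pop.law = 0 :=
    integral_mul_eq_zero_of_condExp_eq_zero hf (hr2.integrable (by norm_num))
      (condExp_score_sub hf hg)
      (h := fun v => 2 * (pop.relDensity a v.1 * π v.1) * pop.scoreUnlabelled f g v.1 v.2)
      ((((hρm.comp measurable_fst).mul (hπm.comp measurable_fst)).const_mul 2).mul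
        (measurable_scoreUnlabelled hg)) k3
  have k12 : Integrable (fun z : Cov d × Side m =>
      pop.relDensity a z.1 * π z.1 * (scoreLabelled f g z - pop.projScore f g z)
        * (scoreLabelled f g z - pop.projScore f g z)
      + pop.relDensity a z.1 * pop.projScore f g z * pop.projScore f g z) pop.law :=
    (k1.add k2).congr (ae_of_all _ fun z => by simp only [Pi.add_apply]; ring)
  rw [information, integral_compProd_covLaw_density ha, ← add_zero (∫ z, (_ + _) ∂pop.law), ← e3,
    ← integral_add k12 k3]
  refine integral_congr_ae (ae_of_all _ fun z => ?_)
  simp only [scoreLabelled, projScore]; ring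

end Directions

/-! ### The Cramér–Rao inequality and its asymptotic attainment. -/

section Efficiency

variable {a π : Cov d → ℝ} {σmin σmax πmin : ℝ}
  (hf : Measurable fun z : Cov d × EuclideanSpace ℝ (Fin m) => f z.1 z.2)
  (hY : Integrable (fun z : Cov d × Side m => z.2.2) pop.law)
  (hY2 : MemLp (fun z : Cov d × Side m => z.2.2 - pop.μ z.1) 2 pop.law)
  (hσ : 0 < σmin) (ha : Measurable a)
  (hab : ∀ᵐ x ∂pop.covLaw pop.q, a x ∈ Set.Icc σmin σmax)
  (hα : ∀ᵐ x ∂pop.covLaw pop.q, σmin ≤ pop.α f x)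
  (hπm : Measurable π) (hπ01 : ∀ x, π x ∈ Set.Icc (0 : ℝ) 1) (hπmin : 0 < πmin)
  (hdich : (∀ᵐ x ∂pop.covLaw pop.q, πmin ≤ π x) ∨ ∀ᵐ x ∂pop.covLaw pop.q, pop.β f x = 0)

include hf hY hY2 hσ ha hab hπm hπ01 hπmin hdich in
/-- The Cramér–Rao bound of a direction is at most the asymptotic variance. -/
lemma sq_deriv_div_information_le {g : Cov d → ℝ → ℝ → ℝ} (hg : pop.IsDirection f g)
    (hI : 0 < pop.information f (pop.density a) π g) :
    (deriv (pop.θPath f g) 0) ^ 2 / pop.information f (pop.density a) π g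
      ≤ pop.V f (pop.density a) π := by
  have hV := V_eq_integral_influence hf hY hY2 hσ ha hab hπm hπmin hdich
  have hIe := information_eq hf hg hσ ha hab hπm hπ01
  have hD := deriv_θPath hf hY hg hY2
  have hρm := measurable_relDensity (pop := pop) ha
  have hE := memLp_Y_sub_τ hf hY hY2
  have hB := memLp_τ_sub_μ hf hY hY2
  have hR := memLp_residualInfluence hf hY hY2 hσ ha hab hπm hπmin hdich
  have hQ := memLp_predictionInfluence hf hY hY2 hσ ha hab
  have hG2 := memLp_scoreLabelled hf hg
  have hs2 := memLp_projScore hf hg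
  have hr2 : MemLp (fun z => scoreLabelled f g z - pop.projScore f g z) 2 pop.law := hG2.sub hs2
  have hρ := pop.ae_law_of_ae (ae_abs_relDensity_le hσ ha hab)
  have hρπ := pop.ae_law_of_ae (ae_abs_relDensity_mul_le hσ ha hab hπ01)
  set I := pop.information f (pop.density a) π g
  set D := deriv (pop.θPath f g) 0
  set lam := D / I
  have iV : Integrable (fun z : Cov d × Side m => (z.2.2 - pop.τ f z.1 (f z.1 z.2.1))
      * pop.residualInfluence f a π z
      + (pop.τ f z.1 (f z.1 z.2.1) - pop.μ z.1) * pop.predictionInfluence f a z) pop.law :=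
    (hE.integrable_mul hR).add (hB.integrable_mul hQ)
  have iD : Integrable (fun z : Cov d × Side m => (z.2.2 - pop.τ f z.1 (f z.1 z.2.1))
        * (scoreLabelled f g z - pop.projScore f g z)
      + (pop.τ f z.1 (f z.1 z.2.1) - pop.μ z.1) * pop.projScore f g z) pop.law :=
    (hE.integrable_mul hr2).add (hB.integrable_mul hs2)
  have iI : Integrable (fun z : Cov d × Side m =>
      pop.relDensity a z.1 * π z.1 * (scoreLabelled f g z - pop.projScore f g z)
        * (scoreLabelled f g z - pop.projScore f g z)
      + pop.relDensity a z.1 * pop.projScore f g z * pop.projScore f g z) pop.law := by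
    refine Integrable.add ?_ ?_
    · refine (hr2.integrable_sq.bdd_mul ((hρm.mul hπm).comp measurable_fst).aestronglyMeasurable
        hρπ).congr (ae_of_all _ fun z => ?_)
      simp only [Pi.mul_apply, Function.comp]; ring
    · refine (hs2.integrable_sq.bdd_mul (hρm.comp measurable_fst).aestronglyMeasurable
        hρ).congr (ae_of_all _ fun z => ?_)
      simp only [Function.comp]; ring
  -- Cauchy–Schwarz as nonnegativity of a quadratic: the right side is E[ρπ(λr − R)² + ρ(λs − Q)²],
  -- with r = g − s, R and Q the two parts of the influence function, and λ = D/I the minimiser.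
  have key : 0 ≤ lam ^ 2 * I - 2 * lam * D + pop.V f (pop.density a) π := by
    have iID := (iI.const_mul (lam ^ 2)).sub (iD.const_mul (2 * lam))
    simp only [Pi.sub_def] at iID
    rw [hIe, hD, hV, ← integral_const_mul, ← integral_const_mul,
      ← integral_sub (iI.const_mul _) (iD.const_mul _), ← integral_add iID iV]
    refine integral_nonneg_of_ae ?_
    filter_upwards [ae_mul_residualInfluence hf hY hY2 hσ ha hab hπmin hdich,
      ae_mul_predictionInfluence (f := f) hσ ha hab] with z h1 h2
    simp only [Pi.zero_apply]
    rw [← h1, ← h2]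
    have n1 : 0 ≤ pop.relDensity a z.1 := relDensity_nonneg _ _
    have n2 := (hπ01 z.1).1
    have : 0 ≤ pop.relDensity a z.1 * π z.1 * (lam * (scoreLabelled f g z - pop.projScore f g z)
        - pop.residualInfluence f a π z) ^ 2 + pop.relDensity a z.1
        * (lam * pop.projScore f g z - pop.predictionInfluence f a z) ^ 2 := by positivity
    refine this.trans (le_of_eq ?_)
    ring
  have hl : lam * I = D := div_mul_cancel₀ _ hI.ne'
  have e1 : lam ^ 2 * I = D ^ 2 / I := by
    simp only [lam]; field_simp
  have e2 : 2 * lam * D = 2 * (D ^ 2 / I) := by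
    simp only [lam]; field_simp
  rw [e1, e2] at key
  linarith

include hf hY hY2 hσ ha hab hα hπm hπ01 hπmin hdich in
/-- The asymptotic variance is positive. -/
lemma V_pos : 0 < pop.V f (pop.density a) π := by
  have hE := memLp_Y_sub_τ hf hY hY2
  have hB := memLp_τ_sub_μ hf hY hY2
  have hR := memLp_residualInfluence hf hY hY2 hσ ha hab hπm hπmin hdich
  have hQ := memLp_predictionInfluence hf hY hY2 hσ ha hab
  have hρm := measurable_relDensity (pop := pop) ha
  have hB2 := integral_mul_sq_of_bounded hρm.inv (inv_relDensity_le hσ ha hab) hB (ae_α_eq hf hY)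
  have hαi : Integrable (fun x => (pop.relDensity a x)⁻¹ * pop.α f x) (pop.covLaw pop.q) :=
    (integrable_α hf hY hY2).bdd_mul hρm.inv.aestronglyMeasurable (inv_relDensity_le hσ ha hab)
  -- One point of the full-measure set gives σmin ≤ σmax, hence σmax > 0.
  obtain ⟨x0, hx0⟩ := hab.exists
  have h1 := Real.sqrt_pos.2 hσ
  have h2 : 0 < √σmax := Real.sqrt_pos.2 (hσ.trans_le (hx0.1.trans hx0.2))
  -- Positivity has to come from the prediction part, since the outcome part may vanish.
  have hlow : (√σmax / √σmin)⁻¹ * σmin ≤ ∫ x, (pop.relDensity a x)⁻¹ * pop.α f x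
      ∂pop.covLaw pop.q := by
    have := integral_mono_ae (μ := pop.covLaw pop.q)
      (integrable_const ((√σmax / √σmin)⁻¹ * σmin)) hαi ?_
    · simpa using this
    · filter_upwards [relDensity_mem_Icc hσ ha hab, relDensity_pos hσ ha hab, hα] with x h3 h4 h5
      have := inv_anti₀ h4 h3.2
      gcongr
  have hpos : 0 < (√σmax / √σmin)⁻¹ * σmin := by positivity
  refine (hpos.trans_le hlow).trans_le ?_
  refine hB2.2.symm.trans_le ?_
  rw [V_eq_integral_influence hf hY hY2 hσ ha hab hπm hπmin hdich]
  refine integral_mono_ae hB2.1 ((hE.integrable_mul hR).add (hB.integrable_mul hQ)) ?_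
  filter_upwards [ae_mul_residualInfluence hf hY hY2 hσ ha hab hπmin hdich] with z h3
  have n1 : 0 ≤ pop.relDensity a z.1 := relDensity_nonneg _ _
  have n2 := (hπ01 z.1).1
  simp only [predictionInfluence, Pi.inv_apply]
  rw [← h3]
  have : 0 ≤ pop.relDensity a z.1 * π z.1 * (pop.residualInfluence f a π z) ^ 2 := by positivity
  nlinarith

/-- Averages of the truncations of a centred square integrable variable tend to zero. -/
lemma tendsto_eLpNorm_integral_κ_clip {G : Cov d × Side m → ℝ} (hG : Measurable G)
    (hG2 : MemLp G 2 pop.law) (h0 : ∀ᵐ x ∂pop.covLaw pop.q, ∫ s, G (x, s) ∂pop.κ x = 0) :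
    Tendsto (fun n : ℕ => eLpNorm (fun z : Cov d × Side m =>
      ∫ s, max (-(n : ℝ)) (min (G (z.1, s)) n) ∂pop.κ z.1) 2 pop.law) atTop (𝓝 0) := by
  refine LTwo.tendsto_eLpNorm_two_of_dominated
    (memLp_two_integral_κ (g := fun z => |G z|) hG.abs hG2.abs) (fun n => ?_)
    (Eventually.of_forall fun n => ?_) ?_
  · exact ((measurable_integral_κ (g := fun z => max (-(n : ℝ)) (min (G z) n))
      (measurable_const.max (hG.min measurable_const))).comp measurable_fst).aestronglyMeasurable
  · filter_upwards [pop.ae_law_of_ae (ae_integrable_κ (g := fun z => |G z|)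
      (hG2.integrable (by norm_num)).abs)] with z hz
    have := norm_integral_le_of_norm_le (f := fun s => max (-(n : ℝ)) (min (G (z.1, s)) n)) hz
      (ae_of_all _ fun s => abs_clip_le _ n.cast_nonneg)
    exact this.trans (le_abs_self _)
  · filter_upwards [pop.ae_law_of_ae h0, pop.ae_law_of_ae (ae_integrable_κ (g := fun z => |G z|)
      (hG2.integrable (by norm_num)).abs)] with z hz hi
    rw [← hz]
    refine tendsto_integral_of_dominated_convergence (fun s => |G (z.1, s)|) (fun n => ?_) hi
      (fun n => ae_of_all _ fun s => abs_clip_le _ n.cast_nonneg)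
      (ae_of_all _ fun s => tendsto_clip _)
    exact (measurable_const.max ((hG.comp measurable_prodMk_left).min
      measurable_const)).aestronglyMeasurable

include hf hY hY2 hσ ha hab hα hπm hπ01 hπmin hdich in
/-- The asymptotic variance is the semiparametric efficiency bound. -/
theorem isEfficiencyBound_V :
    pop.IsEfficiencyBound f (pop.density a) π (pop.V f (pop.density a) π) := by
  have hVpos := V_pos hf hY hY2 hσ ha hab hα hπm hπ01 hπmin hdich
  refine ⟨?_, fun b hb => ?_⟩
  · rintro c ⟨g, hg, hI, rfl⟩
    exact sq_deriv_div_information_le hf hY hY2 hσ ha hab hπm hπ01 hπmin hdich hg hI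
  have hV := V_eq_integral_influence hf hY hY2 hσ ha hab hπm hπmin hdich
  have hρm := measurable_relDensity (pop := pop) ha
  have hE := memLp_Y_sub_τ hf hY hY2
  have hB := memLp_τ_sub_μ hf hY hY2
  have hR := memLp_residualInfluence hf hY hY2 hσ ha hab hπm hπmin hdich
  have hQ := memLp_predictionInfluence hf hY hY2 hσ ha hab
  have hρ := pop.ae_law_of_ae (ae_abs_relDensity_le hσ ha hab)
  have hρπ := pop.ae_law_of_ae (ae_abs_relDensity_mul_le hσ ha hab hπ01)
  -- The equality case of Cauchy–Schwarz: g − s = R and s = Q. It is square integrable and centred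
  -- given X, but possibly unbounded, hence not itself admissible.
  set gs : Cov d → ℝ → ℝ → ℝ := fun x v y =>
    (pop.relDensity a x)⁻¹ * (π x)⁻¹ * (y - pop.τ f x v)
      + (pop.relDensity a x)⁻¹ * (pop.τ f x v - pop.μ x) with hgs
  have hgsm : Measurable fun z : Cov d × ℝ × ℝ => gs z.1 z.2.1 z.2.2 := by
    have hτ : Measurable fun z : Cov d × ℝ × ℝ => pop.τ f z.1 z.2.1 :=
      measurable_τ.comp (measurable_fst.prodMk measurable_snd.fst)
    have h1 : Measurable fun z : Cov d × ℝ × ℝ => (pop.relDensity a z.1)⁻¹ :=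
      hρm.inv.comp measurable_fst
    have h2 : Measurable fun z : Cov d × ℝ × ℝ => (π z.1)⁻¹ := hπm.inv.comp measurable_fst
    have h3 : Measurable fun z : Cov d × ℝ × ℝ => pop.μ z.1 :=
      pop.measurable_μ.comp measurable_fst
    exact ((h1.mul h2).mul (measurable_snd.snd.sub hτ)).add (h1.mul (hτ.sub h3))
  set G : Cov d × Side m → ℝ := scoreLabelled f gs with hGdef
  have hGeq : ∀ z, G z = pop.residualInfluence f a π z + pop.predictionInfluence f a z :=
    fun z => rfl
  have hGm : Measurable G :=
    hgsm.comp (measurable_fst.prodMk ((measurable_pred hf).prodMk measurable_snd.snd))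
  have hG2 : MemLp G 2 pop.law := hR.add hQ
  have hRc : pop.law[pop.residualInfluence f a π|sigmaXF f] =ᵐ[pop.law] 0 := by
    have h := condExp_mul_of_stronglyMeasurable_left (measurable_sigmaXF (f := f)
      (g := fun v => (pop.relDensity a v.1)⁻¹ * (π v.1)⁻¹)
      ((hρm.inv.comp measurable_fst).mul (hπm.inv.comp measurable_fst))).stronglyMeasurable
      (hR.integrable (by norm_num)) (hY.sub (integrable_τ hf hY))
    refine h.trans ?_
    filter_upwards [condExp_Y_sub_τ hf hY] with z hz
    rw [Pi.mul_apply]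
    exact (congrArg _ hz).trans (mul_zero _)
  have hQc : pop.law[pop.predictionInfluence f a|sigmaXF f] = pop.predictionInfluence f a :=
    condExp_of_stronglyMeasurable (sigmaXF_le hf) (measurable_sigmaXF (f := f)
      (g := fun v => (pop.relDensity a v.1)⁻¹ * (pop.τ f v.1 v.2 - pop.μ v.1))
      ((hρm.inv.comp measurable_fst).mul (measurable_τ.sub
        (pop.measurable_μ.comp measurable_fst)))).stronglyMeasurable (hQ.integrable (by norm_num))
  have hGc : pop.law[G|sigmaXF f] =ᵐ[pop.law] pop.predictionInfluence f a := by
    refine (condExp_add (hR.integrable (by norm_num)) (hQ.integrable (by norm_num)) _).trans ?_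
    filter_upwards [hRc] with z hz
    simp [hz, hQc]
  have hG0 : ∀ᵐ x ∂pop.covLaw pop.q, ∫ s, G (x, s) ∂pop.κ x = 0 := by
    have h1 := ae_integral_κ_eq_of_condExp_eq hf hGm
      (measurable_predictionInfluence hf ha) (hG2.integrable (by norm_num))
      (hQ.integrable (by norm_num)) (hGc.trans (EventuallyEq.of_eq hQc.symm))
    filter_upwards [h1, ae_integral_τ hf hY, ae_integrable_κ (integrable_τ hf hY)] with x h2 h3 h4
    rw [h2]
    simp only [predictionInfluence]
    rw [integral_const_mul, integral_sub h4 (integrable_const _), h3]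
    simp
  set c : ℕ → Cov d × Side m → ℝ := fun n z => max (-(n : ℝ)) (min (G z) n) with hc
  have hcm : ∀ n, Measurable (c n) := fun n => measurable_const.max (hGm.min measurable_const)
  have hcb : ∀ n z, |c n z| ≤ n := fun n z =>
    abs_le.2 ⟨le_max_left _ _, max_le (by simp) (min_le_right _ _)⟩
  -- Truncation restores boundedness but disturbs the conditional mean, which is subtracted. The
  -- correction tends to 0 in L² because the untruncated direction is centred.
  set gn : ℕ → Cov d → ℝ → ℝ → ℝ := fun n x v y => max (-(n : ℝ)) (min (gs x v y) n)
    - ∫ s, c n (x, s) ∂pop.κ x with hgn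
  have hmb : ∀ n x, |∫ s, c n (x, s) ∂pop.κ x| ≤ n := fun n x => by
    have := norm_integral_le_of_norm_le_const (μ := pop.κ x) (f := fun s => c n (x, s)) (C := n)
      (ae_of_all _ fun s => hcb n (x, s))
    simpa using this
  have hdir : ∀ n, pop.IsDirection f (gn n) := fun n => by
    refine ⟨?_, ⟨n + n, fun x v y => ?_⟩, ae_of_all _ fun x => ?_⟩
    · exact (measurable_const.max (hgsm.min measurable_const)).sub
        ((measurable_integral_κ (hcm n)).comp measurable_fst)
    · refine (abs_sub _ _).trans (add_le_add ?_ (hmb n x))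
      exact abs_le.2 ⟨le_max_left _ _, max_le (by simp) (min_le_right _ _)⟩
    · have hi : Integrable (fun s => c n (x, s)) (pop.κ x) :=
        Integrable.of_bound ((hcm n).comp measurable_prodMk_left).aestronglyMeasurable n
          (ae_of_all _ fun s => hcb n (x, s))
      change ∫ s, (c n (x, s) - ∫ s, c n (x, s) ∂pop.κ x) ∂pop.κ x = 0
      rw [integral_sub hi (integrable_const _)]
      simp
  have hGn : Tendsto (fun n => eLpNorm (fun z => scoreLabelled f (gn n) z - G z) 2 pop.law) atTop
      (𝓝 0) := by
    have h1 : Tendsto (fun n => eLpNorm (fun z => c n z - G z) 2 pop.law) atTop (𝓝 0) := by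
      refine LTwo.tendsto_eLpNorm_two_of_dominated (g := fun z => 2 * G z) (hG2.const_mul 2)
        (fun n => ((hcm n).sub hGm).aestronglyMeasurable)
        (Eventually.of_forall fun n => ae_of_all _ fun z => ?_) (ae_of_all _ fun z => ?_)
      · refine (abs_sub _ _).trans ?_
        rw [abs_mul, abs_two, two_mul]
        exact add_le_add (abs_clip_le _ n.cast_nonneg) le_rfl
      · simpa using (tendsto_clip (G z)).sub_const (G z)
    have h2 := tendsto_eLpNorm_integral_κ_clip hGm hG2 hG0
    have h3 := h1.add h2
    rw [add_zero] at h3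
    refine tendsto_of_tendsto_of_tendsto_of_le_of_le tendsto_const_nhds h3 (fun _ => zero_le)
      fun n => ?_
    have e : (fun z => scoreLabelled f (gn n) z - G z) = (fun z => c n z - G z)
        - fun z : Cov d × Side m => ∫ s, c n (z.1, s) ∂pop.κ z.1 := by
      ext z
      simp only [scoreLabelled, hgn, hc, hGdef, Pi.sub_apply]; ring
    rw [e]
    exact eLpNorm_sub_le ((hcm n).sub hGm).aestronglyMeasurable
      ((measurable_integral_κ (hcm n)).comp measurable_fst).aestronglyMeasurable (by norm_num)
  have hLn := fun n => memLp_scoreLabelled hf (hdir n)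
  have hsn2 := fun n => memLp_projScore hf (hdir n)
  have hrn2 : ∀ n, MemLp (fun z => scoreLabelled f (gn n) z - pop.projScore f (gn n) z) 2 pop.law :=
    fun n => (hLn n).sub (hsn2 n)
  -- Conditional expectation given (X, F) is an L² contraction, so convergence of the scores passes
  -- to their projections.
  have hsn : Tendsto (fun n => eLpNorm (fun z => pop.projScore f (gn n) z
      - pop.predictionInfluence f a z) 2 pop.law) atTop (𝓝 0) := by
    refine tendsto_of_tendsto_of_tendsto_of_le_of_le tendsto_const_nhds hGn (fun _ => zero_le)
      fun n => ?_
    refine le_trans (le_of_eq ?_) (eLpNorm_condExp_le_eLpNorm (m := sigmaXF f) _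
      (by norm_num : (1 : ℝ≥0∞) ≤ 2))
    refine eLpNorm_congr_ae ?_
    have h1 := condExp_sub (m := sigmaXF f) ((hLn n).integrable (by norm_num))
      (hG2.integrable (by norm_num))
    filter_upwards [h1, condExp_scoreLabelled hf (hdir n), hGc] with z h2 h3 h4
    refine Eq.trans ?_ h2.symm
    rw [Pi.sub_apply, h3, h4]
  have hrn : Tendsto (fun n => eLpNorm (fun z => scoreLabelled f (gn n) z
      - pop.projScore f (gn n) z - pop.residualInfluence f a π z) 2 pop.law) atTop (𝓝 0) := by
    have h3 := hGn.add hsn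
    rw [add_zero] at h3
    refine tendsto_of_tendsto_of_tendsto_of_le_of_le tendsto_const_nhds h3 (fun _ => zero_le)
      fun n => ?_
    have e : (fun z => scoreLabelled f (gn n) z
      - pop.projScore f (gn n) z - pop.residualInfluence f a π z)
        = (fun z => scoreLabelled f (gn n) z - G z)
        - fun z => pop.projScore f (gn n) z - pop.predictionInfluence f a z := by
      ext z
      simp only [Pi.sub_apply, hGeq]; ring
    rw [e]
    exact eLpNorm_sub_le ((hLn n).sub hG2).1 ((hsn2 n).sub hQ).1 (by norm_num)
  have hrnm := fun n => (hrn2 n).1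
  have hsnm := fun n => (hsn2 n).1
  have tconst : ∀ {h : Cov d × Side m → ℝ}, Tendsto (fun _ : ℕ =>
      eLpNorm (fun z => h z - h z) 2 pop.law) atTop (𝓝 0) := by simp
  have hρmz : AEStronglyMeasurable (fun z : Cov d × Side m => pop.relDensity a z.1) pop.law :=
    (hρm.comp measurable_fst).aestronglyMeasurable
  have hρπmz : AEStronglyMeasurable (fun z : Cov d × Side m => pop.relDensity a z.1 * π z.1)
      pop.law := ((hρm.mul hπm).comp measurable_fst).aestronglyMeasurable
  have hρr := LTwo.tendsto_eLpNorm_mul_sub hR hρπmz (fun _ => hρπmz) hrnm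
    (Eventually.of_forall fun _ => hρπ) (ae_of_all _ fun _ => tendsto_const_nhds) hrn
  have hρs := LTwo.tendsto_eLpNorm_mul_sub hQ hρmz (fun _ => hρmz) hsnm
    (Eventually.of_forall fun _ => hρ) (ae_of_all _ fun _ => tendsto_const_nhds) hsn
  have hEe : ∫ z : Cov d × Side m, (z.2.2 - pop.τ f z.1 (f z.1 z.2.1))
      * pop.residualInfluence f a π z ∂pop.law = ∫ z, pop.relDensity a z.1 * π z.1
        * pop.residualInfluence f a π z * pop.residualInfluence f a π z ∂pop.law := by
    refine integral_congr_ae ?_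
    filter_upwards [ae_mul_residualInfluence hf hY hY2 hσ ha hab hπmin hdich] with z hz
    rw [hz]
  have hQe : ∫ z : Cov d × Side m, (pop.τ f z.1 (f z.1 z.2.1) - pop.μ z.1)
      * pop.predictionInfluence f a z ∂pop.law = ∫ z, pop.relDensity a z.1
        * pop.predictionInfluence f a z * pop.predictionInfluence f a z ∂pop.law := by
    refine integral_congr_ae ?_
    filter_upwards [ae_mul_predictionInfluence (f := f) hσ ha hab] with z hz
    rw [hz]
  have hρR : MemLp (fun z : Cov d × Side m => pop.relDensity a z.1 * π z.1
      * pop.residualInfluence f a π z) 2 pop.law := by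
    refine hE.ae_eq ?_
    filter_upwards [ae_mul_residualInfluence hf hY hY2 hσ ha hab hπmin hdich] with z hz
    rw [hz]
  have hρQ : MemLp (fun z : Cov d × Side m => pop.relDensity a z.1
      * pop.predictionInfluence f a z) 2 pop.law := by
    refine hB.ae_eq ?_
    filter_upwards [ae_mul_predictionInfluence (f := f) hσ ha hab] with z hz
    rw [hz]
  have bm : ∀ {w r : Cov d × Side m → ℝ} {K : ℝ}, AEStronglyMeasurable w pop.law →
      (∀ᵐ z ∂pop.law, |w z| ≤ K) → MemLp r 2 pop.law → MemLp (fun z => w z * r z) 2 pop.law :=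
    fun {w r K} hw hK hr => hr.of_le_mul (c := K) (hw.mul hr.1) (hK.mono fun z hz => by
      rw [norm_mul]; gcongr; exact hz)
  have hV' : pop.V f (pop.density a) π = (∫ z : Cov d × Side m,
      (z.2.2 - pop.τ f z.1 (f z.1 z.2.1)) * pop.residualInfluence f a π z ∂pop.law)
      + ∫ z : Cov d × Side m, (pop.τ f z.1 (f z.1 z.2.1) - pop.μ z.1)
        * pop.predictionInfluence f a z ∂pop.law := by
    rw [hV]; exact integral_add (hE.integrable_mul hR) (hB.integrable_mul hQ)
  -- Information and derivative both tend to V, so the Cramér–Rao ratios tend to V²/V = V.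
  have limI : Tendsto (fun n => pop.information f (pop.density a) π (gn n)) atTop
      (𝓝 (pop.V f (pop.density a) π)) := by
    rw [hV', hEe, hQe]
    refine ((LTwo.tendsto_integral_mul hρR hR (fun n => hρπmz.mul (hrnm n)) hrnm hρr hrn).add
      (LTwo.tendsto_integral_mul hρQ hQ (fun n => hρmz.mul (hsnm n)) hsnm hρs hsn)).congr
      fun n => ?_
    rw [information_eq hf (hdir n) hσ ha hab hπm hπ01]
    exact (integral_add ((bm hρπmz hρπ (hrn2 n)).integrable_mul (hrn2 n))
      ((bm hρmz hρ (hsn2 n)).integrable_mul (hsn2 n))).symm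
  have limD : Tendsto (fun n => deriv (pop.θPath f (gn n)) 0) atTop
      (𝓝 (pop.V f (pop.density a) π)) := by
    rw [hV']
    refine ((LTwo.tendsto_integral_mul hE hR (fun n => hE.1) hrnm tconst hrn).add
      (LTwo.tendsto_integral_mul hB hQ (fun n => hB.1) hsnm tconst hsn)).congr fun n => ?_
    rw [deriv_θPath hf hY (hdir n) hY2]
    exact (integral_add (hE.integrable_mul (hrn2 n)) (hB.integrable_mul (hsn2 n))).symm
  have lim := (limD.pow 2).div limI hVpos.ne'
  have e : pop.V f (pop.density a) π ^ 2 / pop.V f (pop.density a) π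
      = pop.V f (pop.density a) π := by
    field_simp
  rw [e] at lim
  refine le_of_tendsto lim ?_
  filter_upwards [limI.eventually_const_lt hVpos] with n hn
  exact hb ⟨gn n, hdir n, hn, rfl⟩

end Efficiency

end Population

end PGAE

/-! ### Randomised observation -/

namespace SequentialSampling

variable {Ω : Type*} {mΩ : MeasurableSpace Ω} {P : Measure Ω} [IsProbabilityMeasure P]
  {Ω' E 𝓦 : Type*} {mΩ' : MeasurableSpace Ω'} {mE : MeasurableSpace E}
  {m𝓦 : MeasurableSpace 𝓦} {ι : Ω → Ω'} {X : Ω → E} {S : Ω → 𝓦} {Q : Measure E}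
  [IsProbabilityMeasure Q] {κ : Kernel E 𝓦} [IsMarkovKernel κ] {ρ : Ω' → E → ℝ} {C : ℝ}
  (hmap : P.map (fun ω => (ι ω, X ω, S ω))
      = ((P.map ι).prod (Q ⊗ₘ κ)).withDensity fun z => ENNReal.ofReal (ρ z.1 z.2.1))
  (hι : Measurable ι) (hX : Measurable X) (hS : Measurable S)
  (hρ : Measurable (Function.uncurry ρ))

include hmap hι hX hS hρ in
/-- A function of the past and of the sampled point is square integrable if it is so, uniformly in
the past, under an independent draw from `Q ⊗ₘ κ`. -/
lemma memLp_two_sample (hρC : ∀ ω x, ρ ω x ≤ C) {a : Ω' × E × 𝓦 → ℝ} (ha : Measurable a)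
    {K : ℝ≥0∞} (hK : K ≠ ∞) (haK : ∀ ω, ∫⁻ z, ‖a (ω, z)‖ₑ ^ 2 ∂(Q ⊗ₘ κ) ≤ K) :
    MemLp (fun ω => a (ι ω, X ω, S ω)) 2 P := by
  have hm : Measurable fun ω => a (ι ω, X ω, S ω) := ha.comp (hι.prodMk (hX.prodMk hS))
  refine ⟨hm.aestronglyMeasurable, ?_⟩
  rw [eLpNorm_lt_top_iff_lintegral_rpow_enorm_lt_top (by norm_num) (by norm_num)]
  have h1 := lintegral_sample_le hmap hι hX hS hρ hρC (H := fun z => ‖a z‖ₑ ^ 2)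
    (ha.enorm.pow_const 2)
  have h2 : ENNReal.ofReal C * ∫⁻ ω, ∫⁻ z, ‖a (ι ω, z)‖ₑ ^ 2 ∂(Q ⊗ₘ κ) ∂P
      ≤ ENNReal.ofReal C * K := by
    gcongr
    exact (lintegral_mono fun ω => haK (ι ω)).trans (by simp)
  have h3 := (h1.trans h2).trans_lt (ENNReal.mul_lt_top ENNReal.ofReal_lt_top hK.lt_top)
  simpa using h3

include hmap hι hX hS hρ in
/-- Conditional expectation, given the past, of a variable that depends on whether the outcome is
observed, the outcome being observed with probability `π`. -/
theorem condExp_sample_randomized (hρ0 : ∀ ω x, 0 ≤ ρ ω x) {π : Ω' → E → ℝ} {Δ : Ω → ℝ}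
    (hπ : Measurable (Function.uncurry π)) (hπ01 : ∀ ω x, π ω x ∈ Set.Icc (0 : ℝ) 1)
    (hΔm : Measurable Δ) (hΔ01 : ∀ ω, Δ ω = 0 ∨ Δ ω = 1)
    (hΔ : P⟦{ω | Δ ω = 1} | mΩ'.comap ι ⊔
      MeasurableSpace.comap (fun ω => (X ω, S ω)) inferInstance⟧ =ᵐ[P] fun ω => π (ι ω) (X ω))
    {a b : Ω' × E × 𝓦 → ℝ} (ha : Measurable a) (hb : Measurable b)
    (hai : Integrable (fun ω => a (ι ω, X ω, S ω)) P)
    (hbi : Integrable (fun ω => b (ι ω, X ω, S ω)) P) :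
    P[fun ω => a (ι ω, X ω, S ω) + Δ ω * b (ι ω, X ω, S ω)|mΩ'.comap ι] =ᵐ[P]
      fun ω => ∫ z, ρ (ι ω) z.1 * (a (ι ω, z) + π (ι ω) z.1 * b (ι ω, z)) ∂(Q ⊗ₘ κ) := by
  have hXS : Measurable fun ω => (X ω, S ω) := hX.prodMk hS
  have hm2 : mΩ'.comap ι ⊔ MeasurableSpace.comap (fun ω => (X ω, S ω)) inferInstance ≤ mΩ :=
    sup_le hι.comap_le hXS.comap_le
  have hΔb : ∀ ω, |Δ ω| ≤ 1 := fun ω => by rcases hΔ01 ω with h | h <;> simp [h]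
  have hΔe : ({ω | Δ ω = 1}.indicator fun _ => (1 : ℝ)) = Δ := by
    ext ω
    rcases hΔ01 ω with h | h <;> simp [Set.indicator, h]
  have hΔ' : P[Δ | mΩ'.comap ι ⊔ MeasurableSpace.comap (fun ω => (X ω, S ω)) inferInstance]
      =ᵐ[P] fun ω => π (ι ω) (X ω) := by rwa [hΔe] at hΔ
  have hbs : StronglyMeasurable[mΩ'.comap ι ⊔
      MeasurableSpace.comap (fun ω => (X ω, S ω)) inferInstance]
      fun ω => b (ι ω, X ω, S ω) := by
    refine (hb.comp (Measurable.prodMk ?_ ?_)).stronglyMeasurable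
    · exact Measurable.of_comap_le le_sup_left
    · exact Measurable.of_comap_le (f := fun ω => (X ω, S ω)) le_sup_right
  have hΔbi : Integrable (fun ω => Δ ω * b (ι ω, X ω, S ω)) P :=
    hbi.bdd_mul hΔm.aestronglyMeasurable (ae_of_all _ hΔb)
  -- Conditioning on the past and the whole sampled point replaces Δ by π, since the factor `b` is
  -- known there; afterwards the coarser conditioning is an integral against the density.
  have h1 := condExp_mul_of_condExp_eq (P := P) (m₁ := mΩ'.comap ι) le_sup_left hm2 hbs hΔbi
    (Integrable.of_bound hΔm.aestronglyMeasurable 1 (ae_of_all _ hΔb)) hΔ'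
  have hπz : Measurable fun z : Ω' × E × 𝓦 => π z.1 z.2.1 :=
    hπ.comp (measurable_fst.prodMk measurable_snd.fst)
  have hπb : Integrable (fun ω => π (ι ω) (X ω) * b (ι ω, X ω, S ω)) P := by
    refine hbi.bdd_mul (c := 1) (hπ.comp (hι.prodMk hX)).aestronglyMeasurable
      (ae_of_all _ fun ω => ?_)
    simpa [abs_of_nonneg (hπ01 (ι ω) (X ω)).1] using (hπ01 (ι ω) (X ω)).2
  have h2 := condExp_sample hmap hι hX hS hρ hρ0
    (G := fun z => a z + π z.1 z.2.1 * b z) (ha.add (hπz.mul hb)) (hai.add hπb)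
  refine (condExp_add hai hΔbi _).trans (EventuallyEq.trans ?_ h2)
  refine EventuallyEq.trans ?_ (condExp_add hai hπb _).symm
  filter_upwards [h1] with ω hω
  simp only [Pi.add_apply, hω]

end SequentialSampling

/-! ### Measurability of plug-in designs -/

namespace PGAE

namespace Population

variable {d m : ℕ} {pop : Population d m} {Ω' : Type*} {mΩ' : MeasurableSpace Ω'}
  {a b : Ω' → Cov d → ℝ}

lemma measurable_integral_covLaw {g : Ω' → Cov d → ℝ} (hg : Measurable (Function.uncurry g)) :
    Measurable fun ω => ∫ x, g ω x ∂pop.covLaw pop.q :=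
  (StronglyMeasurable.integral_prod_right' hg.stronglyMeasurable).measurable

lemma measurable_uncurry_relDensity (ha : Measurable (Function.uncurry a)) :
    Measurable (Function.uncurry fun ω => pop.relDensity (a ω)) :=
  ha.sqrt.div ((measurable_integral_covLaw (g := fun ω x => √(a ω x)) ha.sqrt).comp measurable_fst)

/-- The normaliser is defined through a measure that varies with ω. `expProb_eq` rewrites it with
integrals against the fixed population law, where joint measurability is standard. -/
lemma measurable_uncurry_expProb {σmin σmax : ℝ} (hσ : 0 < σmin) (γ : ℝ)
    (ha : Measurable (Function.uncurry a)) (hb : Measurable (Function.uncurry b))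
    (hab : ∀ ω x, a ω x ∈ Set.Icc σmin σmax) :
    Measurable (Function.uncurry fun ω => pop.expProb γ (a ω) (b ω)) := by
  have e : (Function.uncurry fun ω => pop.expProb γ (a ω) (b ω)) = fun z =>
      min (γ * √(b z.1 z.2 / a z.1 z.2) / ((∫ x', √(b z.1 x') ∂pop.covLaw pop.q)
        / pop.normConst (a z.1))) 1 := by
    ext z
    exact expProb_eq hσ (ha.comp measurable_prodMk_left) (ae_of_all _ (hab z.1)) _ _ _
  rw [e]
  have h1 : Measurable fun z : Ω' × Cov d => ∫ x', √(b z.1 x') ∂pop.covLaw pop.q :=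
    (measurable_integral_covLaw (g := fun ω x => √(b ω x)) hb.sqrt).comp measurable_fst
  have h2 : Measurable fun z : Ω' × Cov d => pop.normConst (a z.1) :=
    (measurable_integral_covLaw (g := fun ω x => √(a ω x)) ha.sqrt).comp measurable_fst
  exact ((((hb.div ha).sqrt.const_mul γ).div (h1.div h2))).min measurable_const

end Population

namespace Experiment

open Population

variable {Ω : Type*} {mΩ : MeasurableSpace Ω} {P : Measure Ω}
  {d m : ℕ} (pop : Population d m) (e : Experiment Ω d m)
  {ℱ : Filtration ℕ (inferInstance : MeasurableSpace Ω)} (γ σmin σmax πmin : ℝ)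

/-- The density of the design of step `t` with respect to the population law of the covariates. -/
noncomputable def rel (t : ℕ) (ω : Ω) (x : Cov d) : ℝ :=
  if t = 0 then 1 else pop.relDensity (e.α σmin σmax t ω) x

/-- The prediction of the outcome at step `t`. -/
def pred (t : ℕ) (ω : Ω) (z : Cov d × Side m) : ℝ := e.τ₁ t ω z.1 (e.f t ω z.1 z.2.1)

/-- The data sampled at step `t`. -/
def sample (t : ℕ) (ω : Ω) : Side m := (e.W t ω, e.Y t ω)

variable {e pop γ σmin σmax πmin}

lemma α_mem_Icc (hσ : σmin ≤ σmax) (t : ℕ) (ω : Ω) (x : Cov d) :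
    e.α σmin σmax t ω x ∈ Set.Icc σmin σmax :=
  ⟨le_max_left _ _, max_le hσ (min_le_right _ _)⟩

lemma p_eq (t : ℕ) (ω : Ω) (x : Cov d) :
    e.p pop σmin σmax t ω x = pop.q x * e.rel pop σmin σmax t ω x := by
  unfold p rel
  split_ifs
  · simp
  · exact density_eq _ _

lemma rel_mem_Icc (hσmin : 0 < σmin) (hσ : σmin ≤ σmax) {t : ℕ} {ω : Ω}
    (hm : Measurable (e.α σmin σmax t ω)) (x : Cov d) :
    e.rel pop σmin σmax t ω x ∈ Set.Icc (√σmin / √σmax) (√σmax / √σmin) := by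
  have h1 := Real.sqrt_pos.2 hσmin
  have h2 := Real.sqrt_le_sqrt hσ
  unfold rel
  split_ifs with ht
  -- At time 0 the relative density is 1, which lies in the interval because σmin ≤ σmax.
  · exact ⟨(div_le_one (h1.trans_le h2)).2 h2, (one_le_div h1).2 h2⟩
  · have hc := normConst_mem_Icc (pop := pop) hm (ae_of_all _ (α_mem_Icc hσ t ω))
    have hx := α_mem_Icc (e := e) hσ t ω x
    exact ⟨div_le_div₀ (Real.sqrt_nonneg _) (Real.sqrt_le_sqrt hx.1) (h1.trans_le hc.1) hc.2,
      div_le_div₀ (Real.sqrt_nonneg _) (Real.sqrt_le_sqrt hx.2) h1 hc.1⟩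

lemma rel_nonneg (t : ℕ) (ω : Ω) (x : Cov d) : 0 ≤ e.rel pop σmin σmax t ω x := by
  unfold rel
  split_ifs
  · exact zero_le_one
  · exact relDensity_nonneg _ _

lemma lintegral_rel (hσmin : 0 < σmin) (hσ : σmin ≤ σmax) {t : ℕ} {ω : Ω}
    (hm : Measurable (e.α σmin σmax t ω)) :
    ∫⁻ x, ENNReal.ofReal (e.rel pop σmin σmax t ω x) ∂pop.covLaw pop.q = 1 := by
  unfold rel
  split_ifs
  · simp
  · exact lintegral_relDensity hσmin hm (ae_of_all _ (α_mem_Icc hσ t ω))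

lemma π_mem_Icc (hγ : 0 ≤ γ) (t : ℕ) (ω : Ω) (x : Cov d) :
    e.π pop γ σmin σmax t ω x ∈ Set.Icc (0 : ℝ) 1 := by
  unfold π
  split_ifs
  · simp
  · exact expProb_mem_Icc hγ _ _ _

lemma covLaw_p {t : ℕ} {ω : Ω} (hm : Measurable (e.rel pop σmin σmax t ω)) :
    pop.covLaw (e.p pop σmin σmax t ω)
    = (pop.covLaw pop.q).withDensity fun x => ENNReal.ofReal (e.rel pop σmin σmax t ω x) := by
  have e : (fun x => ENNReal.ofReal (e.p pop σmin σmax t ω x))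
      = (fun x => ENNReal.ofReal (pop.q x))
        * fun x => ENNReal.ofReal (e.rel pop σmin σmax t ω x) := by
    ext x
    rw [p_eq, Pi.mul_apply, ENNReal.ofReal_mul (pop.q_nonneg x)]
  rw [covLaw, covLaw, e, withDensity_mul _ pop.measurable_q.ennreal_ofReal hm.ennreal_ofReal]

namespace FollowsProtocol

variable (h : e.FollowsProtocol pop γ σmin σmax P ℱ) (t : ℕ)

include h in
lemma measurable_α : Measurable[(ℱ t).prod inferInstance]
    (Function.uncurry (e.α σmin σmax t)) := by
  have h1 := h.predictable_μ₁ t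
  have h2 := h.predictable_μ₂ t
  exact measurable_const.max ((h2.sub (h1.pow_const 2)).min measurable_const)

include h in
lemma measurable_rel : Measurable[(ℱ t).prod inferInstance]
    (Function.uncurry (e.rel pop σmin σmax t)) := by
  have h1 : Measurable[(ℱ t).prod inferInstance] _ :=
    measurable_uncurry_relDensity (pop := pop) (h.measurable_α t)
  by_cases ht : t = 0
  · have : Function.uncurry (e.rel pop σmin σmax t) = fun _ => 1 := by
      ext; simp [Function.uncurry, rel, ht]
    rw [this]; exact measurable_const
  · have : Function.uncurry (e.rel pop σmin σmax t)
        = Function.uncurry fun ω => pop.relDensity (e.α σmin σmax t ω) := by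
      ext; simp [Function.uncurry, rel, ht]
    rw [this]; exact h1

include h in
lemma measurable_π (hσmin : 0 < σmin) (hσ : σmin ≤ σmax) : Measurable[(ℱ t).prod inferInstance]
    (Function.uncurry (e.π pop γ σmin σmax t)) := by
  have h1 : Measurable[(ℱ t).prod inferInstance] _ :=
    measurable_uncurry_expProb (pop := pop) hσmin γ (h.measurable_α t) (h.predictable_β t)
      (α_mem_Icc hσ t)
  by_cases ht : t = 0
  · have : Function.uncurry (e.π pop γ σmin σmax t) = fun _ => 1 := by
      ext; simp [Function.uncurry, π, ht]
    rw [this]; exact measurable_const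
  · have : Function.uncurry (e.π pop γ σmin σmax t)
        = Function.uncurry fun ω => pop.expProb γ (e.α σmin σmax t ω) (e.β t ω) := by
      ext; simp [Function.uncurry, π, ht]
    rw [this]; exact h1

include h in
lemma measurable_pred : Measurable[(ℱ t).prod inferInstance] (Function.uncurry (e.pred t)) := by
  have h1 := h.predictable_f t
  have h2 := h.predictable_τ₁ t
  let := ℱ t
  have h3 : Measurable fun z : Ω × Cov d × Side m => e.f t z.1 z.2.1 z.2.2.1 :=
    h1.comp (measurable_fst.prodMk (measurable_snd.fst.prodMk measurable_snd.snd.fst))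
  exact h2.comp (measurable_fst.prodMk (measurable_snd.fst.prodMk h3))

include h in
lemma measurable_X : Measurable (e.X t) := (h.adapted_X t).mono (ℱ.le _) le_rfl

include h in
lemma measurable_sample : Measurable (e.sample t) :=
  ((h.adapted_W t).mono (ℱ.le _) le_rfl).prodMk ((h.adapted_Y t).mono (ℱ.le _) le_rfl)

include h in
lemma measurable_Δ : Measurable (e.Δ t) := (h.adapted_Δ t).mono (ℱ.le _) le_rfl

include h in
/-- The joint law of the past and the data of step `t`. -/
lemma map_past_sample [IsProbabilityMeasure P] (hσmin : 0 < σmin) (hσ : σmin ≤ σmax) :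
    @Measure.map _ _ _ ((ℱ t).prod inferInstance) (fun ω => (ω, e.X t ω, e.sample t ω)) P
      = @Measure.withDensity _ ((ℱ t).prod inferInstance)
        (@Measure.prod _ _ (ℱ t) _ (@Measure.map _ _ _ (ℱ t) id P) pop.law)
        fun z => ENNReal.ofReal (e.rel pop σmin σmax t z.1 z.2.1) := by
  -- The past is modelled by the identity map into Ω equipped with ℱ t, whose generated σ-algebra is
  -- ℱ t itself.
  have hid : Measurable[inferInstance, ℱ t] (id : Ω → Ω) := measurable_id.mono le_rfl (ℱ.le t)
  have hrel : ∀ ω, Measurable (e.rel pop σmin σmax t ω) := fun ω =>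
    (h.measurable_rel t).comp (measurable_prodMk_left (m := ℱ t))
  have hα : ∀ ω, Measurable (e.α σmin σmax t ω) := fun ω =>
    (h.measurable_α t).comp (measurable_prodMk_left (m := ℱ t))
  refine SequentialSampling.map_prodMk_eq_withDensity (mΩ' := ℱ t) (ι := id) hid
    (h.measurable_X t) (h.measurable_sample t) (h.measurable_rel t)
    (fun ω => lintegral_rel hσmin hσ (hα ω)) (fun A hA => ?_) fun B hB => ?_
  · rw [MeasurableSpace.comap_id]
    refine (h.sample_X t A hA).trans (ae_of_all _ fun ω => ?_)
    simp only [id, covLaw_p (hrel ω)]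
  · rw [MeasurableSpace.comap_id]
    exact h.sample_WY t B hB

end FollowsProtocol

end Experiment

end PGAE

/-! ### The increments of the estimation error -/

namespace LTwo

lemma eLpNorm_two_sq {Z : Type*} {mZ : MeasurableSpace Z} {μ : Measure Z} (f : Z → ℝ) :
    eLpNorm f 2 μ ^ 2 = ∫⁻ z, ‖f z‖ₑ ^ 2 ∂μ := by
  have := eLpNorm_nnreal_pow_eq_lintegral (f := f) (μ := μ) (p := 2) (by norm_num)
  simpa using this

lemma enorm_sq (x : ℝ) : ‖x‖ₑ ^ 2 = ENNReal.ofReal (x ^ 2) := by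
  rw [Real.enorm_eq_ofReal_abs, ← ENNReal.ofReal_pow (abs_nonneg _), sq_abs]

lemma enorm_integral_le_eLpNorm_two {Z : Type*} {mZ : MeasurableSpace Z} {μ : Measure Z}
    [IsProbabilityMeasure μ] {f : Z → ℝ} (hf : AEStronglyMeasurable f μ) :
    ‖∫ z, f z ∂μ‖ₑ ≤ eLpNorm f 2 μ := by
  refine (enorm_integral_le_lintegral_enorm _).trans ?_
  rw [← eLpNorm_one_eq_lintegral_enorm]
  exact eLpNorm_le_eLpNorm_of_exponent_le (by norm_num) hf

lemma memLp_and_integral_sq_le {Z : Type*} {mZ : MeasurableSpace Z} {μ : Measure Z}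
    {f : Z → ℝ} (hf : AEStronglyMeasurable f μ) {K : ℝ≥0∞} (hK : K ≠ ∞)
    (h : ∫⁻ z, ‖f z‖ₑ ^ 2 ∂μ ≤ K) : MemLp f 2 μ ∧ ∫ z, f z ^ 2 ∂μ ≤ K.toReal := by
  constructor
  · refine ⟨hf, lt_top_iff_ne_top.2 fun htop => ?_⟩
    rw [← eLpNorm_two_sq, htop] at h
    simp [hK] at h
  · rw [integral_eq_lintegral_of_nonneg_ae (ae_of_all _ fun z => sq_nonneg _) (hf.pow 2)]
    refine ENNReal.toReal_mono hK (le_of_eq_of_le ?_ h)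
    simp only [enorm_sq]

end LTwo

namespace PGAE

namespace Population

variable {d m : ℕ} (pop : Population d m) (f : Cov d → EuclideanSpace ℝ (Fin m) → ℝ)

/-- An envelope of the oracle influence functions. -/
noncomputable def envelope (z : Cov d × Side m) : ℝ :=
  |z.2.2 - pop.τ f z.1 (f z.1 z.2.1)| + |pop.τ f z.1 (f z.1 z.2.1) - pop.μ z.1| + 1

variable {pop f}

lemma one_le_envelope (z : Cov d × Side m) : 1 ≤ pop.envelope f z := by
  unfold envelope
  linarith [abs_nonneg (z.2.2 - pop.τ f z.1 (f z.1 z.2.1)),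
    abs_nonneg (pop.τ f z.1 (f z.1 z.2.1) - pop.μ z.1)]

lemma measurable_envelope
    (hf : Measurable fun z : Cov d × EuclideanSpace ℝ (Fin m) => f z.1 z.2) :
    Measurable (pop.envelope f) :=
  ((measurable_snd.snd.sub (measurable_τ_comp hf)).abs.add ((measurable_τ_comp hf).sub
    (pop.measurable_μ.comp measurable_fst)).abs).add_const 1

lemma memLp_envelope (hf : Measurable fun z : Cov d × EuclideanSpace ℝ (Fin m) => f z.1 z.2)
    (hY : Integrable (fun z : Cov d × Side m => z.2.2) pop.law)
    (hY2 : MemLp (fun z : Cov d × Side m => z.2.2 - pop.μ z.1) 2 pop.law) :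
    MemLp (pop.envelope f) 2 pop.law :=
  ((memLp_Y_sub_τ hf hY hY2).abs.add (memLp_τ_sub_μ hf hY hY2).abs).add (memLp_const 1)

lemma θ_eq (hY : Integrable (fun z : Cov d × Side m => z.2.2) pop.law) :
    pop.θ = ∫ x, pop.μ x ∂pop.covLaw pop.q := integral_law hY

end Population

namespace Experiment

open Population

variable {Ω : Type*} {mΩ : MeasurableSpace Ω} {P : Measure Ω}
  {d m : ℕ} (pop : Population d m) (e : Experiment Ω d m)
  {ℱ : Filtration ℕ (inferInstance : MeasurableSpace Ω)} (γ σmin σmax πmin : ℝ)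
  (fStar : Cov d → EuclideanSpace ℝ (Fin m) → ℝ)

/-- The part of the estimated influence function that does not involve the outcome. -/
noncomputable def stepA (t : ℕ) (z : Ω × Cov d × Side m) : ℝ :=
  (e.rel pop σmin σmax t z.1 z.2.1)⁻¹ * (e.pred t z.1 z.2 - e.μ₁ t z.1 z.2.1)
    + (∫ x, e.μ₁ t z.1 x ∂pop.covLaw pop.q - pop.θ)

/-- The part of the estimated influence function that is added when the outcome is observed. -/
noncomputable def stepB (t : ℕ) (z : Ω × Cov d × Side m) : ℝ :=
  (e.rel pop σmin σmax t z.1 z.2.1)⁻¹ * (e.π pop γ σmin σmax t z.1 z.2.1)⁻¹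
    * (z.2.2.2 - e.pred t z.1 z.2)

/-- The squared `L²` error of the estimators of step `t`. -/
noncomputable def sqError (t : ℕ) (ω : Ω) : ℝ≥0∞ :=
  (∫⁻ x, ‖e.μ₁ t ω x - pop.μ x‖ₑ ^ 2 ∂pop.covLaw pop.q)
    + ∫⁻ z, ‖e.pred t ω z - pop.τ fStar z.1 (fStar z.1 z.2.1)‖ₑ ^ 2 ∂pop.law

/-- The event, known before step `t`, that the estimators of step `t` are not too bad. -/
def good (t : ℕ) : Set Ω :=
  {ω | e.sqError pop fStar t ω ≤ 1} ∩
    {ω | ∀ᵐ x ∂pop.covLaw pop.q, πmin ≤ e.π pop γ σmin σmax t ω x}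

/-- `stepA`, truncated to the good event. -/
noncomputable def truncA (t : ℕ) : Ω × Cov d × Side m → ℝ :=
  (Prod.fst ⁻¹' e.good pop γ σmin σmax πmin fStar t).indicator (e.stepA pop σmin σmax t)

/-- `stepB`, truncated to the good event. -/
noncomputable def truncB (t : ℕ) : Ω × Cov d × Side m → ℝ :=
  (Prod.fst ⁻¹' e.good pop γ σmin σmax πmin fStar t).indicator (e.stepB pop γ σmin σmax t)

/-- The truncated increment of the estimation error. -/
noncomputable def increment (t : ℕ) (ω : Ω) : ℝ :=
  e.truncA pop γ σmin σmax πmin fStar t (ω, e.X t ω, e.sample t ω)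
    + e.Δ t ω * e.truncB pop γ σmin σmax πmin fStar t (ω, e.X t ω, e.sample t ω)

/-- The conditional variance of the truncated increment. -/
noncomputable def condVar (t : ℕ) (ω : Ω) : ℝ :=
  ∫ z, e.rel pop σmin σmax t ω z.1 * (e.truncA pop γ σmin σmax πmin fStar t (ω, z) ^ 2
    + e.π pop γ σmin σmax t ω z.1 * (2 * e.truncA pop γ σmin σmax πmin fStar t (ω, z)
      * e.truncB pop γ σmin σmax πmin fStar t (ω, z)
      + e.truncB pop γ σmin σmax πmin fStar t (ω, z) ^ 2)) ∂pop.law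

/-- A common factor in the bounds of the parts of the estimated influence function. -/
noncomputable def boundConst (σmin σmax πmin : ℝ) : ℝ :=
  2 * (√σmax / √σmin) + √σmax / √σmin * πmin⁻¹

/-- The error of the estimators of step `t`. -/
noncomputable def errorSum (t : ℕ) (z : Ω × Cov d × Side m) : ℝ :=
  |e.pred t z.1 z.2 - pop.τ fStar z.2.1 (fStar z.2.1 z.2.2.1)|
    + |e.μ₁ t z.1 z.2.1 - pop.μ z.2.1|

variable {e pop γ σmin σmax πmin fStar}

/-! ### Measurability, domination and conditional moments of the truncated increments. -/

namespace FollowsProtocol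

variable (h : e.FollowsProtocol pop γ σmin σmax P ℱ) (t : ℕ)
  (hf : Measurable fun z : Cov d × EuclideanSpace ℝ (Fin m) => fStar z.1 z.2)
  (hY : Integrable (fun z : Cov d × Side m => z.2.2) pop.law)
  (hY2 : MemLp (fun z : Cov d × Side m => z.2.2 - pop.μ z.1) 2 pop.law)
  (hγ : 0 ≤ γ) (hσmin : 0 < σmin) (hσ : σmin ≤ σmax) (hπmin : 0 < πmin)

include h in
lemma measurable_rel_right (ω : Ω) : Measurable (e.rel pop σmin σmax t ω) :=
  (h.measurable_rel t).comp (measurable_prodMk_left (m := ℱ t))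

include h in
lemma measurable_α_right (ω : Ω) : Measurable (e.α σmin σmax t ω) :=
  (h.measurable_α t).comp (measurable_prodMk_left (m := ℱ t))

include h hσmin hσ in
lemma measurable_π_right (ω : Ω) : Measurable (e.π pop γ σmin σmax t ω) :=
  (h.measurable_π t hσmin hσ).comp (measurable_prodMk_left (m := ℱ t))

include h in
lemma measurable_μ₁_right (ω : Ω) : Measurable (e.μ₁ t ω) :=
  (h.predictable_μ₁ t).comp (measurable_prodMk_left (m := ℱ t))

include h in
lemma measurable_β_right (ω : Ω) : Measurable (e.β t ω) :=
  (h.predictable_β t).comp (measurable_prodMk_left (m := ℱ t))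

include h in
lemma measurable_pred_right (ω : Ω) : Measurable (e.pred t ω) :=
  (h.measurable_pred t).comp (measurable_prodMk_left (m := ℱ t))

include h in
lemma measurable_stepA :
    Measurable[(ℱ t).prod inferInstance] (e.stepA pop σmin σmax t) := by
  have h1 := h.measurable_rel t
  have h2 := h.measurable_pred t
  have h3 := h.predictable_μ₁ t
  let := ℱ t
  have hx : Measurable fun z : Ω × Cov d × Side m => (z.1, z.2.1) :=
    measurable_fst.prodMk measurable_snd.fst
  exact (((h1.comp hx).inv).mul (h2.sub (h3.comp hx))).add
    (((measurable_integral_covLaw h3).comp measurable_fst).sub_const _)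

include h hσmin hσ in
lemma measurable_stepB :
    Measurable[(ℱ t).prod inferInstance] (e.stepB pop γ σmin σmax t) := by
  have h1 := h.measurable_rel t
  have h2 := h.measurable_pred t
  have h3 := h.measurable_π t hσmin hσ
  let := ℱ t
  have hx : Measurable fun z : Ω × Cov d × Side m => (z.1, z.2.1) :=
    measurable_fst.prodMk measurable_snd.fst
  exact (((h1.comp hx).inv).mul (h3.comp hx).inv).mul (measurable_snd.snd.snd.sub h2)

include h hf in
lemma measurable_sqError : Measurable[ℱ t] (e.sqError pop fStar t) := by
  have h2 := h.measurable_pred t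
  have h3 := h.predictable_μ₁ t
  let := ℱ t
  refine Measurable.add ?_ ?_
  · exact (((h3.sub (pop.measurable_μ.comp measurable_snd)).enorm.pow_const 2)).lintegral_prod_right'
  · exact ((h2.sub ((measurable_τ_comp hf).comp measurable_snd)).enorm.pow_const
      2).lintegral_prod_right'

include h hf hσmin hσ in
lemma measurableSet_good : MeasurableSet[ℱ t] (e.good pop γ σmin σmax πmin fStar t) := by
  have h1 := h.measurable_sqError t hf
  have h3 := h.measurable_π t hσmin hσ
  let := ℱ t
  refine (measurableSet_le h1 measurable_const).inter ?_
  have h4 : MeasurableSet {z : Ω × Cov d | ¬ πmin ≤ e.π pop γ σmin σmax t z.1 z.2} :=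
    (measurableSet_le measurable_const h3).compl
  -- The almost-everywhere condition says that a section of a measurable set is null, and the
  -- measure of a section is a measurable function of ω.
  exact (measurable_measure_prodMk_left (ν := pop.covLaw pop.q) h4) (measurableSet_singleton 0)

include h hf hσmin hσ in
lemma measurable_truncA : Measurable[(ℱ t).prod inferInstance]
    (e.truncA pop γ σmin σmax πmin fStar t) := by
  have h1 := h.measurable_stepA t
  have h2 := h.measurableSet_good (πmin := πmin) t hf hσmin hσ
  let := ℱ t
  exact h1.indicator (measurable_fst h2)

include h hf hσmin hσ in
lemma measurable_truncB : Measurable[(ℱ t).prod inferInstance]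
    (e.truncB pop γ σmin σmax πmin fStar t) := by
  have h1 := h.measurable_stepB t hσmin hσ
  have h2 := h.measurableSet_good (πmin := πmin) t hf hσmin hσ
  let := ℱ t
  exact h1.indicator (measurable_fst h2)

include h hf in
lemma measurable_errorSum : Measurable[(ℱ t).prod inferInstance]
    (e.errorSum pop fStar t) := by
  have h2 := h.measurable_pred t
  have h3 := h.predictable_μ₁ t
  let := ℱ t
  have hx : Measurable fun z : Ω × Cov d × Side m => (z.1, z.2.1) :=
    measurable_fst.prodMk measurable_snd.fst
  exact (h2.sub ((measurable_τ_comp hf).comp measurable_snd)).abs.add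
    ((h3.comp hx).sub (pop.measurable_μ.comp measurable_snd.fst)).abs

include h hf hσmin hσ in
lemma measurable_condVar :
    Measurable[ℱ t] (e.condVar pop γ σmin σmax πmin fStar t) := by
  have h1 := h.measurable_rel t
  have h2 := h.measurable_π t hσmin hσ
  have h3 := h.measurable_truncA (πmin := πmin) t hf hσmin hσ
  have h4 := h.measurable_truncB (πmin := πmin) t hf hσmin hσ
  let := ℱ t
  have hx : Measurable fun z : Ω × Cov d × Side m => (z.1, z.2.1) :=
    measurable_fst.prodMk measurable_snd.fst
  have hm : Measurable fun z : Ω × Cov d × Side m => e.rel pop σmin σmax t z.1 z.2.1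
      * (e.truncA pop γ σmin σmax πmin fStar t z ^ 2 + e.π pop γ σmin σmax t z.1 z.2.1
        * (2 * e.truncA pop γ σmin σmax πmin fStar t z * e.truncB pop γ σmin σmax πmin fStar t z
          + e.truncB pop γ σmin σmax πmin fStar t z ^ 2)) := (h1.comp hx).mul ((h3.pow_const 2).add ((h2.comp hx).mul
    (((h3.const_mul 2).mul h4).add (h4.pow_const 2))))
  exact (StronglyMeasurable.integral_prod_right' hm.stronglyMeasurable).measurable

include h hf hσmin hσ in
lemma measurable_increment :
    Measurable[ℱ (t + 1)] (e.increment pop γ σmin σmax πmin fStar t) := by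
  have h3 := h.measurable_truncA (πmin := πmin) t hf hσmin hσ
  have h4 := h.measurable_truncB (πmin := πmin) t hf hσmin hσ
  have h5 : Measurable[ℱ (t + 1), (ℱ t).prod inferInstance]
      fun ω => (ω, e.X t ω, e.sample t ω) := by
    have hid : Measurable[ℱ (t + 1), ℱ t] (id : Ω → Ω) := fun s hs => ℱ.mono t.le_succ s hs
    exact Measurable.prodMk hid ((h.adapted_X t).prodMk
      ((h.adapted_W t).prodMk (h.adapted_Y t)))
  exact (h3.comp h5).add ((h.adapted_Δ t).mul (h4.comp h5))

include h hY in
/-- On the good event, the estimator of the mean is integrable and nearly right on average. -/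
lemma integrable_μ₁ {ω : Ω} (hω : e.sqError pop fStar t ω ≤ 1) :
    Integrable (e.μ₁ t ω) (pop.covLaw pop.q) ∧
      |∫ x, e.μ₁ t ω x ∂pop.covLaw pop.q - pop.θ| ≤ 1 := by
  have hm : AEStronglyMeasurable (fun x => e.μ₁ t ω x - pop.μ x) (pop.covLaw pop.q) :=
    ((h.measurable_μ₁_right t ω).sub pop.measurable_μ).aestronglyMeasurable
  have h1 : eLpNorm (fun x => e.μ₁ t ω x - pop.μ x) 2 (pop.covLaw pop.q) ≤ 1 := by
    rw [← pow_le_one_iff (n := 2) (by norm_num), LTwo.eLpNorm_two_sq]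
    exact le_self_add.trans hω
  have h2 : MemLp (fun x => e.μ₁ t ω x - pop.μ x) 2 (pop.covLaw pop.q) :=
    ⟨hm, h1.trans_lt ENNReal.one_lt_top⟩
  have h3 : Integrable (fun x => e.μ₁ t ω x - pop.μ x) (pop.covLaw pop.q) :=
    h2.integrable (by norm_num)
  have h4 : Integrable (e.μ₁ t ω) (pop.covLaw pop.q) :=
    (h3.add (integrable_μ hY)).congr (ae_of_all _ fun x => by simp)
  refine ⟨h4, ?_⟩
  rw [θ_eq hY, ← integral_sub h4 (integrable_μ hY), ← Real.norm_eq_abs]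
  have h5 := (LTwo.enorm_integral_le_eLpNorm_two hm).trans h1
  rwa [← ofReal_norm, ENNReal.ofReal_le_one] at h5

include h hY hσmin hσ hπmin in
/-- On the good event, the parts of the estimated influence function are dominated. -/
lemma abs_step_le {ω : Ω} (hω : ω ∈ e.good pop γ σmin σmax πmin fStar t) :
    ∀ᵐ z ∂pop.law, |e.stepA pop σmin σmax t (ω, z)| ≤ boundConst σmin σmax πmin
        * (e.errorSum pop fStar t (ω, z) + pop.envelope fStar z) ∧
      |e.stepB pop γ σmin σmax t (ω, z)| ≤ boundConst σmin σmax πmin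
        * (e.errorSum pop fStar t (ω, z) + pop.envelope fStar z) := by
  have hc := (h.integrable_μ₁ t hY hω.1).2
  filter_upwards [pop.ae_law_of_ae hω.2] with z hz
  have hs := Real.sqrt_pos.2 hσmin
  have hs2 : 0 < √σmax := Real.sqrt_pos.2 (hσmin.trans_le hσ)
  have h1 := rel_mem_Icc (e := e) (pop := pop) hσmin hσ (h.measurable_α_right t ω) z.1
  set r := √σmax / √σmin with hr
  have hr1 : 1 ≤ r := (one_le_div hs).2 (Real.sqrt_le_sqrt hσ)
  have hrel : |(e.rel pop σmin σmax t ω z.1)⁻¹| ≤ r := by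
    rw [abs_of_nonneg (inv_nonneg.2 (rel_nonneg _ _ _)), hr, ← inv_div]
    exact inv_anti₀ (div_pos hs hs2) h1.1
  have hπ : |(e.π pop γ σmin σmax t ω z.1)⁻¹| ≤ πmin⁻¹ := by
    rw [abs_of_nonneg (inv_nonneg.2 (hπmin.le.trans hz))]
    exact inv_anti₀ hπmin hz
  have hπ0 : 0 < πmin⁻¹ := inv_pos.2 hπmin
  set u := e.pred t ω z - pop.τ fStar z.1 (fStar z.1 z.2.1) with hu
  set w := e.μ₁ t ω z.1 - pop.μ z.1 with hw
  set p := z.2.2 - pop.τ fStar z.1 (fStar z.1 z.2.1) with hp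
  set k := pop.τ fStar z.1 (fStar z.1 z.2.1) - pop.μ z.1 with hk
  have hsum : e.errorSum pop fStar t (ω, z) + pop.envelope fStar z
      = |u| + |w| + (|p| + |k| + 1) := rfl
  have n1 := abs_nonneg u
  have n2 := abs_nonneg w
  have n3 := abs_nonneg p
  have n4 := abs_nonneg k
  have hA : |e.pred t ω z - e.μ₁ t ω z.1| ≤ |u| + |w| + |k| := by
    have : e.pred t ω z - e.μ₁ t ω z.1 = u + k - w := by rw [hu, hk, hw]; ring
    rw [this]
    exact (abs_sub _ _).trans (by linarith [abs_add_le u k])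
  have hB : |z.2.2 - e.pred t ω z| ≤ |p| + |u| := by
    have : z.2.2 - e.pred t ω z = p - u := by rw [hu, hp]; ring
    rw [this]
    exact abs_sub _ _
  rw [hsum, boundConst]
  constructor
  · calc |e.stepA pop σmin σmax t (ω, z)|
        ≤ |(e.rel pop σmin σmax t ω z.1)⁻¹| * |e.pred t ω z - e.μ₁ t ω z.1|
          + |∫ x, e.μ₁ t ω x ∂pop.covLaw pop.q - pop.θ| := by
          rw [← abs_mul]; exact abs_add_le _ _
      _ ≤ r * (|u| + |w| + |k|) + 1 := by gcongr
      -- The centring error is at most 1 on the good event; since r ≥ 1, it is absorbed by the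
      -- constant term of the envelope.
      _ ≤ (2 * r + r * πmin⁻¹) * (|u| + |w| + (|p| + |k| + 1)) := by
          have e1 : 0 ≤ r * πmin⁻¹ * (|u| + |w| + (|p| + |k| + 1)) := by positivity
          have e2 : 0 ≤ r * (|u| + |w| + |k|) := by positivity
          have e3 : 0 ≤ r * |p| := by positivity
          nlinarith
  · calc |e.stepB pop γ σmin σmax t (ω, z)|
        = |(e.rel pop σmin σmax t ω z.1)⁻¹| * |(e.π pop γ σmin σmax t ω z.1)⁻¹|
          * |z.2.2 - e.pred t ω z| := by rw [← abs_mul, ← abs_mul]; rfl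
      _ ≤ r * πmin⁻¹ * (|p| + |u|) := by gcongr
      _ ≤ (2 * r + r * πmin⁻¹) * (|u| + |w| + (|p| + |k| + 1)) := by
          have e1 : 0 ≤ r * πmin⁻¹ * (|w| + |k| + 1) := by positivity
          have e2 : 0 ≤ r * (|u| + |w| + (|p| + |k| + 1)) := by positivity
          nlinarith

/-- A bound on the conditional second moments of the truncated parts of the influence function. -/
noncomputable def momentBound (pop : Population d m) (fStar : Cov d → EuclideanSpace ℝ (Fin m) → ℝ)
    (σmin σmax πmin : ℝ) : ℝ≥0∞ :=
  ENNReal.ofReal (3 * boundConst σmin σmax πmin ^ 2)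
    * (1 + ∫⁻ z, ‖pop.envelope fStar z‖ₑ ^ 2 ∂pop.law)

include hf hY hY2 in
lemma momentBound_ne_top : momentBound pop fStar σmin σmax πmin ≠ ∞ := by
  have := (memLp_envelope hf hY hY2).2
  rw [momentBound, ← LTwo.eLpNorm_two_sq]
  exact ENNReal.mul_ne_top ENNReal.ofReal_ne_top
    (ENNReal.add_ne_top.2 ⟨ENNReal.one_ne_top, ENNReal.pow_ne_top this.ne⟩)

include h in
lemma lintegral_law_μ₁ (ω : Ω) : ∫⁻ z, ‖e.μ₁ t ω z.1 - pop.μ z.1‖ₑ ^ 2 ∂pop.law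
    = ∫⁻ x, ‖e.μ₁ t ω x - pop.μ x‖ₑ ^ 2 ∂pop.covLaw pop.q :=
  pop.measurePreserving_fst.lintegral_comp (f := fun x => ‖e.μ₁ t ω x - pop.μ x‖ₑ ^ 2)
    (((h.measurable_μ₁_right t ω).sub pop.measurable_μ).enorm.pow_const 2)

include h hf in
lemma lintegral_bound_le {ω : Ω} (hω : e.sqError pop fStar t ω ≤ 1) :
    ∫⁻ z, ‖boundConst σmin σmax πmin
        * (e.errorSum pop fStar t (ω, z) + pop.envelope fStar z)‖ₑ ^ 2 ∂pop.law
      ≤ momentBound pop fStar σmin σmax πmin := by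
  set M := boundConst σmin σmax πmin
  -- The factor 3 comes from (a + b + c)² ≤ 3(a² + b² + c²); the two error terms together integrate
  -- to at most 1.
  have h1 : ∀ z : Cov d × Side m,
      ‖M * (e.errorSum pop fStar t (ω, z) + pop.envelope fStar z)‖ₑ ^ 2
      ≤ ENNReal.ofReal (3 * M ^ 2) * (‖e.μ₁ t ω z.1 - pop.μ z.1‖ₑ ^ 2
        + ‖e.pred t ω z - pop.τ fStar z.1 (fStar z.1 z.2.1)‖ₑ ^ 2
        + ‖pop.envelope fStar z‖ₑ ^ 2) := fun z => by
    simp only [LTwo.enorm_sq]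
    rw [← ENNReal.ofReal_add (sq_nonneg _) (sq_nonneg _), ← ENNReal.ofReal_add (by positivity)
      (sq_nonneg _), ← ENNReal.ofReal_mul (by positivity)]
    refine ENNReal.ofReal_le_ofReal ?_
    rw [mul_pow, mul_comm 3, mul_assoc]
    refine mul_le_mul_of_nonneg_left ?_ (sq_nonneg M)
    simp only [errorSum]
    set u := e.pred t ω z - pop.τ fStar z.1 (fStar z.1 z.2.1)
    set w := e.μ₁ t ω z.1 - pop.μ z.1
    nlinarith [sq_nonneg (|u| - |w|), sq_nonneg (|u| - pop.envelope fStar z),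
      sq_nonneg (|w| - pop.envelope fStar z), sq_abs u, sq_abs w]
  have m1 : Measurable fun z : Cov d × Side m => ‖e.μ₁ t ω z.1 - pop.μ z.1‖ₑ ^ 2 :=
    (((h.measurable_μ₁_right t ω).sub pop.measurable_μ).comp measurable_fst).enorm.pow_const 2
  have m2 : Measurable fun z : Cov d × Side m =>
      ‖e.pred t ω z - pop.τ fStar z.1 (fStar z.1 z.2.1)‖ₑ ^ 2 :=
    ((h.measurable_pred_right t ω).sub (measurable_τ_comp hf)).enorm.pow_const 2
  have m12 : Measurable fun z : Cov d × Side m => ‖e.μ₁ t ω z.1 - pop.μ z.1‖ₑ ^ 2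
      + ‖e.pred t ω z - pop.τ fStar z.1 (fStar z.1 z.2.1)‖ₑ ^ 2 := m1.add m2
  refine (lintegral_mono h1).trans ?_
  rw [lintegral_const_mul' _ _ ENNReal.ofReal_ne_top, lintegral_add_left m12,
    lintegral_add_left m1, h.lintegral_law_μ₁, momentBound]
  gcongr
  exact hω

include h hf hY hσmin hσ hπmin in
lemma lintegral_trunc_sq_le (ω : Ω) :
    ∫⁻ z, ‖e.truncA pop γ σmin σmax πmin fStar t (ω, z)‖ₑ ^ 2 ∂pop.law
        ≤ momentBound pop fStar σmin σmax πmin ∧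
      ∫⁻ z, ‖e.truncB pop γ σmin σmax πmin fStar t (ω, z)‖ₑ ^ 2 ∂pop.law
        ≤ momentBound pop fStar σmin σmax πmin := by
  by_cases hω : ω ∈ e.good pop γ σmin σmax πmin fStar t
  · have h1 := h.lintegral_bound_le (σmin := σmin) (σmax := σmax) (πmin := πmin) t hf hω.1
    have h2 := h.abs_step_le t hY hσmin hσ hπmin hω
    constructor
    · refine le_trans (lintegral_mono_ae ?_) h1
      filter_upwards [h2] with z hz
      gcongr
      rw [enorm_le_iff_norm_le]
      simpa [truncA, hω] using hz.1.trans (le_abs_self _)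
    · refine le_trans (lintegral_mono_ae ?_) h1
      filter_upwards [h2] with z hz
      gcongr
      rw [enorm_le_iff_norm_le]
      simpa [truncB, hω] using hz.2.trans (le_abs_self _)
  · simp [truncA, truncB, hω]

include h hf hσmin hσ in
lemma measurable_truncA_right (ω : Ω) :
    Measurable fun z => e.truncA pop γ σmin σmax πmin fStar t (ω, z) :=
  (h.measurable_truncA t hf hσmin hσ).comp (measurable_prodMk_left (m := ℱ t))

include h hf hσmin hσ in
lemma measurable_truncB_right (ω : Ω) :
    Measurable fun z => e.truncB pop γ σmin σmax πmin fStar t (ω, z) :=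
  (h.measurable_truncB t hf hσmin hσ).comp (measurable_prodMk_left (m := ℱ t))

include h hf hY hY2 hγ hσmin hσ hπmin in
lemma condVar_mem_Icc (ω : Ω) : e.condVar pop γ σmin σmax πmin fStar t ω ∈ Set.Icc 0
    (2 * (√σmax / √σmin) * (2 * (momentBound pop fStar σmin σmax πmin).toReal)) := by
  have hK := momentBound_ne_top (pop := pop) (σmin := σmin) (σmax := σmax) (πmin := πmin) hf hY hY2
  have hL := h.lintegral_trunc_sq_le t hf hY hσmin hσ hπmin ω
  have hA := LTwo.memLp_and_integral_sq_le
    (h.measurable_truncA_right (πmin := πmin) t hf hσmin hσ ω).aestronglyMeasurable hK hL.1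
  have hB := LTwo.memLp_and_integral_sq_le
    (h.measurable_truncB_right (πmin := πmin) t hf hσmin hσ ω).aestronglyMeasurable hK hL.2
  -- The expression is the mean of (a + Δb)² for Δ Bernoulli with parameter p, that is, (1−p)a² +
  -- p(a+b)².
  have key : ∀ (p a b : ℝ), p ∈ Set.Icc (0 : ℝ) 1 → 0 ≤ a ^ 2 + p * (2 * a * b + b ^ 2) ∧
      a ^ 2 + p * (2 * a * b + b ^ 2) ≤ 2 * (a ^ 2 + b ^ 2) := fun p a b hp => by
    have e1 : a ^ 2 + p * (2 * a * b + b ^ 2) = (1 - p) * a ^ 2 + p * (a + b) ^ 2 := by ring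
    have e2 : 2 * (a ^ 2 + b ^ 2) - (a ^ 2 + p * (2 * a * b + b ^ 2))
      = (1 - p) * (a ^ 2 + 2 * b ^ 2) + p * (a - b) ^ 2 := by ring
    have h1 := sub_nonneg.2 hp.2
    have h2 := hp.1
    constructor
    · rw [e1]; positivity
    · rw [← sub_nonneg, e2]; positivity
  have hrel := fun x => rel_mem_Icc (e := e) (pop := pop) hσmin hσ (h.measurable_α_right t ω) x
  have hnn : ∀ z : Cov d × Side m, 0 ≤ e.rel pop σmin σmax t ω z.1
      * (e.truncA pop γ σmin σmax πmin fStar t (ω, z) ^ 2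
      + e.π pop γ σmin σmax t ω z.1 * (2 * e.truncA pop γ σmin σmax πmin fStar t (ω, z)
      * e.truncB pop γ σmin σmax πmin fStar t (ω, z)
      + e.truncB pop γ σmin σmax πmin fStar t (ω, z) ^ 2)) := fun z =>
    mul_nonneg (rel_nonneg _ _ _) (key _ _ _ (π_mem_Icc hγ t ω z.1)).1
  refine ⟨integral_nonneg hnn, ?_⟩
  have hr : 0 ≤ √σmax / √σmin := by positivity
  calc e.condVar pop γ σmin σmax πmin fStar t ω
      ≤ ∫ z, 2 * (√σmax / √σmin) * (e.truncA pop γ σmin σmax πmin fStar t (ω, z) ^ 2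
        + e.truncB pop γ σmin σmax πmin fStar t (ω, z) ^ 2) ∂pop.law := by
        refine integral_mono_of_nonneg (ae_of_all _ hnn)
          ((hA.1.integrable_sq.add hB.1.integrable_sq).const_mul _) (ae_of_all _ fun z => ?_)
        have h1 := key _ (e.truncA pop γ σmin σmax πmin fStar t (ω, z))
          (e.truncB pop γ σmin σmax πmin fStar t (ω, z)) (π_mem_Icc (e := e) (pop := pop)
            (σmin := σmin) (σmax := σmax) hγ t ω z.1)
        calc _ ≤ (√σmax / √σmin) * (2 * (e.truncA pop γ σmin σmax πmin fStar t (ω, z) ^ 2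
              + e.truncB pop γ σmin σmax πmin fStar t (ω, z) ^ 2)) :=
              mul_le_mul (hrel z.1).2 h1.2 h1.1 hr
          _ = _ := by ring
    _ ≤ _ := by
        rw [integral_const_mul, integral_add hA.1.integrable_sq hB.1.integrable_sq]
        have := hA.2
        have := hB.2
        gcongr
        linarith

variable [IsProbabilityMeasure P]

include h hf hY hY2 hσmin hσ hπmin in
lemma memLp_trunc_sample :
    MemLp (fun ω => e.truncA pop γ σmin σmax πmin fStar t (ω, e.X t ω, e.sample t ω)) 2 P ∧
    MemLp (fun ω => e.truncB pop γ σmin σmax πmin fStar t (ω, e.X t ω, e.sample t ω)) 2 P := by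
  have hK := momentBound_ne_top (pop := pop) (σmin := σmin) (σmax := σmax) (πmin := πmin) hf hY hY2
  have hid : Measurable[inferInstance, ℱ t] (id : Ω → Ω) := measurable_id.mono le_rfl (ℱ.le t)
  have hC : ∀ ω x, e.rel pop σmin σmax t ω x ≤ √σmax / √σmin := fun ω x =>
    (rel_mem_Icc hσmin hσ (h.measurable_α_right t ω) x).2
  have hL := h.lintegral_trunc_sq_le t hf hY hσmin hσ hπmin
  exact ⟨SequentialSampling.memLp_two_sample (mΩ' := ℱ t) (ι := id)
      (h.map_past_sample t hσmin hσ) hid (h.measurable_X t) (h.measurable_sample t)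
      (h.measurable_rel t) hC (h.measurable_truncA t hf hσmin hσ) hK fun ω => (hL ω).1,
    SequentialSampling.memLp_two_sample (mΩ' := ℱ t) (ι := id)
      (h.map_past_sample t hσmin hσ) hid (h.measurable_X t) (h.measurable_sample t)
      (h.measurable_rel t) hC (h.measurable_truncB t hf hσmin hσ) hK fun ω => (hL ω).2⟩

include h hf hY hY2 hσmin hσ hπmin in
lemma memLp_increment : MemLp (e.increment pop γ σmin σmax πmin fStar t) 2 P := by
  have hm := h.memLp_trunc_sample t hf hY hY2 hσmin hσ hπmin
  refine hm.1.add (hm.2.of_le ((h.measurable_Δ t).aestronglyMeasurable.mul hm.2.1)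
    (ae_of_all _ fun ω => ?_))
  rcases h.Δ_mem t ω with h1 | h1 <;> simp [h1]

include h hγ hσmin hσ in
lemma condExp_randomized {a b : Ω × Cov d × Side m → ℝ}
    (ha : Measurable[(ℱ t).prod inferInstance] a) (hb : Measurable[(ℱ t).prod inferInstance] b)
    (hai : Integrable (fun ω => a (ω, e.X t ω, e.sample t ω)) P)
    (hbi : Integrable (fun ω => b (ω, e.X t ω, e.sample t ω)) P) :
    P[fun ω => a (ω, e.X t ω, e.sample t ω) + e.Δ t ω * b (ω, e.X t ω, e.sample t ω)|ℱ t] =ᵐ[P]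
      fun ω => ∫ z, e.rel pop σmin σmax t ω z.1 * (a (ω, z)
        + e.π pop γ σmin σmax t ω z.1 * b (ω, z)) ∂pop.law := by
  have hid : Measurable[inferInstance, ℱ t] (id : Ω → Ω) := measurable_id.mono le_rfl (ℱ.le t)
  have hΔ := h.sample_Δ t
  have := SequentialSampling.condExp_sample_randomized (mΩ' := ℱ t) (ι := id)
    (h.map_past_sample t hσmin hσ) hid (h.measurable_X t) (h.measurable_sample t)
    (h.measurable_rel t) (rel_nonneg t) (h.measurable_π t hσmin hσ) (π_mem_Icc hγ t)
    (h.measurable_Δ t) (h.Δ_mem t) (by rw [MeasurableSpace.comap_id]; exact hΔ) ha hb hai hbi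
  rwa [MeasurableSpace.comap_id] at this

include h hf hY hY2 hγ hσmin hσ hπmin in
lemma condExp_increment_sq : P[fun ω => e.increment pop γ σmin σmax πmin fStar t ω ^ 2|ℱ t] =ᵐ[P]
    e.condVar pop γ σmin σmax πmin fStar t := by
  have hm := h.memLp_trunc_sample t hf hY hY2 hσmin hσ hπmin
  have h3 := h.measurable_truncA (πmin := πmin) t hf hσmin hσ
  have h4 := h.measurable_truncB (πmin := πmin) t hf hσmin hσ
  have h5 := h.condExp_randomized (P := P) t hγ hσmin hσ
    (a := fun z => e.truncA pop γ σmin σmax πmin fStar t z ^ 2)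
    (b := fun z => 2 * e.truncA pop γ σmin σmax πmin fStar t z
      * e.truncB pop γ σmin σmax πmin fStar t z + e.truncB pop γ σmin σmax πmin fStar t z ^ 2)
    (h3.pow_const 2) (((h3.const_mul 2).mul h4).add (h4.pow_const 2)) hm.1.integrable_sq
    (((hm.1.const_mul 2).integrable_mul hm.2).add hm.2.integrable_sq)
  refine EventuallyEq.trans (EventuallyEq.of_eq ?_) h5
  congr 1
  ext ω
  rw [increment]
  -- As Δ² = Δ, the square (A + ΔB)² is A² + Δ(2AB + B²), again affine in Δ.
  rcases h.Δ_mem t ω with h1 | h1 <;> simp only [h1] <;> ring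

include h hf hY hY2 hγ hσmin hσ hπmin in
-- Inverse weighting makes the estimators cancel: on the good event ρ(A + πB) = Y − μ₁ + ρc with c =
-- E_q μ₁ − θ, and since ρ integrates to 1, the integral is θ − E_q μ₁ + c = 0. Off the good event
-- the increment is 0.
lemma condExp_increment : P[e.increment pop γ σmin σmax πmin fStar t|ℱ t] =ᵐ[P] 0 := by
  have hm := h.memLp_trunc_sample t hf hY hY2 hσmin hσ hπmin
  have h5 := h.condExp_randomized (P := P) t hγ hσmin hσ
    (h.measurable_truncA (πmin := πmin) t hf hσmin hσ) (h.measurable_truncB t hf hσmin hσ)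
    (hm.1.integrable (by norm_num)) (hm.2.integrable (by norm_num))
  refine h5.trans (ae_of_all _ fun ω => ?_)
  by_cases hω : ω ∈ e.good pop γ σmin σmax πmin fStar t
  swap; · simp [truncA, truncB, hω]
  have hrel := fun x => rel_mem_Icc (e := e) (pop := pop) hσmin hσ (h.measurable_α_right t ω) x
  have hs := Real.sqrt_pos.2 hσmin
  have hs2 : 0 < √σmax := Real.sqrt_pos.2 (hσmin.trans_le hσ)
  have hrm := h.measurable_rel_right t ω
  have hri : Integrable (e.rel pop σmin σmax t ω) (pop.covLaw pop.q) :=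
    Integrable.of_bound hrm.aestronglyMeasurable (√σmax / √σmin) (ae_of_all _ fun x => by
      rw [Real.norm_of_nonneg (rel_nonneg _ _ _)]; exact (hrel x).2)
  have hr1 : ∫ x, e.rel pop σmin σmax t ω x ∂pop.covLaw pop.q = 1 := by
    rw [integral_eq_lintegral_of_nonneg_ae (ae_of_all _ (rel_nonneg _ _)) hri.1,
      lintegral_rel hσmin hσ (h.measurable_α_right t ω), ENNReal.toReal_one]
  have hμi := (h.integrable_μ₁ t hY hω.1).1
  set c := ∫ x, e.μ₁ t ω x ∂pop.covLaw pop.q - pop.θ with hc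
  have hμz : Integrable (fun z : Cov d × Side m => e.μ₁ t ω z.1) pop.law :=
    pop.measurePreserving_fst.integrable_comp_of_integrable hμi
  have hrz : Integrable (fun z : Cov d × Side m => e.rel pop σmin σmax t ω z.1 * c) pop.law :=
    (pop.measurePreserving_fst.integrable_comp_of_integrable hri).mul_const c
  have : ∫ z, e.rel pop σmin σmax t ω z.1 * (e.truncA pop γ σmin σmax πmin fStar t (ω, z)
        + e.π pop γ σmin σmax t ω z.1 * e.truncB pop γ σmin σmax πmin fStar t (ω, z)) ∂pop.law
      = ∫ z, ((z.2.2 - e.μ₁ t ω z.1) + e.rel pop σmin σmax t ω z.1 * c) ∂pop.law := by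
    refine integral_congr_ae ?_
    filter_upwards [pop.ae_law_of_ae hω.2] with z hz
    have h1 : e.rel pop σmin σmax t ω z.1 ≠ 0 := ((div_pos hs hs2).trans_le (hrel z.1).1).ne'
    have h2 : e.π pop γ σmin σmax t ω z.1 ≠ 0 := (hπmin.trans_le hz).ne'
    simp only [truncA, truncB, Set.indicator, Set.mem_preimage, hω, if_true, stepA, stepB, ← hc]
    field_simp
    ring
  have hd : Integrable (fun z : Cov d × Side m => z.2.2 - e.μ₁ t ω z.1) pop.law := hY.sub hμz
  refine this.trans ?_
  rw [integral_add hd hrz, integral_sub hY hμz, integral_mul_const,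
    pop.integral_fst hμi.1, pop.integral_fst hri.1, hr1, hc, Pi.zero_apply, θ]
  ring

end FollowsProtocol

end Experiment

end PGAE

/-! ### Convergence of the plug-in designs -/

namespace PGAE

namespace Population

variable {d m : ℕ} {pop : Population d m} {a b : Cov d → ℝ} {as bs : ℕ → Cov d → ℝ}
  {σmin σmax : ℝ}

section

variable (hσ : 0 < σmin) (ha : Measurable a)
  (hab : ∀ᵐ x ∂pop.covLaw pop.q, a x ∈ Set.Icc σmin σmax)
  (has : ∀ t, Measurable (as t)) (hasb : ∀ t x, as t x ∈ Set.Icc σmin σmax)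
  (hlim : ∀ᵐ x ∂pop.covLaw pop.q, Tendsto (fun t => as t x) atTop (𝓝 (a x)))

include has hasb hlim in
lemma tendsto_normConst : Tendsto (fun t => pop.normConst (as t)) atTop (𝓝 (pop.normConst a)) := by
  refine tendsto_integral_of_dominated_convergence (fun _ => √σmax)
    (fun t => (has t).sqrt.aestronglyMeasurable) (integrable_const _)
    (fun t => ae_of_all _ fun x => ?_) ?_
  · rw [Real.norm_of_nonneg (Real.sqrt_nonneg _)]
    exact Real.sqrt_le_sqrt (hasb t x).2
  · filter_upwards [hlim] with x hx using hx.sqrt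

include hσ ha hab has hasb hlim in
lemma tendsto_relDensity : ∀ᵐ x ∂pop.covLaw pop.q,
    Tendsto (fun t => pop.relDensity (as t) x) atTop (𝓝 (pop.relDensity a x)) := by
  filter_upwards [hlim] with x hx
  exact hx.sqrt.div (tendsto_normConst has hasb hlim) (normConst_pos hσ ha hab).ne'

lemma integrable_sqrt (hb : Integrable b (pop.covLaw pop.q)) (hb0 : ∀ x, 0 ≤ b x) :
    MemLp (fun x => √(b x)) 2 (pop.covLaw pop.q) := by
  have hm : AEStronglyMeasurable (fun x => √(b x)) (pop.covLaw pop.q) :=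
    Real.continuous_sqrt.comp_aestronglyMeasurable hb.1
  rw [memLp_two_iff_integrable_sq hm]
  simpa [Real.sq_sqrt, hb0] using hb

/-- Turns L¹ convergence of β̂ into L² convergence of its square root. All real signs are allowed,
because an estimate of β may be negative, where the square root is 0. -/
lemma sq_sqrt_sub_sqrt_le (x y : ℝ) : (√x - √y) ^ 2 ≤ |x - y| := by
  wlog h : y ≤ x generalizing x y
  · have := this y x (le_of_not_ge h)
    rw [abs_sub_comm]; nlinarith
  rw [abs_of_nonneg (sub_nonneg.2 h)]
  have h1 := Real.sqrt_le_sqrt h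
  have h2 := Real.sqrt_nonneg y
  rcases le_total 0 y with hy | hy
  · nlinarith [Real.sq_sqrt hy, Real.sq_sqrt (hy.trans h)]
  · rw [Real.sqrt_eq_zero_of_nonpos hy, sub_zero]
    rcases le_total 0 x with hx | hx
    · rw [Real.sq_sqrt hx]; linarith
    · rw [Real.sqrt_eq_zero_of_nonpos hx]; simp; linarith

/-- The integral of the square root is continuous in `L¹`. -/
lemma tendsto_integral_sqrt (hb : Integrable b (pop.covLaw pop.q)) (hb0 : ∀ x, 0 ≤ b x)
    (hbs : ∀ t, Measurable (bs t))
    (h : Tendsto (fun t => eLpNorm (fun x => bs t x - b x) 1 (pop.covLaw pop.q)) atTop (𝓝 0)) :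
    Tendsto (fun t => ∫ x, √(bs t x) ∂pop.covLaw pop.q) atTop
      (𝓝 (∫ x, √(b x) ∂pop.covLaw pop.q)) := by
  have h2 : Tendsto (fun t => eLpNorm (fun x => √(bs t x) - √(b x)) 2 (pop.covLaw pop.q)) atTop
      (𝓝 0) := by
    have h3 : Tendsto (fun t => eLpNorm (fun x => √(bs t x) - √(b x)) 2 (pop.covLaw pop.q) ^ 2)
        atTop (𝓝 0) := by
      refine tendsto_of_tendsto_of_tendsto_of_le_of_le tendsto_const_nhds h (fun _ => zero_le)
        fun t => ?_
      rw [LTwo.eLpNorm_two_sq, eLpNorm_one_eq_lintegral_enorm]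
      refine lintegral_mono fun x => ?_
      rw [LTwo.enorm_sq, Real.enorm_eq_ofReal_abs]
      exact ENNReal.ofReal_le_ofReal (sq_sqrt_sub_sqrt_le _ _)
    have h4 := ((ENNReal.continuous_rpow_const (y := (2 : ℝ)⁻¹)).tendsto 0).comp h3
    have h5 : ∀ x : ℝ≥0∞, (x ^ 2) ^ (2 : ℝ)⁻¹ = x := fun x => by
      rw [← ENNReal.rpow_natCast, ← ENNReal.rpow_mul]; norm_num
    simpa [Function.comp_def, h5] using h4
  have := LTwo.tendsto_integral_mul (f := fun x => √(b x)) (g := fun _ => (1 : ℝ))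
    (fs := fun t x => √(bs t x)) (gs := fun _ _ => (1 : ℝ)) (integrable_sqrt hb hb0)
    (memLp_const 1) (fun t => (hbs t).sqrt.aestronglyMeasurable)
    (fun _ => aestronglyMeasurable_const) h2 (by simp)
  simpa using this

include hσ ha hab has hasb hlim in
/-- Convergence of the plug-in experiment probabilities, in the nondegenerate case. -/
lemma tendsto_expProb (γ : ℝ)
    (hint : Tendsto (fun t => ∫ x, √(bs t x) ∂pop.covLaw pop.q) atTop
      (𝓝 (∫ x, √(b x) ∂pop.covLaw pop.q)))
    (hpos : ∫ x, √(b x) ∂pop.covLaw pop.q ≠ 0)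
    (hblim : ∀ᵐ x ∂pop.covLaw pop.q, Tendsto (fun t => bs t x) atTop (𝓝 (b x))) :
    ∀ᵐ x ∂pop.covLaw pop.q,
      Tendsto (fun t => pop.expProb γ (as t) (bs t) x) atTop (𝓝 (pop.expProb γ a b x)) := by
  have hN := normConst_pos hσ ha hab
  filter_upwards [hlim, hblim, hab] with x h1 h2 h3
  have e : (fun t => pop.expProb γ (as t) (bs t) x) = fun t =>
      min (γ * √(bs t x / as t x) / ((∫ x', √(bs t x') ∂pop.covLaw pop.q)
        / pop.normConst (as t))) 1 :=
    funext fun t => expProb_eq hσ (has t) (ae_of_all _ (hasb t)) _ _ _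
  rw [e, expProb_eq hσ ha hab]
  refine Tendsto.min (Tendsto.div (Tendsto.const_mul _ (h2.div h1 (hσ.trans_le h3.1).ne').sqrt)
    (hint.div (tendsto_normConst has hasb hlim) hN.ne') (div_ne_zero hpos hN.ne'))
    tendsto_const_nhds

lemma ae_eq_zero_of_integral_sqrt_eq_zero (hb : Integrable b (pop.covLaw pop.q))
    (hb0 : ∀ x, 0 ≤ b x) (h : ∫ x, √(b x) ∂pop.covLaw pop.q = 0) :
    ∀ᵐ x ∂pop.covLaw pop.q, b x = 0 := by
  rw [integral_eq_zero_iff_of_nonneg (fun _ => Real.sqrt_nonneg _)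
    ((integrable_sqrt hb hb0).integrable (by norm_num))] at h
  filter_upwards [h] with x hx
  exact (Real.sqrt_eq_zero (hb0 x)).1 hx

end

end Population

namespace Experiment

open Population

variable {Ω : Type*} {mΩ : MeasurableSpace Ω} {P : Measure Ω}
  {d m : ℕ} (pop : Population d m) (e : Experiment Ω d m)
  {ℱ : Filtration ℕ (inferInstance : MeasurableSpace Ω)} (γ σmin σmax πmin : ℝ)
  (fStar : Cov d → EuclideanSpace ℝ (Fin m) → ℝ)

/-- The estimators converge, and the experiment probabilities are bounded below, along `ω`. -/
structure ConvergesAt (ω : Ω) : Prop where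
  μ₁ : ∀ᵐ x ∂pop.covLaw pop.q, Tendsto (fun t => e.μ₁ t ω x) atTop (𝓝 (pop.μ x))
  μ₁_L2 : Tendsto (fun t => eLpNorm (fun x => e.μ₁ t ω x - pop.μ x) 2 (pop.covLaw pop.q)) atTop
    (𝓝 0)
  μ₂ : ∀ᵐ x ∂pop.covLaw pop.q, Tendsto (fun t => e.μ₂ t ω x) atTop (𝓝 (pop.μsq fStar x))
  pred_L2 : Tendsto (fun t => eLpNorm (fun z =>
    e.pred t ω z - pop.τ fStar z.1 (fStar z.1 z.2.1)) 2 pop.law) atTop (𝓝 0)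
  β : ∀ᵐ x ∂pop.covLaw pop.q, Tendsto (fun t => e.β t ω x) atTop (𝓝 (pop.β fStar x))
  β_L1 : Tendsto (fun t => eLpNorm (fun x => e.β t ω x - pop.β fStar x) 1 (pop.covLaw pop.q)) atTop
    (𝓝 0)
  le_π : ∀ t, ∀ᵐ x ∂pop.covLaw pop.q, πmin ≤ e.π pop γ σmin σmax t ω x

variable {e pop γ σmin σmax πmin fStar} {ω : Ω}

namespace ConvergesAt

variable (hc : e.ConvergesAt pop γ σmin σmax πmin fStar ω)
  (h : e.FollowsProtocol pop γ σmin σmax P ℱ)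
  (hf : Measurable fun z : Cov d × EuclideanSpace ℝ (Fin m) => fStar z.1 z.2)
  (hY : Integrable (fun z : Cov d × Side m => z.2.2) pop.law)
  (hY2 : MemLp (fun z : Cov d × Side m => z.2.2 - pop.μ z.1) 2 pop.law)
  (hγ : 0 ≤ γ) (hσmin : 0 < σmin) (hσ : σmin ≤ σmax) (hπmin : 0 < πmin)
  (hα : ∀ᵐ x ∂pop.covLaw pop.q, pop.α fStar x ∈ Set.Icc σmin σmax)

include hc hf hY hY2 hα in
lemma tendsto_α : ∀ᵐ x ∂pop.covLaw pop.q,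
    Tendsto (fun t => e.α σmin σmax t ω x) atTop (𝓝 (pop.α fStar x)) := by
  filter_upwards [hc.μ₁, hc.μ₂, hα, ae_μsq_sub_sq hf hY hY2] with x h1 h2 h3 h4
  have h5 := tendsto_const_nhds (x := σmin) (f := atTop (α := ℕ)) |>.max
    ((h2.sub (h1.pow 2)).min (tendsto_const_nhds (x := σmax)))
  -- The limit lies in [σmin, σmax], so the truncation leaves it unchanged.
  rwa [h4, min_eq_left h3.2, max_eq_right h3.1] at h5

include hc h hf hY hY2 hσmin hσ hα in
lemma tendsto_rel : ∀ᵐ x ∂pop.covLaw pop.q, Tendsto (fun t => e.rel pop σmin σmax t ω x) atTop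
    (𝓝 (pop.relDensity (pop.α fStar) x)) := by
  filter_upwards [tendsto_relDensity hσmin (measurable_α hf) hα (fun t => h.measurable_α_right t ω)
    (fun t => α_mem_Icc hσ t ω) (hc.tendsto_α hf hY hY2 hα)] with x hx
  refine hx.congr' ?_
  -- The initial step uses its own design, so the plug-in formula is available from time 1 on.
  filter_upwards [eventually_ge_atTop 1] with t ht
  rw [rel, if_neg (by lia)]

include hc h hf hY hY2 hσmin hσ hα in
/-- Either the experiment probabilities converge, or the outcome is a function of the covariate and
the prediction. -/
lemma tendsto_π_or : (∀ᵐ x ∂pop.covLaw pop.q, Tendsto (fun t => e.π pop γ σmin σmax t ω x) atTop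
    (𝓝 (pop.πStar fStar γ x))) ∨ ∀ᵐ x ∂pop.covLaw pop.q, pop.β fStar x = 0 := by
  have hβi := integrable_β hf hY hY2
  -- A vanishing normaliser E_q√β is the only obstruction to convergence, and it forces β = 0 almost
  -- everywhere.
  by_cases hz : ∫ x, √(pop.β fStar x) ∂pop.covLaw pop.q = 0
  · exact Or.inr (ae_eq_zero_of_integral_sqrt_eq_zero hβi β_nonneg hz)
  · left
    have hint := tendsto_integral_sqrt hβi β_nonneg (fun t => h.measurable_β_right t ω) hc.β_L1
    filter_upwards [tendsto_expProb hσmin (measurable_α hf) hα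
      (fun t => h.measurable_α_right t ω) (fun t => α_mem_Icc hσ t ω) (hc.tendsto_α hf hY hY2 hα)
      γ hint hz hc.β] with x hx
    refine hx.congr' ?_
    filter_upwards [eventually_ge_atTop 1] with t ht
    rw [π, if_neg (by lia)]

include hc h hf hY hY2 hσmin hσ hα in
/-- The overlap condition is inherited by the target design. -/
lemma le_πStar_or : (∀ᵐ x ∂pop.covLaw pop.q, πmin ≤ pop.πStar fStar γ x) ∨
    ∀ᵐ x ∂pop.covLaw pop.q, pop.β fStar x = 0 := by
  refine (hc.tendsto_π_or h hf hY hY2 hσmin hσ hα).imp_left fun h1 => ?_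
  filter_upwards [h1, ae_all_iff.2 hc.le_π] with x hx hx2
  exact ge_of_tendsto' hx hx2

include hc in
lemma tendsto_sqError : Tendsto (fun t => e.sqError pop fStar t ω) atTop (𝓝 0) := by
  have h1 := ENNReal.Tendsto.pow (n := 2) hc.μ₁_L2
  have h2 := ENNReal.Tendsto.pow (n := 2) hc.pred_L2
  have h3 := h1.add h2
  have e0 : (0 : ℝ≥0∞) ^ 2 + 0 ^ 2 = 0 := by simp
  simp only [LTwo.eLpNorm_two_sq, e0] at h3
  exact h3

include hc in
lemma eventually_good : ∀ᶠ t in atTop, ω ∈ e.good pop γ σmin σmax πmin fStar t := by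
  filter_upwards [hc.tendsto_sqError.eventually_le_const zero_lt_one] with t ht
  exact ⟨ht, hc.le_π t⟩

include h in
lemma eLpNorm_law_μ₁ (t : ℕ) : eLpNorm (fun z : Cov d × Side m => e.μ₁ t ω z.1 - pop.μ z.1) 2
    pop.law = eLpNorm (fun x => e.μ₁ t ω x - pop.μ x) 2 (pop.covLaw pop.q) :=
  eLpNorm_comp_measurePreserving (g := fun x => e.μ₁ t ω x - pop.μ x)
    ((h.measurable_μ₁_right t ω).sub pop.measurable_μ).aestronglyMeasurable
    pop.measurePreserving_fst

include hc h hY in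
lemma tendsto_centering : Tendsto (fun t => ∫ x, e.μ₁ t ω x ∂pop.covLaw pop.q - pop.θ) atTop
    (𝓝 0) := by
  have h1 : Tendsto (fun t => ‖∫ x, (e.μ₁ t ω x - pop.μ x) ∂pop.covLaw pop.q‖ₑ) atTop (𝓝 0) :=
    tendsto_of_tendsto_of_tendsto_of_le_of_le tendsto_const_nhds hc.μ₁_L2 (fun _ => zero_le)
      fun t => LTwo.enorm_integral_le_eLpNorm_two
        ((h.measurable_μ₁_right t ω).sub pop.measurable_μ).aestronglyMeasurable
  have h2 : Tendsto (fun t => ∫ x, (e.μ₁ t ω x - pop.μ x) ∂pop.covLaw pop.q) atTop (𝓝 0) :=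
    tendsto_zero_iff_enorm_tendsto_zero.2 h1
  refine h2.congr' ?_
  filter_upwards [hc.tendsto_sqError.eventually_le_const zero_lt_one] with t ht
  rw [integral_sub (h.integrable_μ₁ t hY ht).1 (integrable_μ hY), θ_eq hY]

include hc h hf hY hY2 hσmin hσ hα in
-- The inverse densities are uniformly bounded and converge pointwise, the differences τ̂ − μ̂
-- converge in L², and the centring constant tends to 0.
lemma tendsto_stepA : Tendsto (fun t => eLpNorm (fun z => e.stepA pop σmin σmax t (ω, z)
    - pop.predictionInfluence fStar (pop.α fStar) z) 2 pop.law) atTop (𝓝 0) := by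
  have hB := memLp_τ_sub_μ hf hY hY2
  have hs := Real.sqrt_pos.2 hσmin
  have hs2 : 0 < √σmax := Real.sqrt_pos.2 (hσmin.trans_le hσ)
  have hρm := measurable_relDensity (pop := pop) (measurable_α (pop := pop) hf)
  have hrm : ∀ t, AEStronglyMeasurable (fun z : Cov d × Side m =>
      (e.rel pop σmin σmax t ω z.1)⁻¹) pop.law := fun t =>
    ((h.measurable_rel_right t ω).comp measurable_fst).inv.aestronglyMeasurable
  have hpm := fun t => h.measurable_pred_right t ω
  have hμm : ∀ t, Measurable fun z : Cov d × Side m => e.μ₁ t ω z.1 := fun t =>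
    (h.measurable_μ₁_right t ω).comp measurable_fst
  have hdiff : Tendsto (fun t => eLpNorm (fun z : Cov d × Side m => (e.pred t ω z - e.μ₁ t ω z.1)
      - (pop.τ fStar z.1 (fStar z.1 z.2.1) - pop.μ z.1)) 2 pop.law) atTop (𝓝 0) := by
    have h3 := hc.pred_L2.add (hc.μ₁_L2.congr fun t => (eLpNorm_law_μ₁ h t).symm)
    rw [add_zero] at h3
    refine tendsto_of_tendsto_of_tendsto_of_le_of_le tendsto_const_nhds h3 (fun _ => zero_le)
      fun t => ?_
    have e1 : (fun z : Cov d × Side m => (e.pred t ω z - e.μ₁ t ω z.1)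
        - (pop.τ fStar z.1 (fStar z.1 z.2.1) - pop.μ z.1))
        = (fun z => e.pred t ω z - pop.τ fStar z.1 (fStar z.1 z.2.1))
          - fun z => e.μ₁ t ω z.1 - pop.μ z.1 := by
      ext z; simp only [Pi.sub_apply]; ring
    rw [e1]
    exact eLpNorm_sub_le ((hpm t).sub (measurable_τ_comp hf)).aestronglyMeasurable
      ((hμm t).sub (pop.measurable_μ.comp measurable_fst)).aestronglyMeasurable (by norm_num)
  have main := LTwo.tendsto_eLpNorm_mul_sub (C := √σmax / √σmin) hB
    (w := fun z => (pop.relDensity (pop.α fStar) z.1)⁻¹)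
    (hρm.comp measurable_fst).inv.aestronglyMeasurable hrm
    (fun t => ((hpm t).sub (hμm t)).aestronglyMeasurable)
    (Eventually.of_forall fun t => ae_of_all _ fun z => by
      rw [abs_of_nonneg (inv_nonneg.2 (rel_nonneg _ _ _)), ← inv_div]
      exact inv_anti₀ (div_pos hs hs2)
        (rel_mem_Icc hσmin hσ (h.measurable_α_right t ω) z.1).1) (by
      filter_upwards [pop.ae_law_of_ae (hc.tendsto_rel h hf hY hY2 hσmin hσ hα),
        pop.ae_law_of_ae (relDensity_pos hσmin (measurable_α hf) hα)] with z h1 h2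
      exact (h1.inv₀ h2.ne').mul_const _) hdiff
  have hcent : Tendsto (fun t => eLpNorm (fun _ : Cov d × Side m =>
      (∫ x, e.μ₁ t ω x ∂pop.covLaw pop.q - pop.θ) - 0) 2 pop.law) atTop (𝓝 0) := by
    have h1 : Tendsto (fun t => ‖∫ x, e.μ₁ t ω x ∂pop.covLaw pop.q - pop.θ‖ₑ) atTop (𝓝 0) :=
      tendsto_zero_iff_enorm_tendsto_zero.1 (hc.tendsto_centering h hY)
    refine h1.congr fun t => ?_
    rw [eLpNorm_const _ (by norm_num) (IsProbabilityMeasure.ne_zero _)]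
    simp
  have fin := LTwo.tendsto_eLpNorm_add_sub ((hρm.comp measurable_fst).inv.aestronglyMeasurable.mul
    hB.1) aestronglyMeasurable_const (fun t => (hrm t).mul
      ((hpm t).sub (hμm t)).aestronglyMeasurable) (fun _ => aestronglyMeasurable_const) main hcent
  refine fin.congr fun t => ?_
  simp [stepA, predictionInfluence]

include hc h hf hY hY2 hσmin hσ hπmin hα in
lemma tendsto_stepB : Tendsto (fun t => eLpNorm (fun z => e.stepB pop γ σmin σmax t (ω, z)
    - pop.residualInfluence fStar (pop.α fStar) (pop.πStar fStar γ) z) 2 pop.law) atTop (𝓝 0) := by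
  have hE := memLp_Y_sub_τ hf hY hY2
  have hs := Real.sqrt_pos.2 hσmin
  have hs2 : 0 < √σmax := Real.sqrt_pos.2 (hσmin.trans_le hσ)
  have hρm := measurable_relDensity (pop := pop) (measurable_α (pop := pop) hf)
  have hπm : Measurable (pop.πStar fStar γ) :=
    measurable_expProb γ (measurable_α hf) (measurable_β hf)
  have hpm := fun t => h.measurable_pred_right t ω
  have hdiff : Tendsto (fun t => eLpNorm (fun z : Cov d × Side m => (z.2.2 - e.pred t ω z)
      - (z.2.2 - pop.τ fStar z.1 (fStar z.1 z.2.1))) 2 pop.law) atTop (𝓝 0) := by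
    refine hc.pred_L2.congr fun t => ?_
    rw [← eLpNorm_neg]
    congr 1
    ext z; simp only [Pi.neg_apply]; ring
  have hwm : AEStronglyMeasurable (fun z : Cov d × Side m =>
      (pop.relDensity (pop.α fStar) z.1)⁻¹ * (pop.πStar fStar γ z.1)⁻¹) pop.law :=
    ((hρm.comp measurable_fst).inv.mul (hπm.comp measurable_fst).inv).aestronglyMeasurable
  have hwsm : ∀ t, AEStronglyMeasurable (fun z : Cov d × Side m =>
      (e.rel pop σmin σmax t ω z.1)⁻¹ * (e.π pop γ σmin σmax t ω z.1)⁻¹) pop.law := fun t =>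
    (((h.measurable_rel_right t ω).comp measurable_fst).inv.mul
      ((h.measurable_π_right t hσmin hσ ω).comp measurable_fst).inv).aestronglyMeasurable
  have hEm : ∀ t, AEStronglyMeasurable (fun z : Cov d × Side m => z.2.2 - e.pred t ω z) pop.law :=
    fun t => (measurable_snd.snd.sub (hpm t)).aestronglyMeasurable
  have hbound : ∀ t, ∀ᵐ z ∂pop.law, |(e.rel pop σmin σmax t ω z.1)⁻¹
      * (e.π pop γ σmin σmax t ω z.1)⁻¹| ≤ √σmax / √σmin * πmin⁻¹ := fun t => by
    filter_upwards [pop.ae_law_of_ae (hc.le_π t)] with z hz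
    rw [abs_mul, abs_of_nonneg (inv_nonneg.2 (rel_nonneg _ _ _)), ← inv_div √σmin,
      abs_of_nonneg (inv_nonneg.2 (hπmin.le.trans hz))]
    exact mul_le_mul (inv_anti₀ (div_pos hs hs2)
      (rel_mem_Icc hσmin hσ (h.measurable_α_right t ω) z.1).1) (inv_anti₀ hπmin hz)
      (inv_nonneg.2 (hπmin.le.trans hz)) (by positivity)
  -- In the degenerate case the weights may oscillate, but they multiply Y − τ = 0; hence
  -- convergence is asked only of the product.
  have hlim : ∀ᵐ z ∂pop.law, Tendsto (fun t => (e.rel pop σmin σmax t ω z.1)⁻¹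
      * (e.π pop γ σmin σmax t ω z.1)⁻¹ * (z.2.2 - pop.τ fStar z.1 (fStar z.1 z.2.1))) atTop
      (𝓝 ((pop.relDensity (pop.α fStar) z.1)⁻¹ * (pop.πStar fStar γ z.1)⁻¹
        * (z.2.2 - pop.τ fStar z.1 (fStar z.1 z.2.1)))) := by
    rcases hc.tendsto_π_or h hf hY hY2 hσmin hσ hα with h1 | h1
    · filter_upwards [pop.ae_law_of_ae (hc.tendsto_rel h hf hY hY2 hσmin hσ hα),
        pop.ae_law_of_ae (relDensity_pos hσmin (measurable_α hf) hα), pop.ae_law_of_ae h1,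
        pop.ae_law_of_ae (ae_all_iff.2 hc.le_π)] with z h2 h3 h4 h5
      exact ((h2.inv₀ h3.ne').mul (h4.inv₀
        (hπmin.trans_le (ge_of_tendsto' h4 h5)).ne')).mul_const _
    · filter_upwards [ae_Y_eq_τ_of_β_eq_zero hf hY hY2 h1] with z hz
      simp [← hz]
  exact LTwo.tendsto_eLpNorm_mul_sub hE hwm hwsm hEm (Eventually.of_forall hbound) hlim hdiff

include hc h hf hY hY2 hσmin hσ hπmin hα in
/-- The conditional variances converge to the asymptotic variance. -/
lemma tendsto_condVar : Tendsto (fun t => e.condVar pop γ σmin σmax πmin fStar t ω) atTop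
    (𝓝 (pop.V fStar (pop.pStar fStar) (pop.πStar fStar γ))) := by
  have hs := Real.sqrt_pos.2 hσmin
  have hs2 : 0 < √σmax := Real.sqrt_pos.2 (hσmin.trans_le hσ)
  have hαm := measurable_α (pop := pop) hf
  have hρm := measurable_relDensity (pop := pop) hαm
  have hπm : Measurable (pop.πStar fStar γ) := measurable_expProb γ hαm (measurable_β hf)
  have hdich := hc.le_πStar_or h hf hY hY2 hσmin hσ hα
  have hE := memLp_Y_sub_τ hf hY hY2
  have hB := memLp_τ_sub_μ hf hY hY2
  have hR := memLp_residualInfluence hf hY hY2 hσmin hαm hα hπm hπmin hdich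
  have hQ := memLp_predictionInfluence hf hY hY2 hσmin hαm hα
  have hA := hc.tendsto_stepA h hf hY hY2 hσmin hσ hα
  have hBt := hc.tendsto_stepB h hf hY hY2 hσmin hσ hπmin hα
  have hAm : ∀ t, AEStronglyMeasurable (fun z => e.stepA pop σmin σmax t (ω, z)) pop.law :=
    fun t => ((h.measurable_stepA t).comp
      (measurable_prodMk_left (m := ℱ t))).aestronglyMeasurable
  have hBm : ∀ t, AEStronglyMeasurable (fun z => e.stepB pop γ σmin σmax t (ω, z)) pop.law :=
    fun t => ((h.measurable_stepB t hσmin hσ).comp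
      (measurable_prodMk_left (m := ℱ t))).aestronglyMeasurable
  have hrm : ∀ t, AEStronglyMeasurable (fun z : Cov d × Side m =>
      e.rel pop σmin σmax t ω z.1) pop.law := fun t =>
    ((h.measurable_rel_right t ω).comp measurable_fst).aestronglyMeasurable
  have hpm := fun t => h.measurable_pred_right t ω
  have hEm : ∀ t, AEStronglyMeasurable (fun z : Cov d × Side m => z.2.2 - e.pred t ω z) pop.law :=
    fun t => (measurable_snd.snd.sub (hpm t)).aestronglyMeasurable
  have hrelA := LTwo.tendsto_eLpNorm_mul_sub (C := √σmax / √σmin) hQ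
    (w := fun z => pop.relDensity (pop.α fStar) z.1)
    (hρm.comp measurable_fst).aestronglyMeasurable hrm hAm
    (Eventually.of_forall fun t => ae_of_all _ fun z => by
      rw [abs_of_nonneg (rel_nonneg _ _ _)]
      exact (rel_mem_Icc hσmin hσ (h.measurable_α_right t ω) z.1).2) (by
      filter_upwards [pop.ae_law_of_ae (hc.tendsto_rel h hf hY hY2 hσmin hσ hα)] with z h1
      exact h1.mul_const _) hA
  have hρQ : MemLp (fun z : Cov d × Side m => pop.relDensity (pop.α fStar) z.1
      * pop.predictionInfluence fStar (pop.α fStar) z) 2 pop.law := by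
    refine hB.ae_eq ?_
    filter_upwards [ae_mul_predictionInfluence (f := fStar) hσmin hαm hα] with z hz
    rw [hz]
  have hEt : Tendsto (fun t => eLpNorm (fun z : Cov d × Side m => (z.2.2 - e.pred t ω z)
      - (z.2.2 - pop.τ fStar z.1 (fStar z.1 z.2.1))) 2 pop.law) atTop (𝓝 0) := by
    refine hc.pred_L2.congr fun t => ?_
    rw [← eLpNorm_neg]
    congr 1
    ext z; simp only [Pi.neg_apply]; ring
  -- The integrand of the conditional variance is written (ρA)A + (ρπB)(A + A + B), and ρπB = Y −
  -- τ̂. Only products of two L²-convergent sequences remain, and π̂ no longer appears as a separate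
  -- factor.
  have hAA := LTwo.tendsto_eLpNorm_add_sub hQ.1 hQ.1 hAm hAm hA hA
  have hAAm := fun t => (hAm t).add (hAm t)
  have hAAB := LTwo.tendsto_eLpNorm_add_sub (hQ.1.add hQ.1) hR.1 hAAm hBm hAA hBt
  have hQQR : MemLp (fun z => (pop.predictionInfluence fStar (pop.α fStar) z
      + pop.predictionInfluence fStar (pop.α fStar) z)
      + pop.residualInfluence fStar (pop.α fStar) (pop.πStar fStar γ) z) 2 pop.law :=
    (hQ.add hQ).add hR
  have lim1 := LTwo.tendsto_integral_mul hρQ hQ (fun t => (hrm t).mul (hAm t)) hAm hrelA hA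
  have lim2 := LTwo.tendsto_integral_mul hE hQQR hEm (fun t => (hAAm t).add (hBm t)) hEt hAAB
  have hV : pop.V fStar (pop.pStar fStar) (pop.πStar fStar γ)
      = (∫ z : Cov d × Side m, pop.relDensity (pop.α fStar) z.1
          * pop.predictionInfluence fStar (pop.α fStar) z
          * pop.predictionInfluence fStar (pop.α fStar) z ∂pop.law)
        + ∫ z : Cov d × Side m, (z.2.2 - pop.τ fStar z.1 (fStar z.1 z.2.1))
          * ((pop.predictionInfluence fStar (pop.α fStar) z
      + pop.predictionInfluence fStar (pop.α fStar) z)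
      + pop.residualInfluence fStar (pop.α fStar) (pop.πStar fStar γ) z) ∂pop.law := by
    -- In the limit the cross term 2Q(Y − τ) integrates to 0, because Q is a function of (X, F).
    have hcross : Integrable (fun z : Cov d × Side m =>
        2 * pop.predictionInfluence fStar (pop.α fStar) z
          * (z.2.2 - pop.τ fStar z.1 (fStar z.1 z.2.1))) pop.law :=
      (hQ.const_mul 2).integrable_mul hE
    have hcross0 : ∫ z : Cov d × Side m, 2 * pop.predictionInfluence fStar (pop.α fStar) z
          * (z.2.2 - pop.τ fStar z.1 (fStar z.1 z.2.1)) ∂pop.law = 0 :=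
      integral_mul_Y_sub_τ hf hY (g := fun v => 2 * ((pop.relDensity (pop.α fStar) v.1)⁻¹
        * (pop.τ fStar v.1 v.2 - pop.μ v.1))) (((hρm.inv.comp measurable_fst).mul
        (measurable_τ.sub (pop.measurable_μ.comp measurable_fst))).const_mul 2) hcross
    have i1 := hρQ.integrable_mul hQ
    have i2 := hE.integrable_mul hQQR
    have i3 : Integrable (fun z : Cov d × Side m => (z.2.2 - pop.τ fStar z.1 (fStar z.1 z.2.1))
      * pop.residualInfluence fStar (pop.α fStar) (pop.πStar fStar γ) z
      + (pop.τ fStar z.1 (fStar z.1 z.2.1) - pop.μ z.1)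
        * pop.predictionInfluence fStar (pop.α fStar) z) pop.law :=
      (hE.integrable_mul hR).add (hB.integrable_mul hQ)
    have hV0 : pop.V fStar (pop.pStar fStar) (pop.πStar fStar γ) = _ :=
      V_eq_integral_influence hf hY hY2 hσmin hαm hα hπm hπmin hdich
    rw [hV0, ← add_zero (∫ z, (_ + _) ∂pop.law), ← hcross0, ← integral_add i3 hcross]
    refine Eq.trans ?_ (integral_add i1 i2)
    refine integral_congr_ae ?_
    filter_upwards [ae_mul_predictionInfluence (f := fStar) hσmin hαm hα] with z hz
    rw [hz]; ring
  rw [hV]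
  refine (lim1.add lim2).congr' ?_
  filter_upwards [hc.eventually_good, LTwo.eventually_memLp_of_tendsto hAm hQ hA,
    LTwo.eventually_memLp_of_tendsto hBm hR hBt, LTwo.eventually_memLp_of_tendsto hEm hE hEt,
    LTwo.eventually_memLp_of_tendsto (fun t => (hrm t).mul (hAm t)) hρQ hrelA]
    with t hg m1 m2 m3 m4
  refine (integral_add (m4.integrable_mul m1) (m3.integrable_mul ((m1.add m1).add m2))).symm.trans ?_
  refine integral_congr_ae ?_
  filter_upwards [pop.ae_law_of_ae (hc.le_π t)] with z hz
  have h1 : e.rel pop σmin σmax t ω z.1 ≠ 0 := ((div_pos hs hs2).trans_le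
    (rel_mem_Icc hσmin hσ (h.measurable_α_right t ω) z.1).1).ne'
  have h2 : e.π pop γ σmin σmax t ω z.1 ≠ 0 := (hπmin.trans_le hz).ne'
  have h3 : z.2.2 - e.pred t ω z = e.rel pop σmin σmax t ω z.1
      * e.π pop γ σmin σmax t ω z.1 * e.stepB pop γ σmin σmax t (ω, z) := by
    rw [stepB]; field_simp
  simp only [truncA, truncB, Set.indicator, Set.mem_preimage, hg, if_true, Pi.mul_apply,
    Pi.add_apply]
  rw [h3]; ring

end ConvergesAt

end Experiment

end PGAE

/-! ### The Lindeberg condition -/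

/-- The integrand of the Lindeberg condition, split along a domination. -/
lemma min_sq_cube_le_of_abs_le_add {x a b s : ℝ} (hb : 0 ≤ b) (hs : 0 ≤ s)
    (h : |x| ≤ a + b) : min (x ^ 2) (|x| ^ 3 / s)
      ≤ 4 * a ^ 2 + min ((2 * b) ^ 2) ((2 * b) ^ 3 / s) := by
  have h0 := abs_nonneg x
  have h1 : 0 ≤ min ((2 * b) ^ 2) ((2 * b) ^ 3 / s) := le_min (by positivity) (by positivity)
  -- If a dominates, |x| ≤ 2a and the square is kept; otherwise |x| ≤ 2b and the truncated form is
  -- kept.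
  rcases le_total b a with hab | hab
  · have h2 : |x| ^ 2 ≤ (2 * a) ^ 2 := pow_le_pow_left₀ h0 (by linarith) 2
    rw [sq_abs] at h2
    linarith [min_le_left (x ^ 2) (|x| ^ 3 / s)]
  · have h2 : |x| ≤ 2 * b := by linarith
    have h3 : min (x ^ 2) (|x| ^ 3 / s) ≤ min ((2 * b) ^ 2) ((2 * b) ^ 3 / s) := by
      rw [← sq_abs x]
      gcongr
    linarith [sq_nonneg a]

/-- A fixed square-integrable variable satisfies the Lindeberg condition: the integrand is dominated
by g², and its cubic entry tends to 0 pointwise. -/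
lemma tendsto_lintegral_min_sq_cube {Z : Type*} {mZ : MeasurableSpace Z} {μ : Measure Z}
    {g : Z → ℝ} (hg : Measurable g) (hg2 : MemLp g 2 μ) :
    Tendsto (fun T : ℕ => ∫⁻ z, ENNReal.ofReal (min (g z ^ 2) (g z ^ 3 / √(T : ℝ))) ∂μ) atTop
      (𝓝 0) := by
  have h := tendsto_lintegral_of_dominated_convergence (μ := μ)
    (F := fun (T : ℕ) z => ENNReal.ofReal (min (g z ^ 2) (g z ^ 3 / √(T : ℝ)))) (f := fun _ => 0)
    (fun z => ‖g z‖ₑ ^ 2)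
    (fun T => ((hg.pow_const 2).min ((hg.pow_const 3).div_const _)).ennreal_ofReal)
    (fun T => ae_of_all _ fun z => ?_) ?_ (ae_of_all _ fun z => ?_)
  · simpa using h
  · simp only [LTwo.enorm_sq]
    exact ENNReal.ofReal_le_ofReal (min_le_left _ _)
  · rw [← LTwo.eLpNorm_two_sq]
    exact ENNReal.pow_ne_top hg2.2.ne
  · have h1 : Tendsto (fun T : ℕ => g z ^ 3 / √(T : ℝ)) atTop (𝓝 0) :=
      tendsto_const_nhds.div_atTop
        (Real.tendsto_sqrt_atTop.comp tendsto_natCast_atTop_atTop)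
    have h2 := (tendsto_const_nhds (x := g z ^ 2)).min h1
    rw [min_eq_right (sq_nonneg _)] at h2
    simpa using ENNReal.tendsto_ofReal h2

namespace PGAE

namespace Experiment

open Population

variable {Ω : Type*} {mΩ : MeasurableSpace Ω} {P : Measure Ω}
  {d m : ℕ} {pop : Population d m} {e : Experiment Ω d m}
  {ℱ : Filtration ℕ (inferInstance : MeasurableSpace Ω)} {γ σmin σmax πmin : ℝ}
  {fStar : Cov d → EuclideanSpace ℝ (Fin m) → ℝ}
  (hc : ∀ᵐ ω ∂P, e.ConvergesAt pop γ σmin σmax πmin fStar ω)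
  (h : e.FollowsProtocol pop γ σmin σmax P ℱ)
  (hf : Measurable fun z : Cov d × EuclideanSpace ℝ (Fin m) => fStar z.1 z.2)
  (hY : Integrable (fun z : Cov d × Side m => z.2.2) pop.law)
  (hY2 : MemLp (fun z : Cov d × Side m => z.2.2 - pop.μ z.1) 2 pop.law)
  (hγ : 0 ≤ γ) (hσmin : 0 < σmin) (hσ : σmin ≤ σmax) (hπmin : 0 < πmin)

variable (P) in
/-- The mean squared error of the estimators of step `t` on the good event. -/
noncomputable def meanSqError (pop : Population d m) (e : Experiment Ω d m) (γ σmin σmax πmin : ℝ)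
    (fStar : Cov d → EuclideanSpace ℝ (Fin m) → ℝ) (t : ℕ) : ℝ≥0∞ :=
  ∫⁻ ω, (e.good pop γ σmin σmax πmin fStar t).indicator (e.sqError pop fStar t) ω ∂P

include h hf hσmin hσ in
lemma measurable_indicator_sqError (t : ℕ) : Measurable
    ((e.good pop γ σmin σmax πmin fStar t).indicator (e.sqError pop fStar t)) :=
  ((h.measurable_sqError t hf).mono (ℱ.le t) le_rfl).indicator
    (ℱ.le t _ (h.measurableSet_good t hf hσmin hσ))

include h in
lemma lintegral_errorSum_sq_le (t : ℕ) (ω : Ω) {M : ℝ} :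
    ∫⁻ z, ENNReal.ofReal (4 * (2 * M * e.errorSum pop fStar t (ω, z)) ^ 2) ∂pop.law
      ≤ ENNReal.ofReal (32 * M ^ 2) * e.sqError pop fStar t ω := by
  -- The constant is 32 = 4 · 2² · 2, the last factor from (a + b)² ≤ 2(a² + b²).
  have h1 : ∀ z : Cov d × Side m,
      ENNReal.ofReal (4 * (2 * M * e.errorSum pop fStar t (ω, z)) ^ 2)
      ≤ ENNReal.ofReal (32 * M ^ 2) * (‖e.μ₁ t ω z.1 - pop.μ z.1‖ₑ ^ 2
        + ‖e.pred t ω z - pop.τ fStar z.1 (fStar z.1 z.2.1)‖ₑ ^ 2) := fun z => by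
    simp only [LTwo.enorm_sq]
    rw [← ENNReal.ofReal_add (sq_nonneg _) (sq_nonneg _), ← ENNReal.ofReal_mul (by positivity)]
    refine ENNReal.ofReal_le_ofReal ?_
    simp only [errorSum]
    set u := e.pred t ω z - pop.τ fStar z.1 (fStar z.1 z.2.1)
    set w := e.μ₁ t ω z.1 - pop.μ z.1
    have h2 : (|u| + |w|) ^ 2 ≤ 2 * (w ^ 2 + u ^ 2) := by
      nlinarith [sq_nonneg (|u| - |w|), sq_abs u, sq_abs w]
    nlinarith [mul_le_mul_of_nonneg_left h2 (sq_nonneg M)]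
  have m1 : Measurable fun z : Cov d × Side m => ‖e.μ₁ t ω z.1 - pop.μ z.1‖ₑ ^ 2 :=
    (((h.measurable_μ₁_right t ω).sub pop.measurable_μ).comp measurable_fst).enorm.pow_const 2
  refine (lintegral_mono h1).trans ?_
  rw [lintegral_const_mul' _ _ ENNReal.ofReal_ne_top, lintegral_add_left m1,
    h.lintegral_law_μ₁, sqError]

include h hσmin hσ in
lemma measurable_estimator (T : ℕ) : Measurable (e.estimator pop γ σmin σmax T) := by
  refine (Finset.measurable_fun_sum _ fun t _ => Measurable.add ?_ ?_).const_mul _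
  · have h1 := h.predictable_μ₁ t
    exact Measurable.mono (measurable_integral_covLaw h1) (ℱ.le t) le_rfl
  · have hX := h.measurable_X t
    have hS := h.measurable_sample t
    have hΔ := h.measurable_Δ t
    have hY : Measurable (e.Y t) := hS.snd
    have hid : Measurable[inferInstance, ℱ t] (id : Ω → Ω) := measurable_id.mono le_rfl (ℱ.le t)
    have hx : Measurable[inferInstance, (ℱ t).prod inferInstance] fun ω => (ω, e.X t ω) :=
      Measurable.prodMk hid hX
    have hz : Measurable[inferInstance, (ℱ t).prod inferInstance]
      fun ω => (ω, e.X t ω, e.sample t ω) := Measurable.prodMk hid (hX.prodMk hS)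
    have hμ : Measurable fun ω => e.μ₁ t ω (e.X t ω) := (h.predictable_μ₁ t).comp hx
    have hτ : Measurable fun ω => e.τ₁ t ω (e.X t ω) (e.F t ω) := (h.measurable_pred t).comp hz
    have hπ : Measurable fun ω => e.π pop γ σmin σmax t ω (e.X t ω) :=
      (h.measurable_π t hσmin hσ).comp hx
    have hq : Measurable fun ω => pop.q (e.X t ω) := pop.measurable_q.comp hX
    have hp : Measurable fun ω => e.p pop σmin σmax t ω (e.X t ω) := by
      simp only [p_eq]
      exact hq.mul ((h.measurable_rel t).comp hx)
    exact (((hΔ.mul hq).div (hπ.mul hp)).mul (hY.sub hμ)).add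
      ((((hΔ.sub hπ).mul hq).div (hπ.mul hp)).mul (hμ.sub hτ))

variable [IsProbabilityMeasure P]

include h hσmin hσ in
/-- A property that holds almost everywhere for an independent draw from the population holds almost
surely for the sampled data. -/
lemma FollowsProtocol.ae_sample (t : ℕ) {p : Ω × Cov d × Side m → Prop}
    (hp : MeasurableSet[(ℱ t).prod inferInstance] {z | p z})
    (hp2 : ∀ᵐ ω ∂P, ∀ᵐ z ∂pop.law, p (ω, z)) : ∀ᵐ ω ∂P, p (ω, e.X t ω, e.sample t ω) := by
  have hid : Measurable[inferInstance, ℱ t] (id : Ω → Ω) := measurable_id.mono le_rfl (ℱ.le t)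
  exact SequentialSampling.ae_sample (mΩ' := ℱ t) (ι := id) (h.map_past_sample t hσmin hσ) hid
    (h.measurable_X t) (h.measurable_sample t) hp hp2

lemma boundConst_nonneg (hπmin : 0 < πmin) : 0 ≤ boundConst σmin σmax πmin := by
  have := inv_pos.2 hπmin
  unfold boundConst; positivity

lemma indicator_sqError_le_one (t : ℕ) (ω : Ω) :
    (e.good pop γ σmin σmax πmin fStar t).indicator (e.sqError pop fStar t) ω ≤ 1 :=
  Set.indicator_apply_le' (fun hω => hω.1) fun _ => zero_le

lemma meanSqError_le_one (t : ℕ) : e.meanSqError P pop γ σmin σmax πmin fStar t ≤ 1 :=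
  (lintegral_mono (indicator_sqError_le_one t)).trans (by simp)

include hc h hf hσmin hσ in
-- On the good event the squared error is at most 1, so almost sure convergence upgrades to
-- convergence in mean.
lemma tendsto_meanSqError :
    Tendsto (fun t => e.meanSqError P pop γ σmin σmax πmin fStar t) atTop (𝓝 0) := by
  have h1 := tendsto_lintegral_of_dominated_convergence (μ := P)
    (F := fun t => (e.good pop γ σmin σmax πmin fStar t).indicator (e.sqError pop fStar t))
    (f := fun _ => 0) (fun _ => 1) (measurable_indicator_sqError h hf hσmin hσ)
    (fun t => ae_of_all _ (indicator_sqError_le_one t)) (by simp) ?_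
  · simpa [meanSqError] using h1
  · filter_upwards [hc] with ω hω
    exact tendsto_of_tendsto_of_tendsto_of_le_of_le tendsto_const_nhds hω.tendsto_sqError
      (fun _ => zero_le) fun t => Set.indicator_le_self _ _ _

include h hf hY hσmin hσ hπmin in
-- Transfers the population bounds to the adaptively sampled point. The factor 2 counts the two
-- parts A and ΔB; the split into error and envelope feeds `min_sq_cube_le_of_abs_le_add`.
lemma ae_abs_increment_le (t : ℕ) : ∀ᵐ ω ∂P,
    (ω ∉ e.good pop γ σmin σmax πmin fStar t →
      e.increment pop γ σmin σmax πmin fStar t ω = 0) ∧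
    |e.increment pop γ σmin σmax πmin fStar t ω| ≤
      2 * boundConst σmin σmax πmin * e.errorSum pop fStar t (ω, e.X t ω, e.sample t ω)
      + 2 * boundConst σmin σmax πmin * pop.envelope fStar (e.X t ω, e.sample t ω) := by
  have hA := h.measurable_truncA (πmin := πmin) t hf hσmin hσ
  have hB := h.measurable_truncB (πmin := πmin) t hf hσmin hσ
  have hE := h.measurable_errorSum t hf
  have hM := boundConst_nonneg (σmin := σmin) (σmax := σmax) hπmin
  have hms : MeasurableSet[(ℱ t).prod inferInstance] {z : Ω × Cov d × Side m |
      |e.truncA pop γ σmin σmax πmin fStar t z| ≤ boundConst σmin σmax πmin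
        * (e.errorSum pop fStar t z + pop.envelope fStar z.2) ∧
      |e.truncB pop γ σmin σmax πmin fStar t z| ≤ boundConst σmin σmax πmin
        * (e.errorSum pop fStar t z + pop.envelope fStar z.2)} := by
    let := ℱ t
    have hR : Measurable fun z : Ω × Cov d × Side m => boundConst σmin σmax πmin
        * (e.errorSum pop fStar t z + pop.envelope fStar z.2) :=
      (hE.add ((measurable_envelope hf).comp measurable_snd)).const_mul _
    exact (measurableSet_le hA.abs hR).inter (measurableSet_le hB.abs hR)
  have hnn : ∀ z : Ω × Cov d × Side m, 0 ≤ boundConst σmin σmax πmin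
        * (e.errorSum pop fStar t z + pop.envelope fStar z.2) := fun z => by
    have h1 := one_le_envelope (pop := pop) (f := fStar) z.2
    have h2 : 0 ≤ e.errorSum pop fStar t z := by unfold errorSum; positivity
    positivity
  filter_upwards [h.ae_sample hσmin hσ t hms (ae_of_all _ fun ω => by
    by_cases hω : ω ∈ e.good pop γ σmin σmax πmin fStar t
    · filter_upwards [h.abs_step_le t hY hσmin hσ hπmin hω] with z hz
      simpa [truncA, truncB, hω] using hz
    · exact ae_of_all _ fun z => by simpa [truncA, truncB, hω] using hnn (ω, z))] with ω hω
  constructor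
  · intro hg
    simp [increment, truncA, truncB, hg]
  · obtain ⟨h1, h2⟩ := hω
    have h3 : |e.Δ t ω * e.truncB pop γ σmin σmax πmin fStar t (ω, e.X t ω, e.sample t ω)|
        ≤ |e.truncB pop γ σmin σmax πmin fStar t (ω, e.X t ω, e.sample t ω)| := by
      rcases h.Δ_mem t ω with h4 | h4 <;> simp [h4]
    have h4 := abs_add_le (e.truncA pop γ σmin σmax πmin fStar t (ω, e.X t ω, e.sample t ω))
      (e.Δ t ω * e.truncB pop γ σmin σmax πmin fStar t (ω, e.X t ω, e.sample t ω))
    rw [increment]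
    linarith

include h hf hY hσmin hσ hπmin in
/-- A bound on the terms of the Lindeberg condition. -/
lemma lintegral_min_increment_le (t T : ℕ) :
    ∫⁻ ω, ENNReal.ofReal (min (e.increment pop γ σmin σmax πmin fStar t ω ^ 2)
      (|e.increment pop γ σmin σmax πmin fStar t ω| ^ 3 / √(T : ℝ))) ∂P
    ≤ ENNReal.ofReal (√σmax / √σmin) * (ENNReal.ofReal (32 * boundConst σmin σmax πmin ^ 2)
        * e.meanSqError P pop γ σmin σmax πmin fStar t
      + ∫⁻ z, ENNReal.ofReal (min ((2 * (2 * boundConst σmin σmax πmin * pop.envelope fStar z)) ^ 2)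
        ((2 * (2 * boundConst σmin σmax πmin * pop.envelope fStar z)) ^ 3 / √(T : ℝ)))
          ∂pop.law) := by
  have hM := boundConst_nonneg (σmin := σmin) (σmax := σmax) hπmin
  set M := boundConst σmin σmax πmin with hMdef
  set G := e.good pop γ σmin σmax πmin fStar t with hG
  set ψ : Cov d × Side m → ℝ≥0∞ := fun z => ENNReal.ofReal
    (min ((2 * (2 * M * pop.envelope fStar z)) ^ 2)
        ((2 * (2 * M * pop.envelope fStar z)) ^ 3 / √(T : ℝ))) with hψ
  -- The error enters through its full square, since it is small in mean; the envelope, which does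
  -- not shrink with t, enters through the Lindeberg integrand.
  set H : Ω × Cov d × Side m → ℝ≥0∞ := fun z =>
    (Prod.fst ⁻¹' G).indicator (fun z => ENNReal.ofReal
      (4 * (2 * M * e.errorSum pop fStar t z) ^ 2)) z + ψ z.2 with hH
  have hψm : Measurable ψ := by
    have := (measurable_envelope (pop := pop) hf).const_mul (2 * M) |>.const_mul 2
    exact ((this.pow_const 2).min ((this.pow_const 3).div_const _)).ennreal_ofReal
  have hHm : Measurable[(ℱ t).prod inferInstance] H := by
    have h1 := h.measurable_errorSum t hf
    have h2 := h.measurableSet_good (πmin := πmin) t hf hσmin hσ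
    let := ℱ t
    exact (((h1.const_mul (2 * M)).pow_const 2).const_mul 4).ennreal_ofReal.indicator
      (measurable_fst h2) |>.add (hψm.comp measurable_snd)
  have hid : Measurable[inferInstance, ℱ t] (id : Ω → Ω) := measurable_id.mono le_rfl (ℱ.le t)
  have hC : ∀ ω x, e.rel pop σmin σmax t ω x ≤ √σmax / √σmin := fun ω x =>
    (rel_mem_Icc hσmin hσ (h.measurable_α_right t ω) x).2
  have step1 : ∫⁻ ω, ENNReal.ofReal (min (e.increment pop γ σmin σmax πmin fStar t ω ^ 2)
      (|e.increment pop γ σmin σmax πmin fStar t ω| ^ 3 / √(T : ℝ))) ∂P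
      ≤ ∫⁻ ω, H (ω, e.X t ω, e.sample t ω) ∂P := by
    refine lintegral_mono_ae ?_
    filter_upwards [ae_abs_increment_le h hf hY hσmin hσ hπmin t] with ω hω
    by_cases hg : ω ∈ G
    · have hR : 0 ≤ e.errorSum pop fStar t (ω, e.X t ω, e.sample t ω) := by
        unfold errorSum; positivity
      have hEn := one_le_envelope (pop := pop) (f := fStar) (e.X t ω, e.sample t ω)
      have h1 := min_sq_cube_le_of_abs_le_add (by positivity)
        (Real.sqrt_nonneg (T : ℝ)) hω.2
      have h2 : H (ω, e.X t ω, e.sample t ω) = ENNReal.ofReal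
          (4 * (2 * M * e.errorSum pop fStar t (ω, e.X t ω, e.sample t ω)) ^ 2)
          + ψ (e.X t ω, e.sample t ω) := by
        simp [hH, hg]
      rw [h2, hψ, ← ENNReal.ofReal_add (by positivity)
        (le_min (by positivity) (by positivity))]
      exact ENNReal.ofReal_le_ofReal h1
    · rw [hω.1 hg]; simp
  refine step1.trans ((SequentialSampling.lintegral_sample_le (mΩ' := ℱ t) (ι := id)
    (h.map_past_sample t hσmin hσ) hid (h.measurable_X t) (h.measurable_sample t)
    (h.measurable_rel t) hC hHm).trans ?_)
  gcongr
  have step2 : ∀ ω, ∫⁻ z, H (ω, z) ∂pop.law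
      ≤ ENNReal.ofReal (32 * M ^ 2) * G.indicator (e.sqError pop fStar t) ω
        + ∫⁻ z, ψ z ∂pop.law := fun ω => by
    by_cases hg : ω ∈ G
    · have h2 : ∀ z, H (ω, z) = ENNReal.ofReal
          (4 * (2 * M * e.errorSum pop fStar t (ω, z)) ^ 2) + ψ z := fun z => by
        simp [hH, hg]
      simp only [h2]
      rw [lintegral_add_right _ hψm, Set.indicator_of_mem hg]
      gcongr
      exact lintegral_errorSum_sq_le h t ω
    · have h2 : ∀ z, H (ω, z) = ψ z := fun z => by simp [hH, hg]
      simp [h2]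
  refine (lintegral_mono step2).trans (le_of_eq ?_)
  rw [lintegral_add_right _ measurable_const,
    lintegral_const_mul _ (measurable_indicator_sqError h hf hσmin hσ t)]
  simp [meanSqError]

include hc h hf hY hY2 hσmin hσ hπmin in
/-- The Lindeberg condition. -/
lemma tendsto_lindeberg : Tendsto (fun T : ℕ => (T : ℝ)⁻¹ * ∑ k ∈ Finset.range T,
    ∫ ω, min (e.increment pop γ σmin σmax πmin fStar k ω ^ 2)
      (|e.increment pop γ σmin σmax πmin fStar k ω| ^ 3 / √(T : ℝ)) ∂P) atTop (𝓝 0) := by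
  set M := boundConst σmin σmax πmin with hM
  set ψ : ℕ → ℝ≥0∞ := fun T => ∫⁻ z, ENNReal.ofReal
    (min ((2 * (2 * M * pop.envelope fStar z)) ^ 2)
        ((2 * (2 * M * pop.envelope fStar z)) ^ 3 / √(T : ℝ))) ∂pop.law with hψ
  have hEn2 : MemLp (fun z => 2 * (2 * M * pop.envelope fStar z)) 2 pop.law :=
    ((memLp_envelope hf hY hY2).const_mul _).const_mul _
  have hψlim : Tendsto ψ atTop (𝓝 0) := tendsto_lintegral_min_sq_cube
    (((measurable_envelope hf).const_mul _).const_mul _) hEn2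
  have hψfin : ∀ T, ψ T ≠ ∞ := fun T => by
    have h1 : ψ T ≤ ∫⁻ z, ‖2 * (2 * M * pop.envelope fStar z)‖ₑ ^ 2 ∂pop.law := by
      refine lintegral_mono fun z => ?_
      rw [LTwo.enorm_sq]
      exact ENNReal.ofReal_le_ofReal (min_le_left _ _)
    rw [← LTwo.eLpNorm_two_sq] at h1
    exact (h1.trans_lt (ENNReal.pow_lt_top hEn2.2)).ne
  have hefin : ∀ t, e.meanSqError P pop γ σmin σmax πmin fStar t ≠ ∞ := fun t =>
    ((meanSqError_le_one t).trans_lt ENNReal.one_lt_top).ne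
  have ψr : Tendsto (fun T => (ψ T).toReal) atTop (𝓝 0) := by
    simpa [Function.comp_def] using (ENNReal.tendsto_toReal ENNReal.zero_ne_top).comp hψlim
  have er : Tendsto (fun t => (e.meanSqError P pop γ σmin σmax πmin fStar t).toReal) atTop
      (𝓝 0) := by
    simpa [Function.comp_def] using (ENNReal.tendsto_toReal ENNReal.zero_ne_top).comp
      (tendsto_meanSqError hc h hf hσmin hσ)
  set r := √σmax / √σmin with hr
  have hr0 : 0 ≤ r := by positivity
  -- The errors enter as a Cesàro mean of a null sequence, whereas the envelope term is the same for
  -- every k and depends only on T.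
  have lim : Tendsto (fun T : ℕ => r * (32 * M ^ 2 * ((T : ℝ)⁻¹ * ∑ k ∈ Finset.range T,
      (e.meanSqError P pop γ σmin σmax πmin fStar k).toReal) + (ψ T).toReal)) atTop (𝓝 0) := by
    simpa using ((er.cesaro.const_mul (32 * M ^ 2)).add ψr).const_mul r
  have hnn : ∀ (T k : ℕ) ω, 0 ≤ min (e.increment pop γ σmin σmax πmin fStar k ω ^ 2)
      (|e.increment pop γ σmin σmax πmin fStar k ω| ^ 3 / √(T : ℝ)) := fun T k ω =>
    le_min (by positivity) (by positivity)
  have hterm : ∀ T k : ℕ, ∫ ω, min (e.increment pop γ σmin σmax πmin fStar k ω ^ 2)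
      (|e.increment pop γ σmin σmax πmin fStar k ω| ^ 3 / √(T : ℝ)) ∂P
      ≤ r * (32 * M ^ 2 * (e.meanSqError P pop γ σmin σmax πmin fStar k).toReal
        + (ψ T).toReal) := fun T k => by
    have hi := MartingaleCLT.integrable_min_sq_cube
      (h.memLp_increment (P := P) (πmin := πmin) k hf hY hY2 hσmin hσ hπmin)
      (Real.sqrt_nonneg (T : ℝ))
    rw [integral_eq_lintegral_of_nonneg_ae (ae_of_all _ (hnn T k)) hi.1]
    refine (ENNReal.toReal_mono ?_
      (lintegral_min_increment_le h hf hY hσmin hσ hπmin k T)).trans (le_of_eq ?_)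
    · exact ENNReal.mul_ne_top ENNReal.ofReal_ne_top (ENNReal.add_ne_top.2
        ⟨ENNReal.mul_ne_top ENNReal.ofReal_ne_top (hefin k), hψfin T⟩)
    · rw [ENNReal.toReal_mul, ENNReal.toReal_add
        (ENNReal.mul_ne_top ENNReal.ofReal_ne_top (hefin k)) (hψfin T), ENNReal.toReal_mul,
        ENNReal.toReal_ofReal hr0, ENNReal.toReal_ofReal (by positivity)]
  refine tendsto_of_tendsto_of_tendsto_of_le_of_le' tendsto_const_nhds lim
    (Eventually.of_forall fun T => mul_nonneg (by positivity)
      (Finset.sum_nonneg fun k _ => integral_nonneg (hnn T k))) ?_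
  filter_upwards [eventually_ge_atTop 1] with T hT
  have hT0 : (T : ℝ) ≠ 0 := by positivity
  calc _ ≤ (T : ℝ)⁻¹ * ∑ k ∈ Finset.range T,
        r * (32 * M ^ 2 * (e.meanSqError P pop γ σmin σmax πmin fStar k).toReal
          + (ψ T).toReal) := by
        gcongr with k _
        exact hterm T k
    _ = _ := by
        rw [← Finset.mul_sum, Finset.sum_add_distrib, ← Finset.mul_sum, Finset.sum_const,
          Finset.card_range, nsmul_eq_mul]
        field_simp

/-! ### The limit distribution of the estimator -/

include h hf hσmin hσ hπmin in
/-- On the good event, the truncated increment is the increment of the estimation error. -/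
lemma ae_increment_eq (t : ℕ) : ∀ᵐ ω ∂P, ω ∈ e.good pop γ σmin σmax πmin fStar t →
    (∫ x, e.μ₁ t ω x ∂pop.covLaw pop.q) + e.influence pop γ σmin σmax t ω - pop.θ
      = e.increment pop γ σmin σmax πmin fStar t ω := by
  have hs := Real.sqrt_pos.2 hσmin
  have hs2 : 0 < √σmax := Real.sqrt_pos.2 (hσmin.trans_le hσ)
  have hgm := h.measurableSet_good (πmin := πmin) t hf hσmin hσ
  have hπm := h.measurable_π t hσmin hσ
  -- At the sampled point q > 0 and π̂ ≥ πmin are needed, to reduce q/p to 1/ρ and to cancel π̂.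
  -- Both hold for population draws and pass to the sample by absolute continuity.
  have hms : MeasurableSet[(ℱ t).prod inferInstance] {z : Ω × Cov d × Side m |
      0 < pop.q z.2.1 ∧ (z.1 ∈ e.good pop γ σmin σmax πmin fStar t →
        πmin ≤ e.π pop γ σmin σmax t z.1 z.2.1)} := by
    let := ℱ t
    have hx : Measurable fun z : Ω × Cov d × Side m => (z.1, z.2.1) :=
      measurable_fst.prodMk measurable_snd.fst
    have h1 : MeasurableSet {z : Ω × Cov d × Side m | 0 < pop.q z.2.1} :=
      measurableSet_lt measurable_const (pop.measurable_q.comp measurable_snd.fst)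
    have h2 : MeasurableSet {z : Ω × Cov d × Side m | πmin ≤ e.π pop γ σmin σmax t z.1 z.2.1} :=
      measurableSet_le measurable_const (hπm.comp hx)
    have h3 : MeasurableSet {z : Ω × Cov d × Side m |
      z.1 ∈ e.good pop γ σmin σmax πmin fStar t} := measurable_fst hgm
    exact h1.inter (h3.imp h2)
  filter_upwards [h.ae_sample hσmin hσ t hms (ae_of_all _ fun ω => by
    by_cases hω : ω ∈ e.good pop γ σmin σmax πmin fStar t
    · filter_upwards [pop.ae_law_of_ae hω.2, pop.ae_law_of_ae pop.ae_q_pos] with z h1 h2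
      exact ⟨h2, fun _ => h1⟩
    · filter_upwards [pop.ae_law_of_ae pop.ae_q_pos] with z h2
      exact ⟨h2, fun h1 => absurd h1 hω⟩)] with ω hω hg
  have h1 : pop.q (e.X t ω) ≠ 0 := hω.1.ne'
  have h2 : e.π pop γ σmin σmax t ω (e.X t ω) ≠ 0 := (hπmin.trans_le (hω.2 hg)).ne'
  have h3 : e.rel pop σmin σmax t ω (e.X t ω) ≠ 0 := ((div_pos hs hs2).trans_le
    (rel_mem_Icc hσmin hσ (h.measurable_α_right t ω) _).1).ne'
  have h4 : e.τ₁ t ω (e.X t ω) (e.F t ω) = e.pred t ω (e.X t ω, e.sample t ω) := rfl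
  simp only [increment, truncA, truncB, Set.indicator, Set.mem_preimage, hg, if_true, stepA, stepB,
    influence, p_eq, h4]
  simp only [sample]
  field_simp
  ring

lemma sqrt_mul_estimator_sub (T : ℕ) (hT : T ≠ 0) (ω : Ω) :
    √(T : ℝ) * (e.estimator pop γ σmin σmax T ω - pop.θ) = (√(T : ℝ))⁻¹ * ∑ t ∈ Finset.range T,
      ((∫ x, e.μ₁ t ω x ∂pop.covLaw pop.q) + e.influence pop γ σmin σmax t ω - pop.θ) := by
  have hT0 : (0 : ℝ) < T := by positivity
  have h1 : √(T : ℝ) * √(T : ℝ) = T := Real.mul_self_sqrt hT0.le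
  have h2 : √(T : ℝ) ≠ 0 := (Real.sqrt_pos.2 hT0).ne'
  rw [estimator, Finset.sum_sub_distrib, Finset.sum_const, Finset.card_range, nsmul_eq_mul]
  set S := ∑ t ∈ Finset.range T,
    ((∫ x, e.μ₁ t ω x ∂pop.covLaw pop.q) + e.influence pop γ σmin σmax t ω)
  field_simp
  rw [pow_two, h1]

include hc h hf hY hY2 hγ hσmin hσ hπmin in
/-- The adaptive one-step estimator is asymptotically normal. -/
theorem tendstoInDistribution_estimator
    (hα : ∀ᵐ x ∂pop.covLaw pop.q, pop.α fStar x ∈ Set.Icc σmin σmax) :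
    TendstoInDistribution
        (fun (T : ℕ) ω => √(T : ℝ) * (e.estimator pop γ σmin σmax T ω - pop.θ)) atTop
        (fun z : ℝ => z) (fun _ => P)
        (gaussianReal 0 (pop.V fStar (pop.pStar fStar) (pop.πStar fStar γ)).toNNReal) := by
  have hclt := MartingaleCLT.tendstoInDistribution_inv_sqrt_mul_sum_martingale (P := P) (ℱ := ℱ)
    (D := fun k => e.increment pop γ σmin σmax πmin fStar k)
    (v := fun k => e.condVar pop γ σmin σmax πmin fStar k)
    (fun k => h.measurable_increment k hf hσmin hσ)
    (fun k => h.memLp_increment k hf hY hY2 hσmin hσ hπmin)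
    (fun k => h.condExp_increment k hf hY hY2 hγ hσmin hσ hπmin)
    (fun k => h.measurable_condVar k hf hσmin hσ)
    (fun k => h.condExp_increment_sq k hf hY hY2 hγ hσmin hσ hπmin)
    (fun k ω => h.condVar_mem_Icc k hf hY hY2 hγ hσmin hσ hπmin ω)
    (hc.mono fun ω hω => hω.tendsto_condVar h hf hY hY2 hσmin hσ hπmin hα)
    (tendsto_lindeberg hc h hf hY hY2 hσmin hσ hπmin)
  have hm1 : ∀ T : ℕ, Measurable fun ω => √(T : ℝ) * (e.estimator pop γ σmin σmax T ω - pop.θ) :=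
    fun T => ((measurable_estimator h hσmin hσ T).sub_const _).const_mul _
  have hm2 : ∀ T : ℕ, Measurable fun ω => (√(T : ℝ))⁻¹ * ∑ k ∈ Finset.range T,
      e.increment pop γ σmin σmax πmin fStar k ω := fun T =>
    (Finset.measurable_fun_sum _ fun k _ =>
      (h.measurable_increment k hf hσmin hσ).mono (ℱ.le _) le_rfl).const_mul _
  refine tendstoInDistribution_of_tendstoInMeasure_sub _ _ hclt
    (tendstoInMeasure_of_tendsto_ae (fun T => ((hm1 T).sub (hm2 T)).aestronglyMeasurable) ?_)
    fun T => (hm1 T).aemeasurable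
  filter_upwards [hc, ae_all_iff.2 fun t => ae_increment_eq (P := P) h hf hσmin hσ hπmin t]
    with ω hω heq
  obtain ⟨N, hN⟩ := eventually_atTop.1 hω.eventually_good
  -- The effect of the truncation at time t vanishes from N on, so the total discrepancy is a fixed
  -- finite sum divided by √T.
  set δ : ℕ → ℝ := fun t =>
    ((∫ x, e.μ₁ t ω x ∂pop.covLaw pop.q) + e.influence pop γ σmin σmax t ω - pop.θ)
      - e.increment pop γ σmin σmax πmin fStar t ω with hδ
  have hδ0 : ∀ t, N ≤ t → δ t = 0 := fun t ht => sub_eq_zero.2 (heq t (hN t ht))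
  have hlim : Tendsto (fun T : ℕ => (∑ t ∈ Finset.range N, δ t) / √(T : ℝ)) atTop (𝓝 0) :=
    tendsto_const_nhds.div_atTop (Real.tendsto_sqrt_atTop.comp tendsto_natCast_atTop_atTop)
  refine hlim.congr' ?_
  filter_upwards [eventually_ge_atTop (N + 1)] with T hT
  simp only [Pi.sub_apply]
  rw [sqrt_mul_estimator_sub T (by lia), ← mul_sub, ← Finset.sum_sub_distrib,
    ← Finset.sum_subset (Finset.range_subset_range.2 (by lia : N ≤ T)) fun t _ ht =>
      hδ0 t (by simpa using ht), div_eq_inv_mul]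

end Experiment

end PGAE

/-! ### Asymptotic normality and efficiency. -/

theorem mainTheorem4 {Ω : Type*} [MeasurableSpace Ω] {P : Measure Ω} [IsProbabilityMeasure P]
    {d m : ℕ} (pop : PGAE.Population d m) (e : PGAE.Experiment Ω d m)
    (ℱ : Filtration ℕ (inferInstance : MeasurableSpace Ω))
    (γ σmin σmax πmin : ℝ) (hγ : γ ∈ Set.Icc (0 : ℝ) 1) (hσmin : 0 < σmin) (hσ : σmin ≤ σmax)
    (hprotocol : e.FollowsProtocol pop γ σmin σmax P ℱ)
    (hY : Integrable (fun z : EuclideanSpace ℝ (Fin d) × EuclideanSpace ℝ (Fin m) × ℝ => z.2.2)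
      pop.law)
    -- (a) the predictor and the estimators converge almost surely
    (fStar : EuclideanSpace ℝ (Fin d) → EuclideanSpace ℝ (Fin m) → ℝ)
    (hfStar : Measurable fun z : EuclideanSpace ℝ (Fin d) × EuclideanSpace ℝ (Fin m) =>
      fStar z.1 z.2)
    (hf : ∀ᵐ ω ∂P, ∀ᵐ z ∂pop.law,
      Tendsto (fun t => e.f t ω z.1 z.2.1) atTop (𝓝 (fStar z.1 z.2.1)))
    (hμ₁ : ∀ᵐ ω ∂P, ∀ᵐ x ∂pop.covLaw pop.q,
      Tendsto (fun t => e.μ₁ t ω x) atTop (𝓝 (pop.μ x)))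
    (hμ₁_L2 : ∀ᵐ ω ∂P, Tendsto
      (fun t => eLpNorm (fun x => e.μ₁ t ω x - pop.μ x) 2 (pop.covLaw pop.q)) atTop (𝓝 0))
    (hμ₂ : ∀ᵐ ω ∂P, ∀ᵐ x ∂pop.covLaw pop.q,
      Tendsto (fun t => e.μ₂ t ω x) atTop (𝓝 (pop.μsq fStar x)))
    (hτ₁ : ∀ᵐ ω ∂P, ∀ᵐ z ∂pop.law,
      Tendsto (fun t => e.τ₁ t ω z.1 (e.f t ω z.1 z.2.1)) atTop
        (𝓝 (pop.τ fStar z.1 (fStar z.1 z.2.1))))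
    (hτ₁_L2 : ∀ᵐ ω ∂P, Tendsto
      (fun t => eLpNorm (fun z : EuclideanSpace ℝ (Fin d) × EuclideanSpace ℝ (Fin m) × ℝ =>
        e.τ₁ t ω z.1 (e.f t ω z.1 z.2.1) - pop.τ fStar z.1 (fStar z.1 z.2.1)) 2 pop.law)
      atTop (𝓝 0))
    (hτ₂ : ∀ᵐ ω ∂P, ∀ᵐ z ∂pop.law,
      Tendsto (fun t => e.τ₂ t ω z.1 (e.f t ω z.1 z.2.1)) atTop
        (𝓝 (pop.τsq fStar z.1 (fStar z.1 z.2.1))))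
    (hβ : ∀ᵐ ω ∂P, ∀ᵐ x ∂pop.covLaw pop.q,
      Tendsto (fun t => e.β t ω x) atTop (𝓝 (pop.β fStar x)))
    (hβ_L1 : ∀ᵐ ω ∂P, Tendsto
      (fun t => eLpNorm (fun x => e.β t ω x - pop.β fStar x) 1 (pop.covLaw pop.q)) atTop (𝓝 0))
    -- (b) the centered outcome and the centered covariate are sub-Gaussian
    (cX cY : ℝ≥0)
    (hsubY : HasSubgaussianMGF
      (fun z : EuclideanSpace ℝ (Fin d) × EuclideanSpace ℝ (Fin m) × ℝ => z.2.2 - pop.μ z.1)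
      cY pop.law)
    (hsubX : ∀ u : EuclideanSpace ℝ (Fin d), ‖u‖ = 1 → HasSubgaussianMGF
      (fun x => inner ℝ u (x - ∫ x', x' ∂pop.covLaw pop.q)) cX (pop.covLaw pop.q))
    -- the truncation does not cut off the true variance, and overlap
    (hα : ∀ᵐ x ∂pop.covLaw pop.q, pop.α fStar x ∈ Set.Icc σmin σmax)
    (hπmin : 0 < πmin)
    (hπ : ∀ᵐ ω ∂P, ∀ t, ∀ᵐ x ∂pop.covLaw pop.q, πmin ≤ e.π pop γ σmin σmax t ω x) :
    TendstoInDistribution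
        (fun (T : ℕ) ω => √(T : ℝ) * (e.estimator pop γ σmin σmax T ω - pop.θ)) atTop
        (fun z : ℝ => z) (fun _ => P)
        (gaussianReal 0 (pop.V fStar (pop.pStar fStar) (pop.πStar fStar γ)).toNNReal) ∧
      pop.IsEfficiencyBound fStar (pop.pStar fStar) (pop.πStar fStar γ)
        (pop.V fStar (pop.pStar fStar) (pop.πStar fStar γ)) := by
  have hY2 := hsubY.memLp 2
  have hc : ∀ᵐ ω ∂P, e.ConvergesAt pop γ σmin σmax πmin fStar ω := by
    filter_upwards [hμ₁, hμ₁_L2, hμ₂, hτ₁_L2, hβ, hβ_L1, hπ] with ω h1 h2 h3 h4 h5 h6 h7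
    exact ⟨h1, h2, h3, h4, h5, h6, h7⟩
  -- The efficiency claim is deterministic; a single convergent trajectory suffices to give the
  -- lower bound on π*, or else β = 0.
  obtain ⟨ω, hω⟩ := hc.exists
  refine ⟨PGAE.Experiment.tendstoInDistribution_estimator hc hprotocol hfStar hY hY2 hγ.1 hσmin hσ
    hπmin hα, ?_⟩
  exact PGAE.Population.isEfficiencyBound_V hfStar hY hY2 hσmin
    (PGAE.Population.measurable_α hfStar) hα (hα.mono fun x hx => hx.1)
    (PGAE.Population.measurable_expProb γ (PGAE.Population.measurable_α hfStar)
      (PGAE.Population.measurable_β hfStar))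
    (PGAE.Population.expProb_mem_Icc hγ.1 _ _) hπmin
    (hω.le_πStar_or hprotocol hfStar hY hY2 hσmin hσ hα)
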